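/- Let $1<p<2$. Then there is an exponent $\alpha=\alpha(p)\in(0,1/p)$ with the following property. Let $\Omega,X\subset\mathbb{R}^2\equiv\mathbb{C}$ be bounded domains with $\overline\Omega\subset X$, let $\chi\in C_0^\infty(X)$ satisfy $\chi\equiv1$ on $\Omega$, and let $q_1,q_2\in L^p(\Omega)$ be complex-valued, extended by zero outside $\Omega$. Let $\beta_1,\beta_2:\mathbb{C}\to\mathbb{C}$ be bounded. For $\tau>1$ and $z_0\in\mathbb{C}$ put $\Phi(z)=(z-z_0)^2$, and let $$\overline\partial^{-1}u(z)=\frac1\pi\int_{\mathbb{C}}\frac{u(w)}{z-w}\,dm(w),\qquad \partial^{-1}u(z)=\frac1\pi\int_{\mathbb{C}}\frac{u(w)}{\overline z-\overline w}\,dm(w).$$ Define $$S_1f=-\tfrac14\,\overline\partial^{-1}\big(e^{-i\tau(\Phi+\overline\Phi)}\chi\,\partial^{-1}(e^{i\tau(\Phi+\overline\Phi)}q_1f)\big),\qquad S_2f=-\tfrac14\,\partial^{-1}\big(e^{-i\tau(\Phi+\overline\Phi)}\chi\,\overline\partial^{-1}(e^{i\tau(\Phi+\overline\Phi)}q_2f)\big),$$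 $$\varphi_1=\tfrac14\,\overline\partial^{-1}\big(e^{-i\tau(\Phi+\overline\Phi)}\chi\,(\beta_1(z_0)-\partial^{-1}q_1)\big),\qquad \varphi_2=\tfrac14\,\partial^{-1}\big(e^{-i\tau(\Phi+\overline\Phi)}\chi\,(\beta_2(z_0)-\overline\partial^{-1}q_2)\big),$$ and $F_{j,0}=e^{-i\tau(\Phi+\overline\Phi)}$, $F_{j,m}=S_j^{m-1}\varphi_j$ for $m\ge1$, $f_j=\sum_{m=0}^\infty F_{j,m}$. Then for $j\in\{1,2\}$ there are constants $C>0$ and $\tau_0\ge1$, depending only on $p$, $\chi$, $q_j$ and an upper bound for $\sup_{z_0}|\beta_j(z_0)|$, such that for every $z_0\in\mathbb{C}$: 1. for all $\tau>1$ the functions $\varphi_j$ and $F_{j,m}$ are well defined (in each application of a Cauchy operator above, the inner integral converges absolutely almost everywhere and the outer one everywhere), and $\sup_{z\in X}|F_{j,m}(z)|\le(C\tau^{-\alpha})^m$ for all $m\ge0$; 2. for all $\tau>\tau_0$ the series $\sum_{m}F_{j,m}$ converges to $f_j$ uniformly on $X$, and $f_j\in W^{1,2}(X)$; 3. for all $\tau>\tau_0$,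 in the sense of distributions in $\Omega$, $(\Delta+q_1)(e^{i\tau\Phi}f_1)=0$ if $j=1$, and $(\Delta+q_2)(e^{i\tau\overline\Phi}f_2)=0$ if $j=2$. -/

import Mathlib

open MeasureTheory Filter
open scoped ContDiff ComplexConjugate

noncomputable section

namespace BukhgeimCGO

/-- The standing assumptions on the domains `Ω`, `X` in the plane `ℂ ≅ ℝ²` and on the cut-off
function `χ`: both are bounded domains, the closure of `Ω` is contained in `X`, and
`χ ∈ C₀^∞(X)` is identically `1` on `Ω`. -/
structure UsualAssumptions (Ω X : Set ℂ) (χ : ℂ → ℂ) : Prop where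
  isOpen_inner : IsOpen Ω
  isConnected_inner : IsConnected Ω
  isBounded_inner : Bornology.IsBounded Ω
  isOpen_outer : IsOpen X
  isConnected_outer : IsConnected X
  isBounded_outer : Bornology.IsBounded X
  closure_subset : closure Ω ⊆ X
  smooth_cutoff : ContDiff ℝ ∞ χ
  compact_cutoff : HasCompactSupport χ
  tsupport_cutoff : tsupport χ ⊆ X
  cutoff_eq_one : ∀ z ∈ Ω, χ z = 1

/-! ### Cauchy operators -/

/-- `∂̄⁻¹ u = (1 / (π z)) * u` (convolution with respect to Lebesgue measure on `ℂ`). -/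
def dbarInv (u : ℂ → ℂ) (z : ℂ) : ℂ := (1 / (Real.pi : ℂ)) * ∫ w, u w / (z - w)

/-- `∂⁻¹ u = (1 / (π z̄)) * u`. -/
def dInv (u : ℂ → ℂ) (z : ℂ) : ℂ := (1 / (Real.pi : ℂ)) * ∫ w, u w / conj (z - w)

/-- The integral defining `∂̄⁻¹ u` at `z` converges absolutely. -/
def DbarInvConverges (u : ℂ → ℂ) (z : ℂ) : Prop := Integrable (fun w : ℂ => u w / (z - w))

/-- The integral defining `∂⁻¹ u` at `z` converges absolutely. -/
def DInvConverges (u : ℂ → ℂ) (z : ℂ) : Prop := Integrable (fun w : ℂ => u w / conj (z - w))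

/-! ### The phase -/

/-- The phase `Φ(z) = (z - z₀)²`. -/
def Phi (z₀ z : ℂ) : ℂ := (z - z₀) ^ 2

/-- The unimodular function `exp (i s (Φ + Φ̄))`; it is used with `s = τ` and `s = -τ`. -/
def osc (s : ℝ) (z₀ z : ℂ) : ℂ :=
  Complex.exp (Complex.I * s * (Phi z₀ z + conj (Phi z₀ z)))

/-! ### The operators `S₁`, `S₂`

In all that follows `q` is a potential on `Ω`, extended by zero to `ℂ`. -/

/-- `e^{-iτ(Φ+Φ̄)} χ ∂⁻¹ (e^{iτ(Φ+Φ̄)} q f)`. -/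
def S₁Density (χ q : ℂ → ℂ) (τ : ℝ) (z₀ : ℂ) (f : ℂ → ℂ) (w : ℂ) : ℂ :=
  osc (-τ) z₀ w * χ w * dInv (fun v => osc τ z₀ v * q v * f v) w

/-- `S₁ f = -(1/4) ∂̄⁻¹ (e^{-iτ(Φ+Φ̄)} χ ∂⁻¹ (e^{iτ(Φ+Φ̄)} q f))`. -/
def S₁ (χ q : ℂ → ℂ) (τ : ℝ) (z₀ : ℂ) (f : ℂ → ℂ) (z : ℂ) : ℂ :=
  -(1 / 4) * dbarInv (S₁Density χ q τ z₀ f) z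

/-- The integrals defining `S₁ f` converge: the inner one almost everywhere, the outer one
at every point. -/
def S₁Converges (χ q : ℂ → ℂ) (τ : ℝ) (z₀ : ℂ) (f : ℂ → ℂ) : Prop :=
  (∀ᵐ w : ℂ, DInvConverges (fun v => osc τ z₀ v * q v * f v) w) ∧
    ∀ z : ℂ, DbarInvConverges (S₁Density χ q τ z₀ f) z

/-- `e^{-iτ(Φ+Φ̄)} χ ∂̄⁻¹ (e^{iτ(Φ+Φ̄)} q f)`. -/
def S₂Density (χ q : ℂ → ℂ) (τ : ℝ) (z₀ : ℂ) (f : ℂ → ℂ) (w : ℂ) : ℂ :=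
  osc (-τ) z₀ w * χ w * dbarInv (fun v => osc τ z₀ v * q v * f v) w

/-- `S₂ f = -(1/4) ∂⁻¹ (e^{-iτ(Φ+Φ̄)} χ ∂̄⁻¹ (e^{iτ(Φ+Φ̄)} q f))`. -/
def S₂ (χ q : ℂ → ℂ) (τ : ℝ) (z₀ : ℂ) (f : ℂ → ℂ) (z : ℂ) : ℂ :=
  -(1 / 4) * dInv (S₂Density χ q τ z₀ f) z

/-- The integrals defining `S₂ f` converge: the inner one almost everywhere, the outer one
at every point. -/
def S₂Converges (χ q : ℂ → ℂ) (τ : ℝ) (z₀ : ℂ) (f : ℂ → ℂ) : Prop :=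
  (∀ᵐ w : ℂ, DbarInvConverges (fun v => osc τ z₀ v * q v * f v) w) ∧
    ∀ z : ℂ, DInvConverges (S₂Density χ q τ z₀ f) z

/-! ### The functions `φ₁`, `φ₂`; here `b` stands for the number `β_j(z₀)` -/

/-- `e^{-iτ(Φ+Φ̄)} χ (b - ∂⁻¹ q)`. -/
def φ₁Density (χ q : ℂ → ℂ) (τ : ℝ) (z₀ b : ℂ) (w : ℂ) : ℂ :=
  osc (-τ) z₀ w * χ w * (b - dInv q w)

/-- `φ₁ = (1/4) ∂̄⁻¹ (e^{-iτ(Φ+Φ̄)} χ (b - ∂⁻¹ q))`. -/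
def φ₁ (χ q : ℂ → ℂ) (τ : ℝ) (z₀ b : ℂ) (z : ℂ) : ℂ :=
  (1 / 4) * dbarInv (φ₁Density χ q τ z₀ b) z

/-- The integrals defining `φ₁` converge. -/
def φ₁Converges (χ q : ℂ → ℂ) (τ : ℝ) (z₀ b : ℂ) : Prop :=
  (∀ᵐ w : ℂ, DInvConverges q w) ∧ ∀ z : ℂ, DbarInvConverges (φ₁Density χ q τ z₀ b) z

/-- `e^{-iτ(Φ+Φ̄)} χ (b - ∂̄⁻¹ q)`. -/
def φ₂Density (χ q : ℂ → ℂ) (τ : ℝ) (z₀ b : ℂ) (w : ℂ) : ℂ :=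
  osc (-τ) z₀ w * χ w * (b - dbarInv q w)

/-- `φ₂ = (1/4) ∂⁻¹ (e^{-iτ(Φ+Φ̄)} χ (b - ∂̄⁻¹ q))`. -/
def φ₂ (χ q : ℂ → ℂ) (τ : ℝ) (z₀ b : ℂ) (z : ℂ) : ℂ :=
  (1 / 4) * dInv (φ₂Density χ q τ z₀ b) z

/-- The integrals defining `φ₂` converge. -/
def φ₂Converges (χ q : ℂ → ℂ) (τ : ℝ) (z₀ b : ℂ) : Prop :=
  (∀ᵐ w : ℂ, DbarInvConverges q w) ∧ ∀ z : ℂ, DInvConverges (φ₂Density χ q τ z₀ b) z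

/-! ### The series -/

/-- `F_{1,0} = e^{-iτ(Φ+Φ̄)}` and `F_{1,m} = S₁^{m-1} φ₁` for `m ≥ 1`. -/
def F₁ (χ q : ℂ → ℂ) (τ : ℝ) (z₀ b : ℂ) : ℕ → ℂ → ℂ
  | 0 => osc (-τ) z₀
  | m + 1 => (S₁ χ q τ z₀)^[m] (φ₁ χ q τ z₀ b)

/-- `F_{2,0} = e^{-iτ(Φ+Φ̄)}` and `F_{2,m} = S₂^{m-1} φ₂` for `m ≥ 1`. -/
def F₂ (χ q : ℂ → ℂ) (τ : ℝ) (z₀ b : ℂ) : ℕ → ℂ → ℂ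
  | 0 => osc (-τ) z₀
  | m + 1 => (S₂ χ q τ z₀)^[m] (φ₂ χ q τ z₀ b)

/-- `f₁ = ∑_{m ≥ 0} F_{1,m}`. -/
def f₁ (χ q : ℂ → ℂ) (τ : ℝ) (z₀ b : ℂ) (z : ℂ) : ℂ := ∑' m, F₁ χ q τ z₀ b m z

/-- `f₂ = ∑_{m ≥ 0} F_{2,m}`. -/
def f₂ (χ q : ℂ → ℂ) (τ : ℝ) (z₀ b : ℂ) (z : ℂ) : ℂ := ∑' m, F₂ χ q τ z₀ b m z

/-! ### Sobolev space and distributional solutions -/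

/-- `φ ∈ C₀^∞(U)`. -/
def IsTestFunction (U : Set ℂ) (φ : ℂ → ℂ) : Prop :=
  ContDiff ℝ ∞ φ ∧ HasCompactSupport φ ∧ tsupport φ ⊆ U

/-- `g` is the weak derivative of `f` in the direction `v` on the open set `U`. -/
def IsWeakDeriv (U : Set ℂ) (v : ℂ) (f g : ℂ → ℂ) : Prop :=
  ∀ φ : ℂ → ℂ, IsTestFunction U φ →
    ∫ z in U, f z * fderiv ℝ φ z v = -∫ z in U, g z * φ z

/-- `f ∈ W^{1,2}(U)`: `f` and its weak partial derivatives in the real directions `1` and `i`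
are in `L²(U)`. -/
def MemW12 (U : Set ℂ) (f : ℂ → ℂ) : Prop :=
  MemLp f 2 (volume.restrict U) ∧
    ∃ g₁ g₂ : ℂ → ℂ, MemLp g₁ 2 (volume.restrict U) ∧ MemLp g₂ 2 (volume.restrict U) ∧
      IsWeakDeriv U 1 f g₁ ∧ IsWeakDeriv U Complex.I f g₂

/-- `(Δ + q) u = 0` in `U` in the sense of distributions, where `u` and `q u` are
locally integrable in `U`. -/
def IsDistribSolution (U : Set ℂ) (q u : ℂ → ℂ) : Prop :=
  LocallyIntegrableOn u U ∧ LocallyIntegrableOn (fun z => q z * u z) U ∧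
    ∀ φ : ℂ → ℂ, IsTestFunction U φ →
      (∫ z in U, u z * Laplacian.laplacian φ z) + ∫ z in U, q z * u z * φ z = 0

end BukhgeimCGO

end

/-!
For a bounded function `f`, put `Q = e^{iτ(Φ+Φ̄)} q₁ f`. Summing the series term by term shows that
`f₁` solves `f = e^{-iτ(Φ+Φ̄)} + ¼ ∂̄⁻¹ (e^{-iτ(Φ+Φ̄)} χ (β₁(z₀) - ∂⁻¹ Q))` (`f₁_eq`), and that
`φ₁` and every application of `S₁` are instances of one operation, `(Q, b) ↦ φ₁ χ Q τ z₀ b`.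
The whole theorem rests on one estimate for it: for `‖Q‖ ≤ M ‖q₁‖` it is bounded by
`C τ^{-α} (‖b‖ + M)`, uniformly in `z` and `z₀` (`exists_norm_dbarInv_φ₁Density_le`).

*Decay.* In the coordinates `x + i y = z - z₀` the phase is `2τ (y² - x²)`, so averaging the
oscillating factor over a square of side `r` gives a product of two Fresnel integrals, of size
`1 / (τ r²)`. Replacing the amplitude `a(w) = χ(w) (z - w)⁻¹ (b - ∂⁻¹ Q(w))` by its translates costs
its `L¹` modulus of continuity at scale `r`. This is `norm_integral_osc_mul_le`. The amplitude is
Hölder continuous in `L¹` with exponent `holderExp p`: both Cauchy kernels obey a fractional Hölder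
estimate at the price of a slightly stronger singularity, and as `p > 1` Young's inequality absorbs
the composed kernel into `‖q₁‖^p` times an integrable weight plus a product of two integrable weights
(`mul_wt_mul_wt_le`, `exists_double_lintegral_le`). The choice `r = τ^{-1/4}` gives
`α = holderExp p / 4`. Bounds, convergence and measurability of the series follow by iteration.

*Regularity.* The density `e^{-iτ(Φ+Φ̄)} χ (b - ∂⁻¹ Q)` is in `L²`, because `p > 1` makes `∂⁻¹ Q`
locally square integrable. For a test function `φ` the energy identity gives
`‖∇ ∂̄⁻¹ φ‖₂ ≲ ‖φ‖₂` on bounded sets; testing against `∇φ` and moving `∂̄⁻¹` across by Fubini, one sees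
that the distributional gradient of `∂̄⁻¹ Ψ` is a bounded functional on `L²` whenever `Ψ ∈ L²`.
Hahn–Banach and the Riesz representation make it an `L²` function (`exists_memLp_integral_eq`,
`exists_isWeakDeriv_dbarInv`).

*Equation.* With `∂̄⁻¹` and `∂⁻¹` moved onto test functions, where the Cauchy–Pompeiu formula inverts
them, the fixed-point equation gives `4 ∂̄ f₁ = 4 ∂̄ e^{-iτ(Φ+Φ̄)} + e^{-iτ(Φ+Φ̄)} (b - ∂⁻¹ Q)` on `Ω`. As
`e^{iτΦ}` is holomorphic and `e^{-iτΦ̄}` antiholomorphic, applying `∂` to `e^{iτΦ}` times this leaves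
`Δ (e^{iτΦ} f₁) = -e^{-iτΦ̄} Q = -q₁ e^{iτΦ} f₁` (`isDistribSolution_of_eq`).

*Second family.* The reflection `z ↦ z̄` exchanges `∂⁻¹` and `∂̄⁻¹` and turns the phase at `z₀` into the
phase at `z̄₀`, so the case `j = 2` is the case `j = 1` for the reflected data.
-/

namespace BukhgeimCGO

/-! ### Oscillatory integrals with a quadratic phase -/

theorem norm_exp_quadratic (c x : ℝ) : ‖Complex.exp (Complex.I * c * x ^ 2)‖ = 1 := by
  rw [show Complex.I * c * x ^ 2 = ((c * x ^ 2 : ℝ) : ℂ) * Complex.I by push_cast; ring]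
  exact Complex.norm_exp_ofReal_mul_I _

theorem continuous_exp_quadratic (c : ℝ) :
    Continuous (fun x : ℝ => Complex.exp (Complex.I * c * x ^ 2)) := by fun_prop

/-- Away from the stationary point one integration by parts bounds the Fresnel integral. -/
theorem norm_fresnel_tail_le {c A B : ℝ} (hc : c ≠ 0) (hA : 0 < A) (hAB : A ≤ B) :
    ‖∫ x in A..B, Complex.exp (Complex.I * c * x ^ 2)‖ ≤ 1 / (|c| * A) := by
  have hB : 0 < B := hA.trans_le hAB
  have hpos : ∀ x ∈ Set.uIcc A B, 0 < x := fun x hx => by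
    rw [Set.uIcc_of_le hAB] at hx; exact hA.trans_le hx.1
  have hcC : (c : ℂ) ≠ 0 := by exact_mod_cast hc
  set u : ℝ → ℂ := fun x => (2 * Complex.I * c)⁻¹ * ((x⁻¹ : ℝ) : ℂ) with hu
  set u' : ℝ → ℂ := fun x => (2 * Complex.I * c)⁻¹ * ((-(x ^ 2)⁻¹ : ℝ) : ℂ) with hu'
  set v : ℝ → ℂ := fun x => Complex.exp (Complex.I * c * x ^ 2) with hv
  set v' : ℝ → ℂ := fun x => v x * (Complex.I * c * (2 * x)) with hv'
  have hud : ∀ x ∈ Set.uIcc A B, HasDerivAt u (u' x) x := fun x hx =>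
    ((hasDerivAt_inv (hpos x hx).ne').ofReal_comp).const_mul _
  have hvd : ∀ x ∈ Set.uIcc A B, HasDerivAt v (v' x) x := fun x _ => by
    have h1 : HasDerivAt (fun y : ℝ => Complex.I * c * (y : ℂ) ^ 2) (Complex.I * c * (2 * x)) x := by
      have := ((hasDerivAt_id (x : ℂ)).pow 2).comp_ofReal
      simpa using this.const_mul (Complex.I * c)
    exact h1.cexp
  have hu'c : ContinuousOn u' (Set.uIcc A B) := by
    refine continuousOn_const.mul (Complex.continuous_ofReal.comp_continuousOn ?_)
    refine ContinuousOn.neg (ContinuousOn.inv₀ (by fun_prop) fun x hx => ?_)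
    exact pow_ne_zero _ (hpos x hx).ne'
  have hv'c : Continuous v' := by simp only [hv', hv]; fun_prop
  have hparts := intervalIntegral.integral_mul_deriv_eq_deriv_mul hud hvd
    hu'c.intervalIntegrable (hv'c.intervalIntegrable _ _)
  have hleft : ∫ x in A..B, v x = ∫ x in A..B, u x * v' x := by
    refine intervalIntegral.integral_congr fun x hx => ?_
    have hx0 : (x : ℂ) ≠ 0 := by exact_mod_cast (hpos x hx).ne'
    simp only [hu, hv']
    push_cast
    field_simp
  have hK : ‖(2 * Complex.I * (c : ℂ))⁻¹‖ = 1 / (2 * |c|) := by simp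
  have hrem : ‖∫ x in A..B, u' x * v x‖ ≤ 1 / (2 * |c|) * (A⁻¹ - B⁻¹) := by
    have hint : ∫ x in A..B, 1 / (2 * |c|) * (x ^ 2)⁻¹ = 1 / (2 * |c|) * (A⁻¹ - B⁻¹) := by
      rw [intervalIntegral.integral_const_mul]
      congr 1
      have := intervalIntegral.integral_eq_sub_of_hasDerivAt (a := A) (b := B)
        (f := fun x : ℝ => -x⁻¹) (f' := fun x => (x ^ 2)⁻¹)
        (fun x hx => by
          have := (hasDerivAt_inv (hpos x hx).ne').neg
          rw [neg_neg] at this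
          exact this)
        (ContinuousOn.intervalIntegrable (ContinuousOn.inv₀ (by fun_prop) fun x hx =>
          pow_ne_zero _ (hpos x hx).ne'))
      rw [this]; ring
    rw [← hint]
    refine intervalIntegral.norm_integral_le_of_norm_le hAB ?_ ?_
    · refine Eventually.of_forall fun x _ => ?_
      simp only [hu', hv, norm_mul, hK, norm_exp_quadratic, Complex.norm_real]
      simp
    · refine (continuousOn_const.mul (ContinuousOn.inv₀ (by fun_prop) fun x hx => ?_)).intervalIntegrable
      exact pow_ne_zero _ (hpos x hx).ne'
  have hend : ∀ x, 0 < x → ‖u x * v x‖ = 1 / (2 * |c|) * x⁻¹ := fun x hx => by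
    simp only [hu, hv, norm_mul, hK, norm_exp_quadratic, Complex.norm_real, Real.norm_eq_abs,
      abs_inv, abs_of_pos hx, mul_one]
  have hc' : 0 < |c| := abs_pos.mpr hc
  calc ‖∫ x in A..B, v x‖ = ‖u B * v B - u A * v A - ∫ x in A..B, u' x * v x‖ := by
        rw [hleft, hparts]
    _ ≤ ‖u B * v B‖ + ‖u A * v A‖ + ‖∫ x in A..B, u' x * v x‖ :=
        (norm_sub_le _ _).trans (add_le_add_left (norm_sub_le _ _) _)
    _ ≤ 1 / (2 * |c|) * B⁻¹ + 1 / (2 * |c|) * A⁻¹ + 1 / (2 * |c|) * (A⁻¹ - B⁻¹) := by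
        rw [hend B hB, hend A hA]; gcongr
    _ = 1 / (|c| * A) := by field_simp; ring

theorem norm_fresnel_zero_le {c x : ℝ} (hc : c ≠ 0) (hx : 0 ≤ x) :
    ‖∫ t in (0 : ℝ)..x, Complex.exp (Complex.I * c * t ^ 2)‖ ≤ 2 / √|c| := by
  have hc' : 0 < √|c| := Real.sqrt_pos.mpr (abs_pos.mpr hc)
  -- the splitting point `1 / √|c|` balances the trivial bound against the tail bound
  set δ : ℝ := 1 / √|c| with hδ
  have hδ0 : 0 < δ := by positivity
  have htriv : ∀ y, 0 ≤ y → ‖∫ t in (0 : ℝ)..y, Complex.exp (Complex.I * c * t ^ 2)‖ ≤ y :=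
    fun y hy => by
      have := intervalIntegral.norm_integral_le_of_norm_le_const (a := 0) (b := y) (C := 1)
        (f := fun t : ℝ => Complex.exp (Complex.I * c * t ^ 2))
        (fun t _ => (norm_exp_quadratic c t).le)
      simpa [abs_of_nonneg hy] using this
  have h2 : 2 / √|c| = δ + δ := by rw [hδ]; ring
  rcases le_total x δ with h | h
  · rw [h2]; linarith [htriv x hx]
  · have hint : ∀ a b : ℝ, IntervalIntegrable
        (fun t : ℝ => Complex.exp (Complex.I * c * t ^ 2)) volume a b := fun a b =>
      (continuous_exp_quadratic c).intervalIntegrable _ _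
    rw [← intervalIntegral.integral_add_adjacent_intervals (hint 0 δ) (hint δ x), h2]
    refine (norm_add_le _ _).trans (add_le_add (htriv δ hδ0.le) ?_)
    refine (norm_fresnel_tail_le hc hδ0 h).trans (le_of_eq ?_)
    have : |c| = √|c| * √|c| := (Real.mul_self_sqrt (abs_nonneg c)).symm
    rw [hδ]
    nth_rewrite 1 [this]
    field_simp

/-- Fresnel integrals are `O(|c|^{-1/2})`, uniformly in the interval. -/
theorem norm_fresnel_le {c : ℝ} (hc : c ≠ 0) (a b : ℝ) :
    ‖∫ t in a..b, Complex.exp (Complex.I * c * t ^ 2)‖ ≤ 4 / √|c| := by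
  have hall : ∀ x : ℝ, ‖∫ t in (0 : ℝ)..x, Complex.exp (Complex.I * c * t ^ 2)‖ ≤ 2 / √|c| := by
    intro x
    rcases le_total 0 x with h | h
    · exact norm_fresnel_zero_le hc h
    · have h1 := norm_fresnel_zero_le hc (neg_nonneg.mpr h)
      have h2 := intervalIntegral.integral_comp_neg (a := 0) (b := x)
        (fun t : ℝ => Complex.exp (Complex.I * c * t ^ 2))
      simp only [neg_zero, Complex.ofReal_neg, neg_sq] at h2
      rw [h2, intervalIntegral.integral_symm, norm_neg]
      exact h1
  have hint : ∀ a b : ℝ, IntervalIntegrable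
      (fun t : ℝ => Complex.exp (Complex.I * c * t ^ 2)) volume a b := fun a b =>
    (continuous_exp_quadratic c).intervalIntegrable _ _
  rw [← intervalIntegral.integral_interval_sub_left (hint 0 b) (hint 0 a)]
  refine (norm_sub_le _ _).trans ((add_le_add (hall b) (hall a)).trans (le_of_eq ?_))
  ring

theorem osc_eq_exp_re (s : ℝ) (z₀ z : ℂ) :
    osc s z₀ z = Complex.exp (((2 * s * (Phi z₀ z).re : ℝ) : ℂ) * Complex.I) := by
  rw [osc, Complex.add_conj]; congr 1; push_cast; ring

theorem norm_osc (s : ℝ) (z₀ z : ℂ) : ‖osc s z₀ z‖ = 1 := by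
  rw [osc_eq_exp_re]; exact Complex.norm_exp_ofReal_mul_I _

theorem continuous_osc (s : ℝ) (z₀ : ℂ) : Continuous (osc s z₀) := by
  unfold osc Phi; fun_prop

theorem osc_mul_osc_neg (s : ℝ) (z₀ z : ℂ) : osc s z₀ z * osc (-s) z₀ z = 1 := by
  rw [osc, osc, ← Complex.exp_add]
  simp

/-- A translate of the phase splits into a product of two one-dimensional Fresnel phases. -/
theorem osc_add (s : ℝ) (z₀ w : ℂ) (a b : ℝ) :
    osc s z₀ (w + (a + b * Complex.I)) =
      Complex.exp (Complex.I * (2 * s : ℝ) * (((w - z₀).re + a : ℝ) : ℂ) ^ 2) *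
        Complex.exp (Complex.I * (-(2 * s) : ℝ) * (((w - z₀).im + b : ℝ) : ℂ) ^ 2) := by
  rw [osc_eq_exp_re, ← Complex.exp_add]
  congr 1
  have : (Phi z₀ (w + (a + b * Complex.I))).re = ((w - z₀).re + a) ^ 2 - ((w - z₀).im + b) ^ 2 := by
    simp [Phi, pow_two, Complex.mul_re]; ring
  rw [this]; push_cast; ring

theorem norm_integral_osc_shift_le {s : ℝ} (hs : s ≠ 0) {r : ℝ} (hr : 0 ≤ r) (z₀ w : ℂ) :
    ‖∫ q : ℝ × ℝ, osc s z₀ (w + (q.1 + q.2 * Complex.I))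
        ∂((volume.restrict (Set.Ioc 0 r)).prod (volume.restrict (Set.Ioc 0 r)))‖ ≤ 8 / |s| := by
  have hone : ∀ (c d : ℝ), c ≠ 0 →
      ‖∫ t in Set.Ioc 0 r, Complex.exp (Complex.I * c * ((d + t : ℝ) : ℂ) ^ 2)‖ ≤ 4 / √|c| := by
    intro c d hc
    rw [← intervalIntegral.integral_of_le hr,
      intervalIntegral.integral_comp_add_left
        (fun t : ℝ => Complex.exp (Complex.I * c * (t : ℂ) ^ 2)) d]
    exact norm_fresnel_le hc _ _
  simp_rw [osc_add]
  rw [integral_prod_mul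
    (fun a : ℝ => Complex.exp (Complex.I * (2 * s : ℝ) * (((w - z₀).re + a : ℝ) : ℂ) ^ 2))
    (fun b : ℝ => Complex.exp (Complex.I * (-(2 * s) : ℝ) * (((w - z₀).im + b : ℝ) : ℂ) ^ 2)),
    norm_mul]
  have h2s : (2 * s : ℝ) ≠ 0 := by simpa using hs
  have h1 := hone (2 * s) (w - z₀).re h2s
  have h2 := hone (-(2 * s)) (w - z₀).im (neg_ne_zero.mpr h2s)
  rw [abs_neg] at h2
  refine (mul_le_mul h1 h2 (norm_nonneg _) (by positivity)).trans (le_of_eq ?_)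
  rw [div_mul_div_comm, Real.mul_self_sqrt (abs_nonneg _), abs_mul, abs_two]
  have : |s| ≠ 0 := abs_ne_zero.mpr hs
  field_simp
  norm_num

/-- Averaging over translations of size `r`: the oscillatory integral of an integrable `H` is
controlled by `‖H‖₁ / (|s| r²)` plus the `L¹` modulus of continuity of `H` at scale `r`. -/
theorem norm_integral_osc_mul_le {s : ℝ} (hs : s ≠ 0) {r : ℝ} (hr : 0 < r) (z₀ : ℂ) {H : ℂ → ℂ}
    (hH : Integrable H) {δ : ℝ}
    (hδ : ∀ a ∈ Set.Ioc 0 r, ∀ b ∈ Set.Ioc 0 r,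
      ∫ w, ‖H (w + (a + b * Complex.I)) - H w‖ ≤ δ) :
    ‖∫ w, osc s z₀ w * H w‖ ≤ 8 / (|s| * r ^ 2) * (∫ w, ‖H w‖) + δ := by
  set μ : Measure ℝ := volume.restrict (Set.Ioc 0 r) with hμ
  set P : Measure (ℝ × ℝ) := μ.prod μ with hP
  set sh : ℝ × ℝ → ℂ := fun q => q.1 + q.2 * Complex.I with hsh
  have hshc : Continuous sh := by simp only [hsh]; fun_prop
  have hPreal : P.real Set.univ = r ^ 2 := by
    simp [hP, hμ, Measure.real, ← Set.univ_prod_univ, Measure.prod_prod, hr.le, pow_two]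
  set I₀ := ∫ w, osc s z₀ w * H w with hI₀
  set J : ℝ × ℝ → ℂ := fun q => ∫ w, osc s z₀ (w + sh q) * H w with hJ
  have hocont : Continuous fun x : (ℝ × ℝ) × ℂ => osc s z₀ (x.2 + sh x.1) :=
    (continuous_osc s z₀).comp (by fun_prop)
  have hint : Integrable (fun x : (ℝ × ℝ) × ℂ => osc s z₀ (x.2 + sh x.1) * H x.2)
      (P.prod volume) := by
    have h1 : Integrable (fun x : (ℝ × ℝ) × ℂ => H x.2) (P.prod volume) := hH.comp_snd P
    exact h1.bdd_mul (c := 1) hocont.aestronglyMeasurable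
      (Eventually.of_forall fun x => (norm_osc _ _ _).le)
  have hJint : Integrable J P := hint.integral_prod_left
  have hoscH : ∀ q, Integrable (fun w => osc s z₀ (w + sh q) * H w) := fun q =>
    hH.bdd_mul (c := 1) ((continuous_osc s z₀).comp (by fun_prop)).aestronglyMeasurable
      (Eventually.of_forall fun x => (norm_osc _ _ _).le)
  have hoscH' : ∀ q, Integrable (fun w => osc s z₀ (w + sh q) * H (w + sh q)) := fun q =>
    (hH.comp_add_right (sh q)).bdd_mul (c := 1)
      ((continuous_osc s z₀).comp (by fun_prop)).aestronglyMeasurable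
      (Eventually.of_forall fun x => (norm_osc _ _ _).le)
  have hdiff : ∀ᵐ q ∂P, ‖I₀ - J q‖ ≤ δ := by
    have hmem : ∀ᵐ q ∂P, q ∈ Set.Ioc 0 r ×ˢ Set.Ioc 0 r := by
      rw [hP, hμ, Measure.prod_restrict]
      exact ae_restrict_mem (measurableSet_Ioc.prod measurableSet_Ioc)
    filter_upwards [hmem] with q hq
    have h1 : I₀ = ∫ w, osc s z₀ (w + sh q) * H (w + sh q) :=
      (integral_add_right_eq_self (fun w => osc s z₀ w * H w) (sh q)).symm
    rw [h1, hJ, ← integral_sub (hoscH' q) (hoscH q)]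
    refine (norm_integral_le_integral_norm _).trans ((le_of_eq ?_).trans (hδ q.1 hq.1 q.2 hq.2))
    refine integral_congr_ae (Eventually.of_forall fun w => ?_)
    simp only [← mul_sub, norm_mul, norm_osc, one_mul, hsh]
  have hswap : ∫ q, J q ∂P = ∫ w, (∫ q, osc s z₀ (w + sh q) ∂P) * H w := by
    rw [hJ, integral_integral_swap hint]
    simp_rw [integral_mul_const]
  have hJle : ‖∫ q, J q ∂P‖ ≤ 8 / |s| * ∫ w, ‖H w‖ := by
    rw [hswap, ← integral_const_mul]
    refine norm_integral_le_of_norm_le (hH.norm.const_mul _) (Eventually.of_forall fun w => ?_)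
    rw [norm_mul]
    exact mul_le_mul_of_nonneg_right (norm_integral_osc_shift_le hs hr.le z₀ w) (norm_nonneg _)
  have hsplit : (r ^ 2 : ℝ) • I₀ = ∫ q, (I₀ - J q) ∂P + ∫ q, J q ∂P := by
    rw [integral_sub (integrable_const _) hJint, integral_const, hPreal]; abel
  have hr2 : 0 < r ^ 2 := by positivity
  have hfin : r ^ 2 * ‖I₀‖ ≤ δ * r ^ 2 + 8 / |s| * ∫ w, ‖H w‖ := by
    have h1 : r ^ 2 * ‖I₀‖ = ‖(r ^ 2 : ℝ) • I₀‖ := by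
      rw [norm_smul, Real.norm_of_nonneg hr2.le]
    rw [h1, hsplit]
    refine (norm_add_le _ _).trans (add_le_add ?_ hJle)
    have := norm_integral_le_of_norm_le_const hdiff
    rwa [hPreal] at this
  have h3 : ‖I₀‖ = (r ^ 2 * ‖I₀‖) / r ^ 2 := by field_simp
  rw [h3, div_le_iff₀ hr2]
  refine hfin.trans (le_of_eq ?_)
  have : |s| ≠ 0 := abs_ne_zero.mpr hs
  field_simp
  ring

open scoped ENNReal Convolution

/-! ### Weights and weakly singular integrals -/

/-- The weight `max(1, 1/|u|)^e`, which dominates the singularity `|u|^{-e}` and, being at least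
`1`, is monotone in the exponent. At `u = 0` it takes the harmless value `1`. -/
noncomputable def wt (e : ℝ) (u : ℂ) : ℝ≥0∞ := ENNReal.ofReal ((max 1 ‖u‖⁻¹) ^ e)

theorem one_le_max_inv (u : ℂ) : (1 : ℝ) ≤ max 1 ‖u‖⁻¹ := le_max_left _ _

theorem max_inv_pos (u : ℂ) : (0 : ℝ) < max 1 ‖u‖⁻¹ := one_pos.trans_le (one_le_max_inv u)

theorem wt_mul_wt (a b : ℝ) (u : ℂ) : wt a u * wt b u = wt (a + b) u := by
  rw [wt, wt, wt, ← ENNReal.ofReal_mul (by have := max_inv_pos u; positivity),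
    Real.rpow_add (max_inv_pos u)]

theorem wt_rpow (a b : ℝ) (u : ℂ) : wt a u ^ b = wt (a * b) u := by
  have := max_inv_pos u
  rw [wt, wt, ENNReal.ofReal_rpow_of_pos (by positivity), Real.rpow_mul this.le]

theorem wt_mono {a b : ℝ} (h : a ≤ b) (u : ℂ) : wt a u ≤ wt b u :=
  ENNReal.ofReal_le_ofReal (Real.rpow_le_rpow_of_exponent_le (one_le_max_inv u) h)

theorem one_le_wt {a : ℝ} (h : 0 ≤ a) (u : ℂ) : 1 ≤ wt a u := by
  have : wt 0 u = 1 := by simp [wt]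
  exact this ▸ wt_mono h u

theorem wt_ne_top (a : ℝ) (u : ℂ) : wt a u ≠ ⊤ := ENNReal.ofReal_ne_top

theorem wt_neg (a : ℝ) (u : ℂ) : wt a (-u) = wt a u := by simp [wt]

theorem wt_sub_comm (a : ℝ) (u v : ℂ) : wt a (u - v) = wt a (v - u) := by
  rw [← wt_neg, neg_sub]

theorem measurable_wt (a : ℝ) : Measurable (wt a) := by
  unfold wt; fun_prop

theorem wt_mul_wt_le {a b : ℝ} (ha : 0 ≤ a) (hb : 0 ≤ b) (u v : ℂ) :
    wt a u * wt b v ≤ wt (a + b) u + wt (a + b) v := by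
  have hmono : ∀ {c : ℝ}, 0 ≤ c → ∀ {x y : ℂ}, max 1 ‖x‖⁻¹ ≤ max 1 ‖y‖⁻¹ → wt c x ≤ wt c y :=
    fun hc x y h => ENNReal.ofReal_le_ofReal
      (Real.rpow_le_rpow (max_inv_pos x).le h hc)
  rcases le_total (max 1 ‖u‖⁻¹) (max 1 ‖v‖⁻¹) with h | h
  · calc wt a u * wt b v ≤ wt a v * wt b v := by gcongr; exact hmono ha h
      _ = wt (a + b) v := wt_mul_wt _ _ _
      _ ≤ _ := le_add_self
  · calc wt a u * wt b v ≤ wt a u * wt b u := by gcongr; exact hmono hb h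
      _ = wt (a + b) u := wt_mul_wt _ _ _
      _ ≤ _ := le_self_add

theorem enorm_inv_le_wt (u : ℂ) : ‖u⁻¹‖ₑ ≤ wt 1 u := by
  rw [← ofReal_norm, wt, Real.rpow_one, norm_inv]
  exact ENNReal.ofReal_le_ofReal (le_max_right _ _)

theorem div_mul_le_rpow {s x y d : ℝ} (hs₀ : 0 ≤ s) (hs₁ : s ≤ 1) (hx : 0 < x) (hxy : x ≤ y)
    (hd : 0 ≤ d) (hdxy : d ≤ x + y) : d / (x * y) ≤ 2 * d ^ s * x⁻¹ ^ (1 + s) := by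
  rcases hd.eq_or_lt with rfl | hd'
  · rw [zero_div]; positivity
  have hy : 0 < y := hx.trans_le hxy
  have h1 : d = d ^ s * d ^ (1 - s) := by rw [← Real.rpow_add hd']; simp
  have h2 : d ^ (1 - s) ≤ 2 * y ^ (1 - s) := by
    calc d ^ (1 - s) ≤ (2 * y) ^ (1 - s) := Real.rpow_le_rpow hd (by linarith) (by linarith)
      _ = 2 ^ (1 - s) * y ^ (1 - s) := Real.mul_rpow (by norm_num) hy.le
      _ ≤ 2 ^ (1 : ℝ) * y ^ (1 - s) := by
          gcongr
          · norm_num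
          · linarith
      _ = 2 * y ^ (1 - s) := by rw [Real.rpow_one]
  have h3 : y ^ (1 - s) / y = y⁻¹ ^ s := by
    rw [Real.inv_rpow hy.le, Real.rpow_sub hy, Real.rpow_one]; field_simp
  have h4 : y⁻¹ ^ s ≤ x⁻¹ ^ s := by gcongr
  calc d / (x * y) = d ^ s * d ^ (1 - s) / (x * y) := by rw [← h1]
    _ ≤ d ^ s * (2 * y ^ (1 - s)) / (x * y) := by gcongr
    _ = 2 * d ^ s * (x⁻¹ * (y ^ (1 - s) / y)) := by field_simp
    _ ≤ 2 * d ^ s * (x⁻¹ * x⁻¹ ^ s) := by rw [h3]; gcongr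
    _ = 2 * d ^ s * x⁻¹ ^ (1 + s) := by
        rw [Real.rpow_add (by positivity), Real.rpow_one]

/-- Fractional Hölder estimate for the Cauchy kernel. -/
theorem enorm_inv_sub_inv_le {s : ℝ} (hs₀ : 0 ≤ s) (hs₁ : s ≤ 1) (u v : ℂ) :
    ‖u⁻¹ - v⁻¹‖ₑ ≤ 2 * ENNReal.ofReal (‖u - v‖ ^ s) * (wt (1 + s) u + wt (1 + s) v) := by
  have key : ∀ u v : ℂ, ‖u‖ ≤ ‖v‖ →
      ‖u⁻¹ - v⁻¹‖ₑ ≤ 2 * ENNReal.ofReal (‖u - v‖ ^ s) * (wt (1 + s) u + wt (1 + s) v) := by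
    intro u v huv
    have hle : ∀ x : ℂ, ‖u⁻¹ - v⁻¹‖ ≤ 2 * ‖u - v‖ ^ s * ‖x‖⁻¹ ^ (1 + s) →
        ‖u⁻¹ - v⁻¹‖ₑ ≤ 2 * ENNReal.ofReal (‖u - v‖ ^ s) * wt (1 + s) x := by
      intro x hx
      rw [← ofReal_norm, wt, show (2 : ℝ≥0∞) = ENNReal.ofReal 2 by simp,
        ← ENNReal.ofReal_mul (by norm_num), ← ENNReal.ofReal_mul (by positivity)]
      refine ENNReal.ofReal_le_ofReal (hx.trans ?_)
      gcongr
      exact le_max_right _ _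
    rcases eq_or_ne u 0 with rfl | hu
    · refine (hle v ?_).trans (mul_le_mul_right le_add_self _)
      rcases eq_or_ne v 0 with rfl | hv
      · simp; positivity
      · have hv' : 0 < ‖v‖ := norm_pos_iff.mpr hv
        have h1 : ‖v‖ ^ s * ‖v‖⁻¹ ^ (1 + s) = ‖v‖⁻¹ := by
          rw [Real.rpow_add (by positivity), Real.rpow_one, Real.inv_rpow hv'.le]
          field_simp
        simp only [inv_zero, zero_sub, norm_neg, norm_inv]
        rw [mul_assoc, h1]
        have : 0 ≤ ‖v‖⁻¹ := by positivity
        linarith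
    · have hu' : 0 < ‖u‖ := norm_pos_iff.mpr hu
      have hv : v ≠ 0 := norm_pos_iff.mp (hu'.trans_le huv)
      refine (hle u ?_).trans (mul_le_mul_right le_self_add _)
      rw [inv_sub_inv hu hv, norm_div, norm_mul, norm_sub_rev]
      exact div_mul_le_rpow hs₀ hs₁ hu' huv (norm_nonneg _) (norm_sub_le _ _)
  rcases le_total ‖u‖ ‖v‖ with h | h
  · exact key u v h
  · have := key v u h
    rwa [← neg_sub, enorm_neg, norm_sub_rev, add_comm] at this

/-- Exponents below `2` are locally integrable in the plane, uniformly in the centre. -/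
theorem exists_lintegral_wt_le {e : ℝ} (he : e < 2) (R : ℝ) :
    ∃ C : ℝ≥0∞, C ≠ ⊤ ∧ ∀ c : ℂ, ∫⁻ w in Metric.closedBall 0 R, wt e (w - c) ≤ C := by
  -- only nonnegative exponents need an argument, by monotonicity
  wlog he₀ : 0 ≤ e generalizing e
  · obtain ⟨C, hC, h⟩ := this (e := 0) (by norm_num) le_rfl
    exact ⟨C, hC, fun c => (lintegral_mono fun w => wt_mono (not_le.mp he₀).le _).trans (h c)⟩
  set g : ℂ → ℝ≥0∞ := (Metric.ball (0 : ℂ) 1).indicator fun u => ENNReal.ofReal (‖u‖ ^ (-e)) with hg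
  have hgm : Measurable g := Measurable.indicator (by fun_prop) measurableSet_ball
  have hgi : ∫⁻ u, g u ≠ ⊤ := by
    rw [hg, lintegral_indicator measurableSet_ball]
    have h1 : IntegrableOn (fun u : ℂ => ‖u‖ ^ (-e)) (Metric.ball 0 1) := by
      refine integrableOn_ball_of_norm_le_rpow (C := 1) (α := e) (by simp) (by simpa using he)
        (Eventually.of_forall fun u => ?_)
        (Measurable.aestronglyMeasurable (by fun_prop))
      rw [one_mul, Real.norm_of_nonneg (by positivity)]
    exact h1.lintegral_lt_top.ne
  have hle : ∀ u : ℂ, wt e u ≤ 1 + g u := by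
    intro u
    rcases lt_or_ge ‖u‖ 1 with h | h
    · have hmem : u ∈ Metric.ball (0 : ℂ) 1 := by simpa using h
      rcases eq_or_ne u 0 with rfl | hu
      · refine le_trans (le_of_eq ?_) le_self_add
        simp [wt]
      · refine le_trans (le_of_eq ?_) le_add_self
        have hu' : 0 < ‖u‖ := norm_pos_iff.mpr hu
        rw [hg, Set.indicator_of_mem hmem, wt, max_eq_right ((one_le_inv₀ hu').mpr h.le),
          Real.inv_rpow hu'.le, Real.rpow_neg hu'.le]
    · refine le_trans (le_of_eq ?_) le_self_add
      rw [wt, max_eq_left (inv_le_one_of_one_le₀ h)]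
      simp
  refine ⟨volume (Metric.closedBall (0 : ℂ) R) + ∫⁻ u, g u,
    ENNReal.add_ne_top.mpr ⟨measure_closedBall_lt_top.ne, hgi⟩, fun c => ?_⟩
  calc ∫⁻ w in Metric.closedBall 0 R, wt e (w - c)
      ≤ ∫⁻ w in Metric.closedBall 0 R, (1 + g (w - c)) := lintegral_mono fun w => hle _
    _ = volume (Metric.closedBall (0 : ℂ) R) + ∫⁻ w in Metric.closedBall 0 R, g (w - c) := by
        rw [lintegral_add_left measurable_const]; simp
    _ ≤ volume (Metric.closedBall (0 : ℂ) R) + ∫⁻ w, g (w - c) := by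
        gcongr; exact Measure.restrict_le_self
    _ = _ := by rw [lintegral_sub_right_eq_self g c]

/-- Young's inequality with the prefactors dropped. -/
theorem ennreal_mul_le_rpow_add_rpow {p p' : ℝ} (h : p.HolderConjugate p') (a b : ℝ≥0∞) :
    a * b ≤ a ^ p + b ^ p' := by
  refine (ENNReal.young_inequality a b h).trans (add_le_add ?_ ?_)
  · refine ENNReal.div_le_of_le_mul (le_mul_of_one_le_right (by simp) ?_)
    exact ENNReal.one_le_ofReal.mpr h.lt.le
  · refine ENNReal.div_le_of_le_mul (le_mul_of_one_le_right (by simp) ?_)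
    exact ENNReal.one_le_ofReal.mpr h.symm.lt.le

/-- The Hölder exponent used for the kernels. With it, the exponents in
`mul_wt_mul_wt_le` stay below `2`. -/
noncomputable def holderExp (p : ℝ) : ℝ := (p - 1) / (2 * (p + 1))

theorem holderExp_pos {p : ℝ} (hp : 1 < p) : 0 < holderExp p := by
  unfold holderExp; apply div_pos <;> linarith

theorem holderExp_lt_one {p : ℝ} (hp : 1 < p) : holderExp p < 1 := by
  unfold holderExp; rw [div_lt_one] <;> linarith

/-- Splitting of the composed kernel: the part carried by `x` has total singularity of order
`2 - 2s < 2`, and the remaining one splits into two factors of order `3/2 < 2`. -/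
theorem mul_wt_mul_wt_le {p : ℝ} (hp : 1 < p) (x : ℝ≥0∞) (u v : ℂ) :
    x * (wt (1 + holderExp p) u * wt (1 + holderExp p) v) ≤
      x ^ p * (wt (2 - 2 * holderExp p) u + wt (2 - 2 * holderExp p) v) +
        wt (3 / 2) u * wt (3 / 2) v := by
  set s := holderExp p with hs
  have hs1 := holderExp_lt_one hp
  have hp0 : p ≠ 0 := by linarith
  have hp1 : p - 1 ≠ 0 := by linarith
  have hp2 : p + 1 ≠ 0 := by linarith
  set k := (1 - s) / p with hk
  have hpp : p.HolderConjugate (Real.conjExponent p) := Real.HolderConjugate.conjExponent hp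
  have e1 : 1 + s = k + (1 + s - k) := by ring
  have e2 : k * p = 1 - s := by rw [hk]; field_simp
  have e3 : (1 + s - k) * Real.conjExponent p = 3 / 2 := by
    rw [hk, hs, holderExp, Real.conjExponent]; field_simp; ring
  calc x * (wt (1 + s) u * wt (1 + s) v)
      = (x * (wt k u * wt k v)) * (wt (1 + s - k) u * wt (1 + s - k) v) := by
        rw [e1, ← wt_mul_wt, ← wt_mul_wt, ← e1]; ring
    _ ≤ (x * (wt k u * wt k v)) ^ p +
        (wt (1 + s - k) u * wt (1 + s - k) v) ^ (Real.conjExponent p) :=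
        ennreal_mul_le_rpow_add_rpow hpp _ _
    _ = x ^ p * (wt (1 - s) u * wt (1 - s) v) + wt (3 / 2) u * wt (3 / 2) v := by
        rw [ENNReal.mul_rpow_of_nonneg _ _ hpp.pos.le, ENNReal.mul_rpow_of_nonneg _ _ hpp.pos.le,
          ENNReal.mul_rpow_of_nonneg _ _ hpp.symm.pos.le, wt_rpow, wt_rpow, wt_rpow, wt_rpow,
          e2, e3]
    _ ≤ _ := by
        have h := wt_mul_wt_le (a := 1 - s) (b := 1 - s) (by linarith) (by linarith) u v
        rw [show (1 - s) + (1 - s) = 2 - 2 * s by ring] at h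
        gcongr

/-- The two Cauchy kernels, both with singularity worsened from order `1` to `1 + holderExp p`, can
still be integrated one after the other against an `L^p` density, uniformly in the base point `z`
and the shift `a`. -/
theorem exists_double_lintegral_le {p : ℝ} (hp : 1 < p) {q : ℂ → ℂ}
    (hq : MemLp q (ENNReal.ofReal p)) (R R' : ℝ) :
    ∃ C : ℝ≥0∞, C ≠ ⊤ ∧ ∀ z a : ℂ,
      ∫⁻ w in Metric.closedBall 0 R, wt (1 + holderExp p) (z - w) *
        ∫⁻ v in Metric.closedBall 0 R', ‖q v‖ₑ * wt (1 + holderExp p) (w + a - v) ≤ C := by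
  set s := holderExp p with hs
  have hs0 := holderExp_pos hp
  have hqm : AEMeasurable (fun v => ‖q v‖ₑ) := hq.1.enorm
  obtain ⟨C₁, hC₁, h₁⟩ := exists_lintegral_wt_le (e := 2 - 2 * s) (by linarith) R
  obtain ⟨C₂, hC₂, h₂⟩ := exists_lintegral_wt_le (e := 3 / 2) (by norm_num) R
  obtain ⟨C₃, hC₃, h₃⟩ := exists_lintegral_wt_le (e := 3 / 2) (by norm_num) R'
  have hqp : ∫⁻ v, ‖q v‖ₑ ^ p ≠ ⊤ := by
    have := lintegral_rpow_enorm_lt_top_of_eLpNorm_lt_top (by simp; linarith) (by simp) hq.2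
    rw [ENNReal.toReal_ofReal (by linarith)] at this
    exact this.ne
  refine ⟨(∫⁻ v, ‖q v‖ₑ ^ p) * (C₁ + C₁) + C₂ * C₃, by finiteness, fun z a => ?_⟩
  have mwt : ∀ (e : ℝ), Measurable fun x : ℂ × ℂ => wt e (x.1 + a - x.2) := fun e =>
    (measurable_wt e).comp (by fun_prop)
  have mwt' : ∀ (e : ℝ), Measurable fun x : ℂ × ℂ => wt e (z - x.1) := fun e =>
    (measurable_wt e).comp (by fun_prop)
  have mwt'' : ∀ (e : ℝ), Measurable fun w : ℂ => wt e (z - w) := fun e =>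
    (measurable_wt e).comp (by fun_prop)
  have mwt3 : ∀ (e : ℝ) (w : ℂ), Measurable fun v : ℂ => wt e (w + a - v) := fun e w =>
    (measurable_wt e).comp (by fun_prop)
  set D := Metric.closedBall (0 : ℂ) R
  set D' := Metric.closedBall (0 : ℂ) R'
  calc ∫⁻ w in D, wt (1 + s) (z - w) * ∫⁻ v in D', ‖q v‖ₑ * wt (1 + s) (w + a - v)
      = ∫⁻ w in D, ∫⁻ v in D', ‖q v‖ₑ * (wt (1 + s) (z - w) * wt (1 + s) (w + a - v)) := by
        refine lintegral_congr fun w => ?_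
        rw [← lintegral_const_mul' _ _ (wt_ne_top _ _)]
        refine lintegral_congr fun v => by ring
    _ ≤ ∫⁻ w in D, ∫⁻ v in D', (‖q v‖ₑ ^ p * (wt (2 - 2 * s) (z - w) +
          wt (2 - 2 * s) (w + a - v)) + wt (3 / 2) (z - w) * wt (3 / 2) (w + a - v)) :=
        lintegral_mono fun w => lintegral_mono fun v => mul_wt_mul_wt_le hp _ _ _
    _ = (∫⁻ w in D, ∫⁻ v in D', ‖q v‖ₑ ^ p * (wt (2 - 2 * s) (z - w) +
          wt (2 - 2 * s) (w + a - v))) +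
        ∫⁻ w in D, ∫⁻ v in D', wt (3 / 2) (z - w) * wt (3 / 2) (w + a - v) := by
        rw [← lintegral_add_right]
        · refine lintegral_congr fun w => ?_
          rw [lintegral_add_right]
          exact (mwt3 _ w).const_mul _
        · exact Measurable.lintegral_prod_right' ((mwt' (3 / 2)).mul (mwt (3 / 2)))
    _ ≤ _ := by
        refine add_le_add ?_ ?_
        · rw [lintegral_lintegral_swap]
          · calc ∫⁻ v in D', ∫⁻ w in D, ‖q v‖ₑ ^ p * (wt (2 - 2 * s) (z - w) +
                    wt (2 - 2 * s) (w + a - v))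
                ≤ ∫⁻ v in D', ‖q v‖ₑ ^ p * (C₁ + C₁) := by
                  refine lintegral_mono fun v => ?_
                  rw [lintegral_const_mul' _ _ (ENNReal.rpow_ne_top_of_nonneg (by linarith)
                    (by simp)), lintegral_add_left (mwt'' _)]
                  gcongr
                  · simp_rw [wt_sub_comm _ z]; exact h₁ z
                  · simp_rw [show ∀ w, w + a - v = w - (v - a) by intro w; ring]
                    exact h₁ _
              _ = (∫⁻ v in D', ‖q v‖ₑ ^ p) * (C₁ + C₁) :=
                  lintegral_mul_const' _ _ (by finiteness)
              _ ≤ _ := by gcongr; exact Measure.restrict_le_self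
          · refine AEMeasurable.mul ?_ (((mwt' _).add (mwt _)).aemeasurable)
            exact (hqm.restrict.comp_snd).pow_const p
        · calc ∫⁻ w in D, ∫⁻ v in D', wt (3 / 2) (z - w) * wt (3 / 2) (w + a - v)
              ≤ ∫⁻ w in D, wt (3 / 2) (z - w) * C₃ := by
                refine lintegral_mono fun w => ?_
                rw [lintegral_const_mul' _ _ (wt_ne_top _ _)]
                gcongr
                simp_rw [wt_sub_comm _ (w + a)]; exact h₃ _
            _ ≤ C₂ * C₃ := by
                rw [lintegral_mul_const' _ _ hC₃]
                gcongr
                simp_rw [wt_sub_comm _ z]; exact h₂ z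

/-! ### Decay of the Cauchy transform of an oscillating density -/

/-- A majorant of `‖b - ∂⁻¹ Q‖` which also controls its Hölder differences. -/
noncomputable def majorant (p : ℝ) (Q : ℂ → ℂ) (b w : ℂ) : ℝ≥0∞ :=
  ‖b‖ₑ + ∫⁻ v, ‖Q v‖ₑ * wt (1 + holderExp p) (w - v)

theorem enorm_div_conj_le {p : ℝ} (hp : 1 < p) (Q : ℂ → ℂ) (w v : ℂ) :
    ‖Q v / conj (w - v)‖ₑ ≤ ‖Q v‖ₑ * wt (1 + holderExp p) (w - v) := by
  rw [div_eq_mul_inv, enorm_mul, ← map_inv₀]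
  gcongr
  have h : ‖conj ((w - v)⁻¹)‖ₑ = ‖(w - v)⁻¹‖ₑ := by
    rw [← ofReal_norm, ← ofReal_norm, Complex.norm_conj]
  rw [h]
  exact (enorm_inv_le_wt _).trans (wt_mono (by linarith [holderExp_pos hp]) _)

theorem enorm_one_div_pi_le : ‖(1 / (Real.pi : ℂ))‖ₑ ≤ 1 := by
  rw [← ofReal_norm, ENNReal.ofReal_le_one]
  simp only [one_div, norm_inv, Complex.norm_real, Real.norm_eq_abs, abs_of_pos Real.pi_pos]
  exact inv_le_one_of_one_le₀ (by linarith [Real.pi_gt_three])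

theorem aestronglyMeasurable_div_conj {Q : ℂ → ℂ} (hQ : AEStronglyMeasurable Q) (w : ℂ) :
    AEStronglyMeasurable (fun v => Q v / conj (w - v)) :=
  hQ.div₀ (by fun_prop)

theorem aestronglyMeasurable_dInv {Q : ℂ → ℂ} (hQ : AEStronglyMeasurable Q) :
    AEStronglyMeasurable (dInv Q) := by
  have h : AEStronglyMeasurable (fun x : ℂ × ℂ => Q x.2 / conj (x.1 - x.2))
      ((volume : Measure ℂ).prod volume) := hQ.comp_snd.div₀ (by fun_prop)
  exact h.integral_prod_right'.const_mul _

theorem aestronglyMeasurable_dbarInv {Q : ℂ → ℂ} (hQ : AEStronglyMeasurable Q) :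
    AEStronglyMeasurable (dbarInv Q) := by
  have h : AEStronglyMeasurable (fun x : ℂ × ℂ => Q x.2 / (x.1 - x.2))
      ((volume : Measure ℂ).prod volume) := hQ.comp_snd.div₀ (by fun_prop)
  exact h.integral_prod_right'.const_mul _

theorem dInvConverges_of_majorant_ne_top {p : ℝ} (hp : 1 < p) {Q : ℂ → ℂ}
    (hQ : AEStronglyMeasurable Q) {b w : ℂ} (h : majorant p Q b w ≠ ⊤) : DInvConverges Q w := by
  refine ⟨aestronglyMeasurable_div_conj hQ w, ?_⟩
  rw [hasFiniteIntegral_iff_enorm]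
  refine lt_of_le_of_lt (lintegral_mono fun v => enorm_div_conj_le hp Q w v) ?_
  exact lt_of_le_of_lt le_add_self (lt_top_iff_ne_top.mpr h)

theorem enorm_sub_dInv_le_majorant {p : ℝ} (hp : 1 < p) (Q : ℂ → ℂ) (b w : ℂ) :
    ‖b - dInv Q w‖ₑ ≤ majorant p Q b w := by
  refine (enorm_sub_le).trans (add_le_add_right ?_ _)
  rw [dInv, enorm_mul]
  refine (mul_le_of_le_one_left (by simp) enorm_one_div_pi_le).trans ?_
  exact (enorm_integral_le_lintegral_enorm _).trans
    (lintegral_mono fun v => enorm_div_conj_le hp Q w v)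

theorem enorm_dInv_sub_dInv_le {p : ℝ} (hp : 1 < p) {Q : ℂ → ℂ} (hQ : AEStronglyMeasurable Q)
    (b w w' : ℂ) :
    ‖(b - dInv Q w') - (b - dInv Q w)‖ₑ ≤
      2 * ENNReal.ofReal (‖w' - w‖ ^ holderExp p) * (majorant p Q b w' + majorant p Q b w) := by
  rcases eq_or_ne w' w with rfl | hne
  · simp
  have hpos : 0 < ‖w' - w‖ ^ holderExp p :=
    Real.rpow_pos_of_pos (norm_pos_iff.mpr (sub_ne_zero.mpr hne)) _
  have hcoef : 2 * ENNReal.ofReal (‖w' - w‖ ^ holderExp p) ≠ 0 := by simp [hpos]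
  by_cases htop : majorant p Q b w' = ⊤ ∨ majorant p Q b w = ⊤
  · have : majorant p Q b w' + majorant p Q b w = ⊤ := by rcases htop with h | h <;> simp [h]
    rw [this, ENNReal.mul_top hcoef]
    exact le_top
  rw [not_or] at htop
  have h1 : Integrable (fun v => Q v / conj (w' - v)) := dInvConverges_of_majorant_ne_top hp hQ htop.1
  have h2 : Integrable (fun v => Q v / conj (w - v)) := dInvConverges_of_majorant_ne_top hp hQ htop.2
  have heq : (b - dInv Q w') - (b - dInv Q w) =
      (1 / (Real.pi : ℂ)) * ∫ v, (Q v / conj (w - v) - Q v / conj (w' - v)) := by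
    rw [integral_sub h2 h1, dInv, dInv]; ring
  have hm : ∀ x : ℂ, AEMeasurable fun v => ‖Q v‖ₑ * wt (1 + holderExp p) (x - v) := fun x =>
    hQ.enorm.mul ((measurable_wt _).comp (by fun_prop)).aemeasurable
  rw [heq, enorm_mul]
  refine (mul_le_of_le_one_left (by simp) enorm_one_div_pi_le).trans ?_
  refine (enorm_integral_le_lintegral_enorm _).trans ?_
  calc ∫⁻ v, ‖Q v / conj (w - v) - Q v / conj (w' - v)‖ₑ
      ≤ ∫⁻ v, 2 * ENNReal.ofReal (‖w' - w‖ ^ holderExp p) *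
          (‖Q v‖ₑ * wt (1 + holderExp p) (w' - v) + ‖Q v‖ₑ * wt (1 + holderExp p) (w - v)) := by
        refine lintegral_mono fun v => ?_
        have h3 : Q v / conj (w - v) - Q v / conj (w' - v) =
            Q v * conj ((w - v)⁻¹ - (w' - v)⁻¹) := by
          simp only [map_sub, map_inv₀]; ring
        have h4 : ‖conj ((w - v)⁻¹ - (w' - v)⁻¹)‖ₑ = ‖(w' - v)⁻¹ - (w - v)⁻¹‖ₑ := by
          rw [← ofReal_norm, ← ofReal_norm, Complex.norm_conj, norm_sub_rev]
        have h5 := enorm_inv_sub_inv_le (holderExp_pos hp).le (holderExp_lt_one hp).le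
          (w' - v) (w - v)
        rw [show w' - v - (w - v) = w' - w by ring] at h5
        rw [h3, enorm_mul, h4]
        refine (mul_le_mul_right h5 _).trans (le_of_eq ?_)
        ring
    _ = 2 * ENNReal.ofReal (‖w' - w‖ ^ holderExp p) *
          ((∫⁻ v, ‖Q v‖ₑ * wt (1 + holderExp p) (w' - v)) +
            ∫⁻ v, ‖Q v‖ₑ * wt (1 + holderExp p) (w - v)) := by
        rw [lintegral_const_mul' _ _ (by finiteness), lintegral_add_left' (hm w')]
    _ ≤ _ := by
        gcongr <;> exact le_add_self

/-- The data shared by all estimates: an `L^p` potential supported in a fixed ball. -/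
structure Potential (p R : ℝ) (q : ℂ → ℂ) : Prop where
  one_lt : 1 < p
  memLp : MemLp q (ENNReal.ofReal p)
  eq_zero : ∀ z ∉ Metric.closedBall (0 : ℂ) R, q z = 0

theorem measurable_majorant {p : ℝ} {Q : ℂ → ℂ} (hQ : AEStronglyMeasurable Q) (b : ℂ) :
    AEMeasurable (majorant p Q b) := by
  refine AEMeasurable.const_add ?_ _
  have h : AEMeasurable (fun x : ℂ × ℂ => ‖Q x.2‖ₑ * wt (1 + holderExp p) (x.1 - x.2))
      ((volume : Measure ℂ).prod volume) :=
    hQ.enorm.comp_snd.mul ((measurable_wt _).comp (by fun_prop)).aemeasurable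
  exact h.lintegral_prod_right'

theorem exists_lintegral_majorant_le {p R : ℝ} {q : ℂ → ℂ} (hq : Potential p R q) (R' : ℝ) :
    ∃ C : ℝ, 0 ≤ C ∧ ∀ (Q : ℂ → ℂ) (M : ℝ) (b : ℂ), 0 ≤ M →
      (∀ v, ‖Q v‖ ≤ M * ‖q v‖) → ∀ z a : ℂ,
      ∫⁻ w in Metric.closedBall 0 R', wt (1 + holderExp p) (z - w) * majorant p Q b (w + a) ≤
        ENNReal.ofReal (C * (‖b‖ + M)) := by
  have hp := hq.one_lt
  obtain ⟨C₁, hC₁, h₁⟩ := exists_lintegral_wt_le (e := 1 + holderExp p)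
    (by linarith [holderExp_lt_one hp]) R'
  obtain ⟨C₂, hC₂, h₂⟩ := exists_double_lintegral_le hp hq.memLp R' R
  refine ⟨C₁.toReal + C₂.toReal, by positivity, fun Q M b hM hQ z a => ?_⟩
  have hQe : ∀ v, ‖Q v‖ₑ ≤ ENNReal.ofReal M * ‖q v‖ₑ := fun v => by
    rw [← ofReal_norm, ← ofReal_norm, ← ENNReal.ofReal_mul hM]
    exact ENNReal.ofReal_le_ofReal (hQ v)
  have hmw : Measurable fun w : ℂ => wt (1 + holderExp p) (z - w) :=
    (measurable_wt _).comp (by fun_prop)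
  have hinner : ∀ x : ℂ, ∫⁻ v, ‖Q v‖ₑ * wt (1 + holderExp p) (x - v) ≤
      ENNReal.ofReal M * ∫⁻ v in Metric.closedBall 0 R, ‖q v‖ₑ * wt (1 + holderExp p) (x - v) := by
    intro x
    rw [← lintegral_const_mul' _ _ ENNReal.ofReal_ne_top,
      ← lintegral_indicator measurableSet_closedBall]
    refine lintegral_mono fun v => ?_
    by_cases hv : v ∈ Metric.closedBall (0 : ℂ) R
    · rw [Set.indicator_of_mem hv, ← mul_assoc]
      gcongr
      exact hQe v
    · have := hQe v
      rw [hq.eq_zero v hv] at this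
      simp only [enorm_zero, mul_zero, nonpos_iff_eq_zero] at this
      simp [this]
  calc ∫⁻ w in Metric.closedBall 0 R', wt (1 + holderExp p) (z - w) * majorant p Q b (w + a)
      ≤ ∫⁻ w in Metric.closedBall 0 R', (wt (1 + holderExp p) (z - w) * ‖b‖ₑ +
          ENNReal.ofReal M * (wt (1 + holderExp p) (z - w) *
            ∫⁻ v in Metric.closedBall 0 R, ‖q v‖ₑ * wt (1 + holderExp p) (w + a - v))) := by
        refine lintegral_mono fun w => ?_
        rw [majorant, mul_add, mul_left_comm (ENNReal.ofReal M)]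
        gcongr
        exact hinner (w + a)
    _ = (∫⁻ w in Metric.closedBall 0 R', wt (1 + holderExp p) (z - w)) * ‖b‖ₑ +
          ENNReal.ofReal M * ∫⁻ w in Metric.closedBall 0 R', (wt (1 + holderExp p) (z - w) *
            ∫⁻ v in Metric.closedBall 0 R, ‖q v‖ₑ * wt (1 + holderExp p) (w + a - v)) := by
        rw [lintegral_add_left (hmw.mul_const _), lintegral_mul_const' _ _ (by simp),
          lintegral_const_mul' _ _ ENNReal.ofReal_ne_top]
    _ ≤ C₁ * ‖b‖ₑ + ENNReal.ofReal M * C₂ := by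
        gcongr
        · simp_rw [wt_sub_comm _ z]; exact h₁ z
        · exact h₂ z a
    _ = ENNReal.ofReal (C₁.toReal * ‖b‖ + M * C₂.toReal) := by
        rw [ENNReal.ofReal_add (by positivity) (by positivity), ENNReal.ofReal_mul (by positivity),
          ENNReal.ofReal_mul hM, ENNReal.ofReal_toReal hC₁, ENNReal.ofReal_toReal hC₂, ofReal_norm]
    _ ≤ _ := by
        refine ENNReal.ofReal_le_ofReal ?_
        have h1 : 0 ≤ C₁.toReal * M := by positivity
        have h2 : 0 ≤ C₂.toReal * ‖b‖ := by positivity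
        nlinarith

theorem ae_dInvConverges {p R : ℝ} {q : ℂ → ℂ} (hq : Potential p R q) {Q : ℂ → ℂ} {M : ℝ}
    (hM : 0 ≤ M) (hQm : AEStronglyMeasurable Q) (hQ : ∀ v, ‖Q v‖ ≤ M * ‖q v‖) :
    ∀ᵐ w, DInvConverges Q w := by
  have hp := hq.one_lt
  have hball : ∀ n : ℕ, ∀ᵐ w, w ∈ Metric.closedBall (0 : ℂ) n → majorant p Q 0 w ≠ ⊤ := by
    intro n
    rw [← ae_restrict_iff' measurableSet_closedBall]
    obtain ⟨C, -, hC⟩ := exists_lintegral_majorant_le hq n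
    have h := hC Q M 0 hM hQ 0 0
    have h2 : ∫⁻ w in Metric.closedBall 0 (n : ℝ), majorant p Q 0 w ≠ ⊤ := by
      refine ne_top_of_le_ne_top ENNReal.ofReal_ne_top (le_trans (lintegral_mono fun w => ?_) h)
      simp only [add_zero]
      exact le_mul_of_one_le_left (by simp) (one_le_wt (by linarith [holderExp_pos hp]) _)
    filter_upwards [ae_lt_top' (measurable_majorant hQm 0).restrict h2] with w hw using hw.ne
  filter_upwards [ae_all_iff.mpr hball] with w hw
  obtain ⟨n, hn⟩ := exists_nat_ge ‖w‖
  exact dInvConverges_of_majorant_ne_top hp hQm (hw n (by simpa using hn))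

theorem exists_cutoff_bound {χ : ℂ → ℂ} (hχ : ContDiff ℝ ∞ χ) (hc : HasCompactSupport χ) {s : ℝ}
    (hs₀ : 0 ≤ s) (hs₁ : s ≤ 1) : ∃ L : ℝ, 0 ≤ L ∧ (∀ w, ‖χ w‖ ≤ L) ∧
      ∀ w a : ℂ, ‖a‖ ≤ 2 → ‖χ (w + a) - χ w‖ ≤ L * ‖a‖ ^ s := by
  obtain ⟨L₁, hL₁⟩ := ContDiff.lipschitzWith_of_hasCompactSupport hc hχ (by simp)
  obtain ⟨L₂, hL₂⟩ := hc.exists_bound_of_continuous hχ.continuous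
  have hL₂0 : 0 ≤ L₂ := (norm_nonneg _).trans (hL₂ 0)
  refine ⟨L₂ + 2 * L₁, by positivity, fun w => (hL₂ w).trans (by simp), fun w a ha => ?_⟩
  rcases eq_or_ne a 0 with rfl | ha0
  · simp only [add_zero, sub_self, norm_zero]; positivity
  have ha' : 0 < ‖a‖ := norm_pos_iff.mpr ha0
  have h1 : ‖χ (w + a) - χ w‖ ≤ L₁ * ‖a‖ := by
    simpa [dist_eq_norm] using hL₁.dist_le_mul (w + a) w
  have h2 : ‖a‖ = ‖a‖ ^ s * ‖a‖ ^ (1 - s) := by rw [← Real.rpow_add ha']; simp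
  have h3 : ‖a‖ ^ (1 - s) ≤ 2 ^ (1 - s) := Real.rpow_le_rpow ha'.le ha (by linarith)
  have h4 : (2 : ℝ) ^ (1 - s) ≤ 2 := by
    calc (2 : ℝ) ^ (1 - s) ≤ 2 ^ (1 : ℝ) :=
          Real.rpow_le_rpow_of_exponent_le (by norm_num) (by linarith)
      _ = 2 := Real.rpow_one _
  have h5 : 0 ≤ ‖a‖ ^ s := by positivity
  calc ‖χ (w + a) - χ w‖ ≤ L₁ * (‖a‖ ^ s * ‖a‖ ^ (1 - s)) := by rw [← h2]; exact h1
    _ ≤ L₁ * (‖a‖ ^ s * 2) := by gcongr; exact h3.trans h4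
    _ ≤ (L₂ + 2 * L₁) * ‖a‖ ^ s := by nlinarith

/-- The amplitude `χ(w) (z - w)⁻¹ (b - ∂⁻¹ Q(w))` left after removing the phase. -/
noncomputable def amplitude (χ Q : ℂ → ℂ) (b z w : ℂ) : ℂ := χ w * (z - w)⁻¹ * (b - dInv Q w)

theorem φ₁Density_div_eq (χ Q : ℂ → ℂ) (τ : ℝ) (z₀ b z w : ℂ) :
    φ₁Density χ Q τ z₀ b w / (z - w) = osc (-τ) z₀ w * amplitude χ Q b z w := by
  rw [φ₁Density, amplitude]; ring

theorem aestronglyMeasurable_amplitude {χ Q : ℂ → ℂ} (hχ : Continuous χ)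
    (hQ : AEStronglyMeasurable Q) (b z : ℂ) : AEStronglyMeasurable (amplitude χ Q b z) := by
  have h : AEStronglyMeasurable (fun w : ℂ => (z - w)⁻¹) :=
    Measurable.aestronglyMeasurable (by fun_prop)
  exact (hχ.aestronglyMeasurable.mul h).mul
    (aestronglyMeasurable_const.sub (aestronglyMeasurable_dInv hQ))

/-- The amplitude is bounded in `L¹` and Hölder continuous in `L¹` under translations, with constants
that depend on `Q` only through the multiple `M` of the fixed potential dominating it. -/
theorem exists_lintegral_amplitude_le {p R : ℝ} {χ q : ℂ → ℂ} (hq : Potential p R q)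
    (hχ : ContDiff ℝ ∞ χ) (hc : HasCompactSupport χ)
    (hχR : tsupport χ ⊆ Metric.closedBall 0 R) :
    ∃ C : ℝ, 0 ≤ C ∧ ∀ (Q : ℂ → ℂ) (M : ℝ) (b : ℂ), 0 ≤ M → AEStronglyMeasurable Q →
      (∀ v, ‖Q v‖ ≤ M * ‖q v‖) → ∀ z : ℂ,
      ∫⁻ w, ‖amplitude χ Q b z w‖ₑ ≤ ENNReal.ofReal (C * (‖b‖ + M)) ∧
      ∀ a : ℂ, ‖a‖ ≤ 2 → ∫⁻ w, ‖amplitude χ Q b z (w + a) - amplitude χ Q b z w‖ₑ ≤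
        ENNReal.ofReal (C * ‖a‖ ^ holderExp p * (‖b‖ + M)) := by
  have hp := hq.one_lt
  set s := holderExp p with hs
  have hs₀ := holderExp_pos hp
  have hs₁ := holderExp_lt_one hp
  obtain ⟨L, hL, hL₁, hL₂⟩ := exists_cutoff_bound hχ hc hs₀.le hs₁.le
  obtain ⟨C, hC, hmaj⟩ := exists_lintegral_majorant_le hq (R + 2)
  set D := Metric.closedBall (0 : ℂ) (R + 2) with hD
  have hout : ∀ w a : ℂ, ‖a‖ ≤ 2 → w ∉ D → χ (w + a) = 0 := by
    intro w a ha hw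
    refine image_eq_zero_of_notMem_tsupport fun hmem => hw ?_
    have h1 := hχR hmem
    simp only [hD, mem_closedBall_zero_iff] at h1 ⊢
    have := norm_sub_le (w + a) a
    rw [add_sub_cancel_right] at this
    linarith
  have hinv : ∀ u : ℂ, ‖u⁻¹‖ₑ ≤ wt (1 + s) u := fun u =>
    (enorm_inv_le_wt u).trans (wt_mono (by linarith) u)
  have hχe : ∀ w, ‖χ w‖ₑ ≤ ENNReal.ofReal L := fun w => by
    rw [← ofReal_norm]; exact ENNReal.ofReal_le_ofReal (hL₁ w)
  refine ⟨20 * L * C, by positivity, fun Q M b hM hQm hQ z => ⟨?_, fun a ha => ?_⟩⟩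
  · calc ∫⁻ w, ‖amplitude χ Q b z w‖ₑ
        ≤ ∫⁻ w, D.indicator (fun w => ENNReal.ofReal L *
            (wt (1 + s) (z - w) * majorant p Q b (w + 0))) w := by
          refine lintegral_mono fun w => ?_
          by_cases hw : w ∈ D
          · rw [Set.indicator_of_mem hw, amplitude, enorm_mul, enorm_mul, mul_assoc, add_zero]
            gcongr
            · exact hχe w
            · exact hinv _
            · exact enorm_sub_dInv_le_majorant hp Q b w
          · have := hout w 0 (by simp) hw
            rw [add_zero] at this
            simp [amplitude, this]
      _ ≤ ENNReal.ofReal L * ENNReal.ofReal (C * (‖b‖ + M)) := by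
          rw [lintegral_indicator measurableSet_closedBall,
            lintegral_const_mul' _ _ ENNReal.ofReal_ne_top]
          gcongr
          exact hmaj Q M b hM hQ z 0
      _ ≤ _ := by
          rw [← ENNReal.ofReal_mul hL]
          refine ENNReal.ofReal_le_ofReal ?_
          have : 0 ≤ L * (C * (‖b‖ + M)) := by positivity
          linarith
  · set N : ℂ → ℝ≥0∞ := majorant p Q b with hN
    set h : ℝ≥0∞ := ENNReal.ofReal (‖a‖ ^ s) with hh
    set l : ℝ≥0∞ := ENNReal.ofReal L with hl
    set A : ℂ → ℝ≥0∞ := fun w => wt (1 + s) (z - w) with hA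
    set A' : ℂ → ℝ≥0∞ := fun w => wt (1 + s) (z - a - w) with hA'
    have hpt : ∀ w, ‖amplitude χ Q b z (w + a) - amplitude χ Q b z w‖ₑ ≤
        D.indicator (fun w => 5 * l * h * (A w * N (w + 0) + A w * N (w + a) +
          (A' w * N (w + 0) + A' w * N (w + a)))) w := by
      intro w
      by_cases hw : w ∈ D
      · rw [Set.indicator_of_mem hw, add_zero]
        have e1 : amplitude χ Q b z (w + a) - amplitude χ Q b z w =
            (χ (w + a) - χ w) * ((z - a - w)⁻¹ * (b - dInv Q (w + a))) +
            χ w * (((z - a - w)⁻¹ - (z - w)⁻¹) * (b - dInv Q (w + a))) +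
            χ w * ((z - w)⁻¹ * ((b - dInv Q (w + a)) - (b - dInv Q w))) := by
          rw [amplitude, amplitude, show z - (w + a) = z - a - w by ring]; ring
        have i1 : ‖χ (w + a) - χ w‖ₑ ≤ l * h := by
          rw [← ofReal_norm, hl, hh, ← ENNReal.ofReal_mul hL]
          exact ENNReal.ofReal_le_ofReal (hL₂ w a ha)
        have i2 : ‖(z - a - w)⁻¹ - (z - w)⁻¹‖ₑ ≤ 2 * h * (A' w + A w) := by
          have := enorm_inv_sub_inv_le hs₀.le hs₁.le (z - a - w) (z - w)
          rwa [show z - a - w - (z - w) = -a by ring, norm_neg] at this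
        have i3 : ‖(b - dInv Q (w + a)) - (b - dInv Q w)‖ₑ ≤ 2 * h * (N (w + a) + N w) := by
          have := enorm_dInv_sub_dInv_le hp hQm b w (w + a)
          rwa [add_sub_cancel_left] at this
        have i4 : ‖b - dInv Q (w + a)‖ₑ ≤ N (w + a) := enorm_sub_dInv_le_majorant hp Q b _
        calc ‖amplitude χ Q b z (w + a) - amplitude χ Q b z w‖ₑ
            ≤ ‖(χ (w + a) - χ w) * ((z - a - w)⁻¹ * (b - dInv Q (w + a)))‖ₑ +
              ‖χ w * (((z - a - w)⁻¹ - (z - w)⁻¹) * (b - dInv Q (w + a)))‖ₑ +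
              ‖χ w * ((z - w)⁻¹ * ((b - dInv Q (w + a)) - (b - dInv Q w)))‖ₑ := by
              rw [e1]
              exact (enorm_add_le _ _).trans (by gcongr; exact enorm_add_le _ _)
          _ ≤ l * h * (A' w * N (w + a)) + l * (2 * h * (A' w + A w) * N (w + a)) +
              l * (A w * (2 * h * (N (w + a) + N w))) := by
              simp only [enorm_mul]
              gcongr
              · exact hinv _
              · exact hχe w
              · exact hχe w
              · exact hinv _
          _ = l * h * (3 * (A' w * N (w + a)) + 4 * (A w * N (w + a)) + 2 * (A w * N w)) := by
              ring
          _ ≤ l * h * (5 * (A' w * N (w + a)) + 5 * (A w * N (w + a)) + 5 * (A w * N w) +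
              5 * (A' w * N w)) := by
              gcongr l * h * ?_
              refine le_trans ?_ le_self_add
              gcongr <;> norm_num
          _ = _ := by ring
      · have h1 := hout w a ha hw
        have h2 := hout w 0 (by simp) hw
        rw [add_zero] at h2
        simp [amplitude, h1, h2]
    have hAm : Measurable A := (measurable_wt _).comp (by fun_prop)
    have hA'm : Measurable A' := (measurable_wt _).comp (by fun_prop)
    have hNm : ∀ c : ℂ, AEMeasurable (fun w => N (w + c)) (volume.restrict D) := fun c =>
      ((measurable_majorant hQm b).comp_quasiMeasurePreserving
        (measurePreserving_add_right volume c).quasiMeasurePreserving).restrict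
    have hAN : ∀ c : ℂ, AEMeasurable (fun w => A w * N (w + c)) (volume.restrict D) := fun c =>
      hAm.aemeasurable.mul (hNm c)
    have hAN' : ∀ c : ℂ, AEMeasurable (fun w => A' w * N (w + c)) (volume.restrict D) := fun c =>
      hA'm.aemeasurable.mul (hNm c)
    have hAN2 : AEMeasurable (fun w => A w * N (w + 0) + A w * N (w + a)) (volume.restrict D) :=
      (hAN 0).add (hAN a)
    refine (lintegral_mono hpt).trans ?_
    rw [lintegral_indicator measurableSet_closedBall, lintegral_const_mul' _ _ (by finiteness),
      lintegral_add_left' hAN2, lintegral_add_left' (hAN 0), lintegral_add_left' (hAN' 0)]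
    have hm := hmaj Q M b hM hQ
    refine (mul_le_mul_right (add_le_add (add_le_add (hm z 0) (hm z a))
      (add_le_add (hm (z - a) 0) (hm (z - a) a))) _).trans (le_of_eq ?_)
    rw [hl, hh, show (5 : ℝ≥0∞) = ENNReal.ofReal 5 by simp, ← ENNReal.ofReal_add (by positivity)
      (by positivity), ← ENNReal.ofReal_add (by positivity) (by positivity),
      ← ENNReal.ofReal_mul (by norm_num), ← ENNReal.ofReal_mul (by positivity),
      ← ENNReal.ofReal_mul (by positivity)]
    congr 1
    ring

theorem integrable_of_lintegral_enorm_le {f : ℂ → ℂ} (hf : AEStronglyMeasurable f) {c : ℝ}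
    (h : ∫⁻ w, ‖f w‖ₑ ≤ ENNReal.ofReal c) : Integrable f :=
  ⟨hf, hasFiniteIntegral_iff_enorm.mpr (h.trans_lt ENNReal.ofReal_lt_top)⟩

theorem integral_norm_le_of_lintegral_enorm_le {f : ℂ → ℂ} (hf : AEStronglyMeasurable f) {c : ℝ}
    (hc : 0 ≤ c) (h : ∫⁻ w, ‖f w‖ₑ ≤ ENNReal.ofReal c) : ∫ w, ‖f w‖ ≤ c := by
  rw [integral_norm_eq_lintegral_enorm hf]
  exact ENNReal.toReal_le_of_le_ofReal hc h

/-- The Cauchy transform of the oscillating density decays like a power of `τ`, uniformly in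
`z`, `z₀`, and in all densities dominated by the potential. -/
theorem exists_norm_dbarInv_φ₁Density_le {p R : ℝ} {χ q : ℂ → ℂ} (hq : Potential p R q)
    (hχ : ContDiff ℝ ∞ χ) (hc : HasCompactSupport χ)
    (hχR : tsupport χ ⊆ Metric.closedBall 0 R) :
    ∃ C : ℝ, 0 ≤ C ∧ ∀ (Q : ℂ → ℂ) (M : ℝ) (b : ℂ), 0 ≤ M → AEStronglyMeasurable Q →
      (∀ v, ‖Q v‖ ≤ M * ‖q v‖) → ∀ (τ : ℝ) (z₀ z : ℂ), 1 < τ →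
      DbarInvConverges (φ₁Density χ Q τ z₀ b) z ∧
      ‖dbarInv (φ₁Density χ Q τ z₀ b) z‖ ≤ C * τ ^ (-(holderExp p / 4)) * (‖b‖ + M) := by
  have hp := hq.one_lt
  set s := holderExp p with hs
  have hs₀ := holderExp_pos hp
  have hs₁ := holderExp_lt_one hp
  obtain ⟨C, hC, hamp⟩ := exists_lintegral_amplitude_le hq hχ hc hχR
  refine ⟨10 * C, by positivity, fun Q M b hM hQm hQ τ z₀ z hτ => ?_⟩
  obtain ⟨h1, h2⟩ := hamp Q M b hM hQm hQ z
  have hm := aestronglyMeasurable_amplitude hχ.continuous hQm b z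
  have hint := integrable_of_lintegral_enorm_le hm h1
  have hτ0 : 0 < τ := by linarith
  refine ⟨?_, ?_⟩
  · unfold DbarInvConverges
    simp_rw [φ₁Density_div_eq]
    exact hint.bdd_mul (c := 1) (continuous_osc _ _).aestronglyMeasurable
      (Eventually.of_forall fun x => (norm_osc _ _ _).le)
  · -- translations of size `τ^{-1/4}` balance the two terms of the oscillatory estimate
    set r : ℝ := τ ^ (-(1 / 4) : ℝ) with hr
    have hr0 : 0 < r := Real.rpow_pos_of_pos hτ0 _
    have hr1 : r ≤ 1 := Real.rpow_le_one_of_one_le_of_nonpos hτ.le (by norm_num)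
    have hbM : 0 ≤ ‖b‖ + M := by positivity
    have hshift : ∀ x ∈ Set.Ioc 0 r, ∀ y ∈ Set.Ioc 0 r,
        ∫ w, ‖amplitude χ Q b z (w + (x + y * Complex.I)) - amplitude χ Q b z w‖ ≤
          2 * C * r ^ s * (‖b‖ + M) := by
      intro x hx y hy
      have ha : ‖(x + y * Complex.I : ℂ)‖ ≤ 2 * r := by
        refine (norm_add_le _ _).trans ?_
        rw [norm_mul, Complex.norm_I, mul_one, Complex.norm_real, Complex.norm_real,
          Real.norm_of_nonneg hx.1.le, Real.norm_of_nonneg hy.1.le]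
        linarith [hx.2, hy.2]
      have hm' : AEStronglyMeasurable
          (fun w => amplitude χ Q b z (w + (x + y * Complex.I)) - amplitude χ Q b z w) :=
        (hm.comp_quasiMeasurePreserving
          (measurePreserving_add_right volume _).quasiMeasurePreserving).sub hm
      refine (integral_norm_le_of_lintegral_enorm_le hm' (by positivity)
        (h2 _ (ha.trans (by linarith)))).trans ?_
      have h3 : ‖(x + y * Complex.I : ℂ)‖ ^ s ≤ 2 * r ^ s := by
        calc ‖(x + y * Complex.I : ℂ)‖ ^ s ≤ (2 * r) ^ s :=
              Real.rpow_le_rpow (norm_nonneg _) ha hs₀.le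
          _ = 2 ^ s * r ^ s := Real.mul_rpow (by norm_num) hr0.le
          _ ≤ 2 ^ (1 : ℝ) * r ^ s := by
              gcongr
              norm_num
          _ = 2 * r ^ s := by rw [Real.rpow_one]
      calc C * ‖(x + y * Complex.I : ℂ)‖ ^ s * (‖b‖ + M) ≤ C * (2 * r ^ s) * (‖b‖ + M) := by
            gcongr
        _ = _ := by ring
    have hosc := norm_integral_osc_mul_le (neg_ne_zero.mpr hτ0.ne') hr0 z₀ hint hshift
    have hL1 := integral_norm_le_of_lintegral_enorm_le hm (by positivity) h1
    have hrs : r ^ s = τ ^ (-(s / 4)) := by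
      rw [hr, ← Real.rpow_mul hτ0.le]; congr 1; ring
    have hτr : 8 / (|-τ| * r ^ 2) ≤ 8 * τ ^ (-(s / 4)) := by
      have e1 : |-τ| * r ^ 2 = τ ^ (1 / 2 : ℝ) := by
        rw [abs_neg, abs_of_pos hτ0, hr, ← Real.rpow_natCast, ← Real.rpow_mul hτ0.le]
        nth_rewrite 1 [← Real.rpow_one τ]
        rw [← Real.rpow_add hτ0]
        norm_num
      rw [e1, div_eq_mul_inv, ← Real.rpow_neg hτ0.le]
      gcongr
      · exact hτ.le
      · linarith
    rw [dbarInv, norm_mul]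
    have hpi : ‖(1 / (Real.pi : ℂ))‖ ≤ 1 := by
      have := enorm_one_div_pi_le
      rwa [← ofReal_norm, ENNReal.ofReal_le_one] at this
    refine (mul_le_of_le_one_left (norm_nonneg _) hpi).trans ?_
    simp_rw [φ₁Density_div_eq]
    refine hosc.trans ?_
    rw [hrs]
    have hX : 0 ≤ τ ^ (-(s / 4)) := by positivity
    calc 8 / (|-τ| * r ^ 2) * (∫ w, ‖amplitude χ Q b z w‖) + 2 * C * τ ^ (-(s / 4)) * (‖b‖ + M)
        ≤ 8 * τ ^ (-(s / 4)) * (C * (‖b‖ + M)) + 2 * C * τ ^ (-(s / 4)) * (‖b‖ + M) := by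
          gcongr
      _ = _ := by ring

/-! ### The Neumann series -/

theorem S₁Density_eq_neg (χ q : ℂ → ℂ) (τ : ℝ) (z₀ : ℂ) (f : ℂ → ℂ) (w : ℂ) :
    S₁Density χ q τ z₀ f w = -φ₁Density χ (fun v => osc τ z₀ v * q v * f v) τ z₀ 0 w := by
  rw [S₁Density, φ₁Density]; ring

/-- `S₁` is the linear part of the map sending the density `Q` to `φ₁` built from `Q`. -/
theorem S₁_eq_φ₁ (χ q : ℂ → ℂ) (τ : ℝ) (z₀ : ℂ) (f : ℂ → ℂ) :
    S₁ χ q τ z₀ f = φ₁ χ (fun v => osc τ z₀ v * q v * f v) τ z₀ 0 := by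
  ext z
  rw [S₁, φ₁, dbarInv, dbarInv]
  simp_rw [S₁Density_eq_neg, neg_div]
  rw [integral_neg]
  ring

theorem φ₁_add {χ Q₁ Q₂ : ℂ → ℂ} {τ : ℝ} {z₀ b₁ b₂ z : ℂ}
    (h₁ : ∀ᵐ w, DInvConverges Q₁ w) (h₂ : ∀ᵐ w, DInvConverges Q₂ w)
    (h₁' : DbarInvConverges (φ₁Density χ Q₁ τ z₀ b₁) z)
    (h₂' : DbarInvConverges (φ₁Density χ Q₂ τ z₀ b₂) z) :
    φ₁ χ (fun v => Q₁ v + Q₂ v) τ z₀ (b₁ + b₂) z = φ₁ χ Q₁ τ z₀ b₁ z + φ₁ χ Q₂ τ z₀ b₂ z := by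
  simp only [φ₁, dbarInv]
  rw [← mul_add, ← mul_add, ← integral_add h₁' h₂']
  congr 2
  refine integral_congr_ae ?_
  filter_upwards [h₁, h₂] with w hw₁ hw₂
  have : dInv (fun v => Q₁ v + Q₂ v) w = dInv Q₁ w + dInv Q₂ w := by
    simp only [dInv, add_div]
    rw [integral_add hw₁ hw₂, mul_add]
  simp only [φ₁Density, this]
  ring

/-- `C` bounds the map sending a density `Q`, dominated by the potential, and a number `b` to
`φ₁` built from them; all integrals involved converge. -/
def IsDecayConst (χ q : ℂ → ℂ) (α C : ℝ) : Prop :=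
  ∀ (Q : ℂ → ℂ) (M : ℝ) (b : ℂ), 0 ≤ M → AEStronglyMeasurable Q → (∀ v, ‖Q v‖ ≤ M * ‖q v‖) →
    ∀ (τ : ℝ) (z₀ : ℂ), 1 < τ → (∀ᵐ w, DInvConverges Q w) ∧
      ∀ z, DbarInvConverges (φ₁Density χ Q τ z₀ b) z ∧
        ‖φ₁ χ Q τ z₀ b z‖ ≤ C * τ ^ (-α) * (‖b‖ + M)

theorem exists_isDecayConst {p R : ℝ} {χ q : ℂ → ℂ} (hq : Potential p R q)
    (hχ : ContDiff ℝ ∞ χ) (hc : HasCompactSupport χ)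
    (hχR : tsupport χ ⊆ Metric.closedBall 0 R) :
    ∃ C : ℝ, 0 ≤ C ∧ IsDecayConst χ q (holderExp p / 4) C := by
  obtain ⟨C, hC, h⟩ := exists_norm_dbarInv_φ₁Density_le hq hχ hc hχR
  refine ⟨C, hC, fun Q M b hM hQm hQ τ z₀ hτ => ⟨ae_dInvConverges hq hM hQm hQ, fun z => ?_⟩⟩
  obtain ⟨h1, h2⟩ := h Q M b hM hQm hQ τ z₀ z hτ
  refine ⟨h1, ?_⟩
  rw [φ₁, norm_mul]
  refine le_trans (mul_le_of_le_one_left (norm_nonneg _) ?_) h2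
  norm_num

theorem norm_osc_mul_mul_le (τ : ℝ) (z₀ : ℂ) (q : ℂ → ℂ) {f : ℂ → ℂ} {M : ℝ}
    (hf : ∀ v, ‖f v‖ ≤ M) (v : ℂ) : ‖osc τ z₀ v * q v * f v‖ ≤ M * ‖q v‖ := by
  rw [norm_mul, norm_mul, norm_osc, one_mul, mul_comm]
  exact mul_le_mul_of_nonneg_right (hf v) (norm_nonneg _)

theorem aestronglyMeasurable_osc_mul_mul (τ : ℝ) (z₀ : ℂ) {q f : ℂ → ℂ}
    (hq : AEStronglyMeasurable q) (hf : AEStronglyMeasurable f) :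
    AEStronglyMeasurable (fun v => osc τ z₀ v * q v * f v) :=
  ((continuous_osc τ z₀).aestronglyMeasurable.mul hq).mul hf

theorem aestronglyMeasurable_φ₁ {χ Q : ℂ → ℂ} (hχ : Continuous χ) (hQ : AEStronglyMeasurable Q)
    (τ : ℝ) (z₀ b : ℂ) : AEStronglyMeasurable (φ₁ χ Q τ z₀ b) := by
  refine (aestronglyMeasurable_dbarInv ?_).const_mul _
  exact ((continuous_osc _ z₀).aestronglyMeasurable.mul hχ.aestronglyMeasurable).mul
    (aestronglyMeasurable_const.sub (aestronglyMeasurable_dInv hQ))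

section Neumann

variable {χ q : ℂ → ℂ} {α C : ℝ} {τ : ℝ} {z₀ b : ℂ}

theorem F₁_succ_succ (m : ℕ) :
    F₁ χ q τ z₀ b (m + 2) =
      φ₁ χ (fun v => osc τ z₀ v * q v * F₁ χ q τ z₀ b (m + 1) v) τ z₀ 0 := by
  rw [← S₁_eq_φ₁, F₁, F₁, Function.iterate_succ_apply']

theorem aestronglyMeasurable_F₁ (hχ : Continuous χ) (hq : AEStronglyMeasurable q) (m : ℕ) :
    AEStronglyMeasurable (F₁ χ q τ z₀ b m) := by
  match m with
  | 0 => exact (continuous_osc _ _).aestronglyMeasurable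
  | 1 => exact aestronglyMeasurable_φ₁ hχ hq τ z₀ b
  | m + 2 =>
    rw [F₁_succ_succ]
    exact aestronglyMeasurable_φ₁ hχ (aestronglyMeasurable_osc_mul_mul τ z₀ hq
      (aestronglyMeasurable_F₁ hχ hq (m + 1))) τ z₀ 0

theorem norm_F₁_le (hC : IsDecayConst χ q α C) (hC₀ : 0 ≤ C) (hχ : Continuous χ)
    (hq : AEStronglyMeasurable q) (hτ : 1 < τ) {C' : ℝ} (hC' : C * (‖b‖ + 1) ≤ C') (m : ℕ) (z : ℂ) :
    ‖F₁ χ q τ z₀ b m z‖ ≤ (C' * τ ^ (-α)) ^ m := by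
  have hX : 0 ≤ τ ^ (-α) := Real.rpow_nonneg (by linarith) _
  have hCC' : C ≤ C' := le_trans (le_mul_of_one_le_right hC₀ (by linarith [norm_nonneg b])) hC'
  match m with
  | 0 => rw [pow_zero, F₁, norm_osc]
  | 1 =>
    have h := ((hC q 1 b zero_le_one hq (fun v => by simp) τ z₀ hτ).2 z).2
    rw [pow_one]
    calc ‖F₁ χ q τ z₀ b 1 z‖ ≤ C * τ ^ (-α) * (‖b‖ + 1) := h
      _ = C * (‖b‖ + 1) * τ ^ (-α) := by ring
      _ ≤ C' * τ ^ (-α) := by gcongr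
  | m + 2 =>
    have hr : 0 ≤ C' * τ ^ (-α) := mul_nonneg (hC₀.trans hCC') hX
    have ih := norm_F₁_le hC hC₀ hχ hq hτ hC' (m + 1)
    rw [F₁_succ_succ]
    have h := ((hC _ _ 0 (pow_nonneg hr (m + 1)) (aestronglyMeasurable_osc_mul_mul τ z₀ hq
      (aestronglyMeasurable_F₁ hχ hq (m + 1))) (norm_osc_mul_mul_le τ z₀ q ih) τ z₀ hτ).2 z).2
    refine h.trans ?_
    rw [norm_zero, zero_add, pow_succ' _ (m + 1)]
    gcongr

theorem S₁Converges_F₁ (hC : IsDecayConst χ q α C) (hC₀ : 0 ≤ C) (hχ : Continuous χ)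
    (hq : AEStronglyMeasurable q) (hτ : 1 < τ) (m : ℕ) :
    S₁Converges χ q τ z₀ (F₁ χ q τ z₀ b m) := by
  have hX : 0 ≤ τ ^ (-α) := Real.rpow_nonneg (by linarith) _
  have hF : ∀ z, ‖F₁ χ q τ z₀ b m z‖ ≤ (C * (‖b‖ + 1) * τ ^ (-α)) ^ m :=
    norm_F₁_le hC hC₀ hχ hq hτ le_rfl m
  have hr : 0 ≤ (C * (‖b‖ + 1) * τ ^ (-α)) ^ m := by positivity
  have h := hC _ _ 0 hr
    (aestronglyMeasurable_osc_mul_mul τ z₀ hq (aestronglyMeasurable_F₁ hχ hq m))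
    (norm_osc_mul_mul_le τ z₀ q hF) τ z₀ hτ
  refine ⟨h.1, fun z => ?_⟩
  have h2 := (h.2 z).1
  unfold DbarInvConverges at h2 ⊢
  simp_rw [S₁Density_eq_neg, neg_div]
  exact h2.neg

theorem φ₁Converges_of_isDecayConst (hC : IsDecayConst χ q α C) (hq : AEStronglyMeasurable q)
    (hτ : 1 < τ) : φ₁Converges χ q τ z₀ b := by
  have h := hC q 1 b zero_le_one hq (fun v => by simp) τ z₀ hτ
  exact ⟨h.1, fun z => (h.2 z).1⟩

variable {r : ℝ}

theorem hasSum_f₁ (hr₀ : 0 ≤ r) (hr₁ : r < 1) (hF : ∀ m z, ‖F₁ χ q τ z₀ b m z‖ ≤ r ^ m) (z : ℂ) :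
    HasSum (fun m => F₁ χ q τ z₀ b m z) (f₁ χ q τ z₀ b z) :=
  (Summable.of_norm_bounded (summable_geometric_of_lt_one hr₀ hr₁) fun m => hF m z).hasSum

theorem norm_f₁_le (hr₀ : 0 ≤ r) (hr₁ : r < 1) (hF : ∀ m z, ‖F₁ χ q τ z₀ b m z‖ ≤ r ^ m) (z : ℂ) :
    ‖f₁ χ q τ z₀ b z‖ ≤ (1 - r)⁻¹ :=
  tsum_of_norm_bounded (hasSum_geometric_of_lt_one hr₀ hr₁) fun m => hF m z

theorem aestronglyMeasurable_sum_F₁ (hχ : Continuous χ) (hq : AEStronglyMeasurable q) (N : ℕ) :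
    AEStronglyMeasurable (fun z => ∑ m ∈ Finset.range N, F₁ χ q τ z₀ b m z) :=
  Finset.aestronglyMeasurable_fun_sum _ fun m _ => aestronglyMeasurable_F₁ hχ hq m

theorem aestronglyMeasurable_f₁ (hr₀ : 0 ≤ r) (hr₁ : r < 1)
    (hF : ∀ m z, ‖F₁ χ q τ z₀ b m z‖ ≤ r ^ m) (hχ : Continuous χ) (hq : AEStronglyMeasurable q) :
    AEStronglyMeasurable (f₁ χ q τ z₀ b) :=
  aestronglyMeasurable_of_tendsto_ae atTop (fun N => aestronglyMeasurable_sum_F₁ hχ hq N)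
    (Eventually.of_forall fun z => (hasSum_f₁ hr₀ hr₁ hF z).tendsto_sum_nat)

/-- The partial sums satisfy the integral equation up to a shift of the index. -/
theorem sum_F₁_eq (hC : IsDecayConst χ q α C) (hχ : Continuous χ)
    (hq : AEStronglyMeasurable q) (hτ : 1 < τ) (hr₀ : 0 ≤ r)
    (hF : ∀ m z, ‖F₁ χ q τ z₀ b m z‖ ≤ r ^ m) (N : ℕ) (z : ℂ) :
    ∑ m ∈ Finset.range (N + 2), F₁ χ q τ z₀ b m z = osc (-τ) z₀ z +
      φ₁ χ (fun v => osc τ z₀ v * q v * ∑ m ∈ Finset.range (N + 1), F₁ χ q τ z₀ b m v)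
        τ z₀ b z := by
  induction N with
  | zero =>
    have : (fun v => osc τ z₀ v * q v * ∑ m ∈ Finset.range (0 + 1), F₁ χ q τ z₀ b m v) = q := by
      ext v
      rw [Finset.sum_range_one, F₁, mul_right_comm, osc_mul_osc_neg, one_mul]
    rw [this, Finset.sum_range_succ, Finset.sum_range_one, F₁]
    rfl
  | succ N ih =>
    have hsum : ∀ v, ‖∑ m ∈ Finset.range (N + 1), F₁ χ q τ z₀ b m v‖ ≤
        ∑ m ∈ Finset.range (N + 1), r ^ m := fun v =>
      (norm_sum_le _ _).trans (Finset.sum_le_sum fun m _ => hF m v)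
    have h₁ := hC _ _ b (Finset.sum_nonneg fun m _ => pow_nonneg hr₀ m)
      (aestronglyMeasurable_osc_mul_mul τ z₀ hq (aestronglyMeasurable_sum_F₁ hχ hq (N + 1)))
      (norm_osc_mul_mul_le τ z₀ q hsum) τ z₀ hτ
    have h₂ := hC _ _ 0 (pow_nonneg hr₀ (N + 1)) (aestronglyMeasurable_osc_mul_mul τ z₀ hq
      (aestronglyMeasurable_F₁ (τ := τ) (z₀ := z₀) (b := b) hχ hq (N + 1)))
      (norm_osc_mul_mul_le τ z₀ q (hF (N + 1))) τ z₀ hτ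
    have hadd := φ₁_add h₁.1 h₂.1 (h₁.2 z).1 (h₂.2 z).1
    have hfun : (fun v => osc τ z₀ v * q v * ∑ m ∈ Finset.range (N + 1 + 1), F₁ χ q τ z₀ b m v) =
        fun v => osc τ z₀ v * q v * ∑ m ∈ Finset.range (N + 1), F₁ χ q τ z₀ b m v +
          osc τ z₀ v * q v * F₁ χ q τ z₀ b (N + 1) v := by
      ext v
      rw [Finset.sum_range_succ, mul_add]
    rw [hfun]
    rw [add_zero] at hadd
    rw [hadd, Finset.sum_range_succ, show N + 1 + 1 = N + 2 from rfl, ih, F₁_succ_succ, add_assoc]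

/-- The sum of the series solves the integral equation
`f = e^{-iτ(Φ+Φ̄)} + ¼ ∂̄⁻¹(e^{-iτ(Φ+Φ̄)} χ (b - ∂⁻¹(e^{iτ(Φ+Φ̄)} q f)))`. -/
theorem f₁_eq (hC : IsDecayConst χ q α C) (hχ : Continuous χ)
    (hq : AEStronglyMeasurable q) (hτ : 1 < τ) (hr₀ : 0 ≤ r) (hr₁ : r < 1)
    (hF : ∀ m z, ‖F₁ χ q τ z₀ b m z‖ ≤ r ^ m) (z : ℂ) :
    f₁ χ q τ z₀ b z = osc (-τ) z₀ z +
      φ₁ χ (fun v => osc τ z₀ v * q v * f₁ χ q τ z₀ b v) τ z₀ b z := by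
  set P : ℕ → ℂ → ℂ := fun N v => ∑ m ∈ Finset.range N, F₁ χ q τ z₀ b m v with hP
  have htend : ∀ v, Tendsto (fun N => P N v) atTop (nhds (f₁ χ q τ z₀ b v)) := fun v =>
    (hasSum_f₁ hr₀ hr₁ hF v).tendsto_sum_nat
  have hinv : 0 < (1 - r)⁻¹ := inv_pos.mpr (by linarith)
  have htail : ∀ N v, ‖P N v - f₁ χ q τ z₀ b v‖ ≤ r ^ N * (1 - r)⁻¹ := fun N v => by
    have := norm_sub_le_of_geometric_bound_of_hasSum (C := 1) hr₁ (fun m => by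
      simpa using hF m v) (hasSum_f₁ hr₀ hr₁ hF v) N
    simpa [div_eq_mul_inv] using this
  have hfm := aestronglyMeasurable_f₁ hr₀ hr₁ hF hχ hq
  have hf := hC _ _ b hinv.le (aestronglyMeasurable_osc_mul_mul τ z₀ hq hfm)
    (norm_osc_mul_mul_le τ z₀ q (norm_f₁_le hr₀ hr₁ hF)) τ z₀ hτ
  have hdiff : ∀ N, ‖φ₁ χ (fun v => osc τ z₀ v * q v * P N v) τ z₀ b z -
      φ₁ χ (fun v => osc τ z₀ v * q v * f₁ χ q τ z₀ b v) τ z₀ b z‖ ≤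
      C * τ ^ (-α) * (r ^ N * (1 - r)⁻¹) := by
    intro N
    have hsub : AEStronglyMeasurable (fun v => P N v - f₁ χ q τ z₀ b v) :=
      (aestronglyMeasurable_sum_F₁ hχ hq N).sub hfm
    have h := hC _ _ 0 (mul_nonneg (pow_nonneg hr₀ N) hinv.le)
      (aestronglyMeasurable_osc_mul_mul τ z₀ hq hsub)
      (norm_osc_mul_mul_le τ z₀ q (htail N)) τ z₀ hτ
    have hadd := φ₁_add hf.1 h.1 (hf.2 z).1 (h.2 z).1
    have hfun : (fun v => osc τ z₀ v * q v * P N v) =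
        fun v => osc τ z₀ v * q v * f₁ χ q τ z₀ b v +
          osc τ z₀ v * q v * (P N v - f₁ χ q τ z₀ b v) := by
      ext v; ring
    rw [add_zero] at hadd
    rw [hfun]
    have h2 := (h.2 z).2
    rw [norm_zero, zero_add] at h2
    refine le_trans (le_of_eq ?_) h2
    rw [hadd, add_sub_cancel_left]
  have hlim : Tendsto (fun N => φ₁ χ (fun v => osc τ z₀ v * q v * P (N + 1) v) τ z₀ b z) atTop
      (nhds (φ₁ χ (fun v => osc τ z₀ v * q v * f₁ χ q τ z₀ b v) τ z₀ b z)) := by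
    rw [tendsto_iff_norm_sub_tendsto_zero]
    refine squeeze_zero (fun _ => norm_nonneg _) (fun N => hdiff (N + 1)) ?_
    have h0 := ((tendsto_pow_atTop_nhds_zero_of_lt_one hr₀ hr₁).comp (tendsto_add_atTop_nat 1))
    have := (h0.mul_const ((1 - r)⁻¹)).const_mul (C * τ ^ (-α))
    simpa using this
  refine tendsto_nhds_unique ((htend z).comp (tendsto_add_atTop_nat 2)) ?_
  refine (hlim.const_add (osc (-τ) z₀ z)).congr fun N => ?_
  exact (sum_F₁_eq hC hχ hq hτ hr₀ hF N z).symm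

end Neumann

/-! ### The Cauchy–Pompeiu formula and its dual form -/

/-- The Wirtinger derivative `∂̄ = (∂₁ + i ∂₂) / 2`. -/
noncomputable def dbar (f : ℂ → ℂ) (z : ℂ) : ℂ :=
  (fderiv ℝ f z 1 + Complex.I * fderiv ℝ f z Complex.I) / 2

/-- The Wirtinger derivative `∂ = (∂₁ - i ∂₂) / 2`. -/
noncomputable def del (f : ℂ → ℂ) (z : ℂ) : ℂ :=
  (fderiv ℝ f z 1 - Complex.I * fderiv ℝ f z Complex.I) / 2

/-- `∂̄` computed in a rotated orthonormal frame. -/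
theorem conj_mul_dbar (f : ℂ → ℂ) (z : ℂ) {e : ℂ} (he : e * conj e = 1) :
    e⁻¹ * dbar f z = (fderiv ℝ f z e + Complex.I * fderiv ℝ f z (Complex.I * e)) / 2 := by
  have hdec : ∀ v : ℂ, fderiv ℝ f z v = v.re * fderiv ℝ f z 1 + v.im * fderiv ℝ f z Complex.I := by
    intro v
    have : v = v.re • (1 : ℂ) + v.im • Complex.I := by
      simp [Complex.re_add_im]
    conv_lhs => rw [this]
    rw [map_add, map_smul, map_smul]
    simp
  have hinv : e⁻¹ = conj e := inv_eq_of_mul_eq_one_right he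
  rw [hinv, hdec e, hdec (Complex.I * e), dbar]
  have h1 : (Complex.I * e).re = -e.im := by simp
  have h2 : (Complex.I * e).im = e.re := by simp
  have h3 : conj e = e.re - e.im * Complex.I := by
    apply Complex.ext <;> simp
  rw [h1, h2, h3]
  push_cast
  linear_combination (-(e.im : ℂ) * fderiv ℝ f z Complex.I / 2) * Complex.I_sq

theorem integrableOn_polar {k : ℝ × ℝ → ℂ} (hk : Continuous k) {R : ℝ}
    (hR : ∀ x : ℝ × ℝ, R < x.1 → k x = 0) :
    IntegrableOn k (Set.Ioi (0 : ℝ) ×ˢ Set.Ioo (-Real.pi) Real.pi) := by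
  have h1 : IntegrableOn k (Set.Icc 0 R ×ˢ Set.Icc (-Real.pi) Real.pi) :=
    hk.continuousOn.integrableOn_compact (isCompact_Icc.prod isCompact_Icc)
  refine IntegrableOn.of_forall_sdiff_eq_zero h1 (measurableSet_Ioi.prod measurableSet_Ioo) ?_
  rintro ⟨r, t⟩ ⟨⟨hr, ht⟩, hnot⟩
  refine hR _ ?_
  by_contra hle
  exact hnot ⟨⟨le_of_lt hr, not_lt.mp hle⟩, Set.Ioo_subset_Icc_self ht⟩

/-- The Cauchy–Pompeiu formula: in polar coordinates around `z`, the angular part of `∂̄θ`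
integrates to zero by periodicity, and the radial part by the fundamental theorem of calculus. -/
theorem dbarInv_dbar {θ : ℂ → ℂ} (hθ : ContDiff ℝ 1 θ) (hc : HasCompactSupport θ) (z : ℂ) :
    dbarInv (dbar θ) z = θ z := by
  set e : ℝ → ℂ := fun t => Complex.exp (t * Complex.I) with he
  have hec : Continuous e := by simp only [he]; fun_prop
  have hee : ∀ t, e t * conj (e t) = 1 := fun t => by
    rw [Complex.mul_conj, Complex.normSq_eq_norm_sq]
    simp only [he, Complex.norm_exp_ofReal_mul_I]
    simp
  have hne : ∀ t, e t ≠ 0 := fun t => Complex.exp_ne_zero _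
  have hnorm : ∀ t, ‖e t‖ = 1 := fun t => Complex.norm_exp_ofReal_mul_I t
  have hdiff : Differentiable ℝ θ := hθ.differentiable (by simp)
  have hfc : Continuous (fderiv ℝ θ) := hθ.continuous_fderiv (by simp)
  set γ : ℝ × ℝ → ℂ := fun x => z + x.1 * e x.2 with hγ
  have hγc : Continuous γ := by simp only [hγ]; fun_prop
  set A : ℝ × ℝ → ℂ := fun x => fderiv ℝ θ (γ x) (e x.2) with hA
  set B : ℝ × ℝ → ℂ := fun x => fderiv ℝ θ (γ x) (Complex.I * e x.2) with hB
  have hAc : Continuous A := (hfc.comp hγc).clm_apply (by fun_prop)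
  have hBc : Continuous B := (hfc.comp hγc).clm_apply (by fun_prop)
  obtain ⟨R₀, hR₀⟩ := hc.isBounded.subset_closedBall (0 : ℂ)
  set R := |R₀| + ‖z‖ with hR
  have hout : ∀ x : ℝ × ℝ, R < x.1 → γ x ∉ tsupport θ := by
    intro x hx hmem
    have h1 : ‖γ x‖ ≤ R₀ := by simpa using hR₀ hmem
    have h2 : ‖(x.1 : ℂ) * e x.2‖ ≤ ‖γ x‖ + ‖z‖ := by
      have := norm_sub_le (γ x) z
      rwa [hγ, add_sub_cancel_left] at this
    rw [norm_mul, hnorm, mul_one, Complex.norm_real] at h2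
    have := le_abs_self x.1
    have := le_abs_self R₀
    rw [Real.norm_eq_abs] at h2
    linarith
  have hfz : ∀ x : ℝ × ℝ, R < x.1 → fderiv ℝ θ (γ x) = 0 := fun x hx => by
    by_contra h
    exact hout x hx (support_fderiv_subset ℝ h)
  have hAi := integrableOn_polar hAc (R := R) fun x hx => by simp [hA, hfz x hx]
  have hBi := integrableOn_polar hBc (R := R) fun x hx => by simp [hB, hfz x hx]
  -- the radial part
  have hrad : ∀ t, ∫ r in Set.Ioi (0 : ℝ), A (r, t) = -θ z := by
    intro t
    have hd : ∀ r : ℝ, HasDerivAt (fun r : ℝ => θ (z + r * e t)) (A (r, t)) r := by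
      intro r
      have h1 : HasDerivAt (fun r : ℝ => z + (r : ℂ) * e t) (e t) r := by
        simpa using ((hasDerivAt_id (r : ℂ)).comp_ofReal.mul_const (e t)).const_add z
      exact (hdiff _).hasFDerivAt.comp_hasDerivAt r h1
    have hev : ∀ r : ℝ, R < r → θ (z + r * e t) = 0 := fun r hr =>
      image_eq_zero_of_notMem_tsupport (hout (r, t) hr)
    have hint : IntegrableOn (fun r => A (r, t)) (Set.Ioi 0) := by
      have h1 : IntegrableOn (fun r => A (r, t)) (Set.Icc 0 R) :=
        (hAc.comp (by fun_prop)).continuousOn.integrableOn_compact isCompact_Icc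
      refine IntegrableOn.of_forall_sdiff_eq_zero h1 measurableSet_Ioi ?_
      rintro r ⟨hr, hnot⟩
      have : R < r := by
        by_contra hle
        exact hnot ⟨le_of_lt hr, not_lt.mp hle⟩
      simp [hA, hfz (r, t) this]
    have hlim : Tendsto (fun r : ℝ => θ (z + r * e t)) atTop (nhds 0) :=
      tendsto_const_nhds.congr' (by
        filter_upwards [eventually_gt_atTop R] with r hr using (hev r hr).symm)
    have := integral_Ioi_of_hasDerivAt_of_tendsto (hd 0).continuousAt.continuousWithinAt
      (fun r _ => hd r) hint hlim
    simpa using this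
  -- the angular part
  have hang : ∀ r : ℝ, 0 < r → ∫ t in Set.Ioo (-Real.pi) Real.pi, B (r, t) = 0 := by
    intro r hr
    have hd : ∀ t : ℝ, HasDerivAt (fun t : ℝ => θ (z + r * e t)) ((r : ℂ) * B (r, t)) t := by
      intro t
      have h0 : HasDerivAt e (e t * Complex.I) t := by
        simpa using ((hasDerivAt_id (t : ℂ)).comp_ofReal.mul_const Complex.I).cexp
      have h1 : HasDerivAt (fun t : ℝ => z + (r : ℂ) * e t) (r • (Complex.I * e t)) t := by
        have := (h0.const_mul (r : ℂ)).const_add z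
        rwa [mul_comm (e t), ← Complex.real_smul] at this
      have := (hdiff (z + r * e t)).hasFDerivAt.comp_hasDerivAt t h1
      rwa [map_smul, Complex.real_smul] at this
    have hcont : Continuous fun t : ℝ => (r : ℂ) * B (r, t) :=
      continuous_const.mul (hBc.comp (by fun_prop))
    have h1 := intervalIntegral.integral_eq_sub_of_hasDerivAt (a := -Real.pi) (b := Real.pi)
      (fun t _ => hd t) (hcont.intervalIntegrable _ _)
    have hper : e Real.pi = e (-Real.pi) := by simp [he, Complex.exp_neg]
    rw [hper, sub_self, intervalIntegral.integral_const_mul,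
      intervalIntegral.integral_of_le (by linarith [Real.pi_pos]),
      integral_Ioc_eq_integral_Ioo] at h1
    have hrC : (r : ℂ) ≠ 0 := by exact_mod_cast hr.ne'
    exact (mul_eq_zero.mp h1).resolve_left hrC
  have hvol : (volume : Measure (ℝ × ℝ)) = (volume : Measure ℝ).prod volume := rfl
  have hAint : ∫ x in Set.Ioi (0 : ℝ) ×ˢ Set.Ioo (-Real.pi) Real.pi, A x =
      -(2 * Real.pi * θ z) := by
    rw [hvol, ← setIntegral_prod_swap, setIntegral_prod]
    · simp only [Prod.swap_prod_mk, hrad]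
      rw [setIntegral_const]
      simp [Measure.real, Real.volume_Ioo, ENNReal.toReal_ofReal, Real.pi_pos.le, ← two_mul]
    · have : IntegrableOn A (Set.Ioi (0 : ℝ) ×ˢ Set.Ioo (-Real.pi) Real.pi)
          ((volume : Measure ℝ).prod volume) := hAi
      rw [IntegrableOn, ← Measure.prod_restrict] at this ⊢
      exact this.swap
  have hBint : ∫ x in Set.Ioi (0 : ℝ) ×ˢ Set.Ioo (-Real.pi) Real.pi, B x = 0 := by
    rw [hvol, setIntegral_prod _ hBi]
    exact setIntegral_eq_zero_of_forall_eq_zero fun r hr => hang r hr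
  have hpolar : ∫ u : ℂ, dbar θ (z + u) / u = -(Real.pi * θ z) := by
    rw [← Complex.integral_comp_polarCoord_symm]
    have hcongr : ∫ x in polarCoord.target, x.1 • (dbar θ (z + Complex.polarCoord.symm x) /
        Complex.polarCoord.symm x) = ∫ x in Set.Ioi (0 : ℝ) ×ˢ Set.Ioo (-Real.pi) Real.pi,
          (A x + Complex.I * B x) / 2 := by
      refine setIntegral_congr_fun (measurableSet_Ioi.prod measurableSet_Ioo) fun x hx => ?_
      have hx0 : (x.1 : ℂ) ≠ 0 := by exact_mod_cast (ne_of_gt hx.1)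
      have hsymm : Complex.polarCoord.symm x = x.1 * e x.2 := by
        rw [Complex.polarCoord_symm_apply]
        simp only [he, Complex.exp_mul_I, Complex.ofReal_cos, Complex.ofReal_sin]
      simp only [hsymm]
      have := conj_mul_dbar θ (γ x) (hee x.2)
      simp only [hA, hB]
      rw [← this, Complex.real_smul]
      have := hne x.2
      field_simp
      rfl
    rw [hcongr, integral_div, integral_add hAi (hBi.const_mul _), integral_const_mul, hAint, hBint]
    ring
  have hsub : ∫ w, dbar θ w / (z - w) = -∫ u : ℂ, dbar θ (z + u) / u := by
    rw [← integral_add_left_eq_self (fun w => dbar θ w / (z - w)) z, ← integral_neg]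
    refine integral_congr_ae (Eventually.of_forall fun u => ?_)
    simp [div_neg]
  rw [dbarInv, hsub, hpolar]
  have : (Real.pi : ℂ) ≠ 0 := by exact_mod_cast Real.pi_ne_zero
  field_simp

theorem conj_dbarInv (u : ℂ → ℂ) (z : ℂ) : conj (dbarInv u z) = dInv (fun w => conj (u w)) z := by
  rw [dbarInv, dInv, map_mul, ← integral_conj]
  simp

theorem fderiv_conj (f : ℂ → ℂ) (z v : ℂ) :
    fderiv ℝ (fun w => conj (f w)) z v = conj (fderiv ℝ f z v) := by
  have : (fun w => conj (f w)) = Complex.conjCLE ∘ f := rfl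
  rw [this, Complex.conjCLE.comp_fderiv]
  simp

theorem conj_del (f : ℂ → ℂ) (z : ℂ) : conj (del f z) = dbar (fun w => conj (f w)) z := by
  simp [del, dbar, fderiv_conj, map_ofNat]

theorem dInv_del {θ : ℂ → ℂ} (hθ : ContDiff ℝ 1 θ) (hc : HasCompactSupport θ) (z : ℂ) :
    dInv (del θ) z = θ z := by
  have h1 : ContDiff ℝ 1 (fun w => conj (θ w)) := Complex.conjCLE.contDiff.comp hθ
  have h2 : HasCompactSupport (fun w => conj (θ w)) := hc.comp_left (map_zero _)
  have h3 : del θ = fun w => conj (dbar (fun w => conj (θ w)) w) := by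
    ext w; rw [← conj_del, Complex.conj_conj]
  rw [h3, ← conj_dbarInv, dbarInv_dbar h1 h2, Complex.conj_conj]

theorem integral_kernel_swap {κ : ℂ → ℂ} (hκm : Measurable κ) (hκ : ∀ u, ‖κ u‖ ≤ ‖u‖⁻¹)
    {Ψ θ : ℂ → ℂ} (hΨ : Integrable Ψ) (hθ : Continuous θ) (hc : HasCompactSupport θ) :
    ∫ z, (∫ w, Ψ w * κ (z - w)) * θ z = ∫ w, Ψ w * ∫ z, θ z * κ (z - w) := by
  obtain ⟨R, hR⟩ := hc.isBounded.subset_closedBall (0 : ℂ)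
  obtain ⟨M, hM⟩ := hc.exists_bound_of_continuous hθ
  obtain ⟨C, hC, hCw⟩ := exists_lintegral_wt_le (e := 1) (by norm_num) R
  have hM0 : 0 ≤ M := (norm_nonneg _).trans (hM 0)
  have hpt : ∀ z w, ‖θ z * κ (z - w)‖ₑ ≤
      (Metric.closedBall (0 : ℂ) R).indicator (fun z => ENNReal.ofReal M * wt 1 (z - w)) z := by
    intro z w
    by_cases hz : z ∈ Metric.closedBall (0 : ℂ) R
    · rw [Set.indicator_of_mem hz, enorm_mul]
      gcongr
      · rw [← ofReal_norm]; exact ENNReal.ofReal_le_ofReal (hM z)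
      · refine le_trans ?_ (enorm_inv_le_wt (z - w))
        rw [← ofReal_norm, ← ofReal_norm, norm_inv]
        exact ENNReal.ofReal_le_ofReal (hκ _)
    · rw [image_eq_zero_of_notMem_tsupport fun h => hz (hR h)]
      simp
  have hbound : ∀ w, ∫⁻ z, ‖θ z * κ (z - w)‖ₑ ≤ ENNReal.ofReal M * C := fun w => by
    refine (lintegral_mono fun z => hpt z w).trans ?_
    rw [lintegral_indicator measurableSet_closedBall,
      lintegral_const_mul' _ _ ENNReal.ofReal_ne_top]
    gcongr
    exact hCw w
  have hmeas : AEStronglyMeasurable (fun x : ℂ × ℂ => Ψ x.1 * (θ x.2 * κ (x.2 - x.1)))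
      ((volume : Measure ℂ).prod volume) := by
    refine hΨ.1.comp_fst.mul (AEStronglyMeasurable.mul (by fun_prop) ?_)
    exact (hκm.comp (by fun_prop)).aestronglyMeasurable
  have hint : Integrable (fun x : ℂ × ℂ => Ψ x.1 * (θ x.2 * κ (x.2 - x.1)))
      ((volume : Measure ℂ).prod volume) := by
    refine ⟨hmeas, hasFiniteIntegral_iff_enorm.mpr ?_⟩
    rw [lintegral_prod _ hmeas.enorm]
    calc ∫⁻ w, ∫⁻ z, ‖Ψ w * (θ z * κ (z - w))‖ₑ
        = ∫⁻ w, ‖Ψ w‖ₑ * ∫⁻ z, ‖θ z * κ (z - w)‖ₑ := by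
          refine lintegral_congr fun w => ?_
          simp_rw [enorm_mul (Ψ w)]
          rw [lintegral_const_mul' _ _ (by simp)]
      _ ≤ ∫⁻ w, ‖Ψ w‖ₑ * (ENNReal.ofReal M * C) :=
          lintegral_mono fun w => mul_le_mul_right (hbound w) _
      _ = (∫⁻ w, ‖Ψ w‖ₑ) * (ENNReal.ofReal M * C) := lintegral_mul_const' _ _ (by finiteness)
      _ < ⊤ := ENNReal.mul_lt_top (hasFiniteIntegral_iff_enorm.mp hΨ.2) (by finiteness)
  calc ∫ z, (∫ w, Ψ w * κ (z - w)) * θ z = ∫ z, ∫ w, Ψ w * (θ z * κ (z - w)) := by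
        refine integral_congr_ae (Eventually.of_forall fun z => ?_)
        simp only
        rw [← integral_mul_const]
        refine integral_congr_ae (Eventually.of_forall fun w => ?_)
        simp only; ring
    _ = ∫ w, ∫ z, Ψ w * (θ z * κ (z - w)) := (integral_integral_swap hint).symm
    _ = _ := by simp_rw [integral_const_mul]

/-- Up to sign `∂̄⁻¹` is its own transpose, as its kernel is odd. -/
theorem integral_dbarInv_mul {Ψ θ : ℂ → ℂ} (hΨ : Integrable Ψ) (hθ : Continuous θ)
    (hc : HasCompactSupport θ) : ∫ z, dbarInv Ψ z * θ z = -∫ w, Ψ w * dbarInv θ w := by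
  have h := integral_kernel_swap (κ := fun u => u⁻¹) measurable_inv
    (fun u => (norm_inv u).le) hΨ hθ hc
  have hneg : ∀ w, ∫ z, θ z * (z - w)⁻¹ = -∫ z, θ z * (w - z)⁻¹ := fun w => by
    rw [← integral_neg]
    congr 1
    ext z
    rw [← mul_neg, ← inv_neg, neg_sub]
  simp only [dbarInv, div_eq_mul_inv, one_mul, mul_assoc, mul_left_comm (Ψ _)]
  rw [integral_const_mul, integral_const_mul, h]
  simp_rw [hneg, mul_neg, integral_neg, mul_neg]

theorem integral_dInv_mul {Ψ θ : ℂ → ℂ} (hΨ : Integrable Ψ) (hθ : Continuous θ)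
    (hc : HasCompactSupport θ) : ∫ z, dInv Ψ z * θ z = -∫ w, Ψ w * dInv θ w := by
  have h := integral_kernel_swap (κ := fun u => (conj u)⁻¹)
    (measurable_inv.comp (by fun_prop)) (fun u => by simp) hΨ hθ hc
  have hneg : ∀ w, ∫ z, θ z * (conj (z - w))⁻¹ = -∫ z, θ z * (conj (w - z))⁻¹ := fun w => by
    rw [← integral_neg]
    congr 1
    ext z
    rw [← mul_neg, ← inv_neg, ← map_neg, neg_sub]
  simp only [dInv, div_eq_mul_inv, one_mul, mul_assoc, mul_left_comm (Ψ _)]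
  rw [integral_const_mul, integral_const_mul, h]
  simp_rw [hneg, mul_neg, integral_neg, mul_neg]

theorem hasCompactSupport_dbar {θ : ℂ → ℂ} (hc : HasCompactSupport θ) :
    HasCompactSupport (dbar θ) :=
  (hc.fderiv ℝ).mono fun z hz h => hz (by simp [dbar, h])

theorem hasCompactSupport_del {θ : ℂ → ℂ} (hc : HasCompactSupport θ) :
    HasCompactSupport (del θ) :=
  (hc.fderiv ℝ).mono fun z hz h => hz (by simp [del, h])

/-! ### Square integrability of Cauchy transforms -/

theorem eLpNorm_two_rpow (f : ℂ → ℂ) (μ : Measure ℂ) :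
    eLpNorm f 2 μ ^ (2 : ℝ) = ∫⁻ z, ‖f z‖ₑ ^ (2 : ℝ) ∂μ := by
  rw [eLpNorm_eq_lintegral_rpow_enorm_toReal (by simp) (by simp), ← ENNReal.rpow_mul]
  simp

/-- Cauchy–Schwarz for the lower integral. -/
theorem lintegral_mul_rpow_two_le {μ : Measure ℂ} {f g : ℂ → ℝ≥0∞} (hf : AEMeasurable f μ)
    (hg : AEMeasurable g μ) :
    (∫⁻ z, f z * g z ∂μ) ^ (2 : ℝ) ≤ (∫⁻ z, f z ^ (2 : ℝ) ∂μ) * ∫⁻ z, g z ^ (2 : ℝ) ∂μ := by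
  have h := ENNReal.lintegral_mul_le_Lp_mul_Lq μ Real.HolderConjugate.two_two hf hg
  calc (∫⁻ z, f z * g z ∂μ) ^ (2 : ℝ)
      ≤ ((∫⁻ z, f z ^ (2 : ℝ) ∂μ) ^ (1 / (2 : ℝ)) *
          (∫⁻ z, g z ^ (2 : ℝ) ∂μ) ^ (1 / (2 : ℝ))) ^ (2 : ℝ) := by
        gcongr
        exact h
    _ = _ := by
        rw [ENNReal.mul_rpow_of_nonneg _ _ (by norm_num), ← ENNReal.rpow_mul, ← ENNReal.rpow_mul]
        norm_num

/-- The `L^p` potential theoretic gain: `∂⁻¹` maps compactly supported `L^p` densities, `p > 1`,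
to locally square integrable functions. -/
theorem memLp_two_dInv {p R : ℝ} (hp₂ : p < 2) {Q : ℂ → ℂ} (hQ : Potential p R Q) (R' : ℝ) :
    MemLp (dInv Q) 2 (volume.restrict (Metric.closedBall 0 R')) := by
  have hp := hQ.one_lt
  have hQm := hQ.memLp.1
  refine ⟨(aestronglyMeasurable_dInv hQm).restrict, ?_⟩
  obtain ⟨C₁, hC₁, h₁⟩ := exists_lintegral_wt_le (e := 1) (by norm_num) R
  obtain ⟨C₂, hC₂, h₂⟩ := exists_lintegral_wt_le (e := 2 / p)
    (by rw [div_lt_iff₀ (by linarith)]; linarith) R'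
  have hI : ∫⁻ v, ‖Q v‖ₑ ^ p ≠ ⊤ := by
    have := lintegral_rpow_enorm_lt_top_of_eLpNorm_lt_top (by simp; linarith) (by simp) hQ.memLp.2
    rw [ENNReal.toReal_ofReal (by linarith)] at this
    exact this.ne
  set I := ∫⁻ v, ‖Q v‖ₑ ^ p with hIdef
  set D := Metric.closedBall (0 : ℂ) R
  set D' := Metric.closedBall (0 : ℂ) R'
  have hxm : AEMeasurable (fun v => ‖Q v‖ₑ) := hQm.enorm
  have mwt : ∀ (e : ℝ) (w : ℂ), Measurable fun v : ℂ => wt e (w - v) := fun e w =>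
    (measurable_wt e).comp (by fun_prop)
  have hp2 : (2 - p) ≠ 0 := by linarith
  have hp1 : (p - 1) ≠ 0 := by linarith
  have hp0 : p ≠ 0 := by linarith
  have hconj : (p / (2 - p)).HolderConjugate (p / (2 * (p - 1))) := by
    rw [Real.holderConjugate_iff]
    refine ⟨by rw [lt_div_iff₀] <;> linarith, ?_⟩
    field_simp
    ring
  have hbase : ∀ w, ‖dInv Q w‖ₑ ≤ ∫⁻ v in D, ‖Q v‖ₑ * wt 1 (w - v) := by
    intro w
    rw [dInv, enorm_mul, ← lintegral_indicator measurableSet_closedBall]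
    refine (mul_le_of_le_one_left (by simp) enorm_one_div_pi_le).trans ?_
    refine (enorm_integral_le_lintegral_enorm _).trans (lintegral_mono fun v => ?_)
    by_cases hv : v ∈ D
    · rw [Set.indicator_of_mem hv, div_eq_mul_inv, enorm_mul, ← map_inv₀]
      gcongr
      have h : ‖conj ((w - v)⁻¹)‖ₑ = ‖(w - v)⁻¹‖ₑ := by
        rw [← ofReal_norm, ← ofReal_norm, Complex.norm_conj]
      rw [h]
      exact enorm_inv_le_wt _
    · simp [hQ.eq_zero v hv]
  have hsq : ∀ w, ‖dInv Q w‖ₑ ^ (2 : ℝ) ≤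
      (∫⁻ v in D, ‖Q v‖ₑ ^ p * wt (2 / p) (w - v)) * (I + C₁) := by
    intro w
    have hsplit : ∀ v, ‖Q v‖ₑ * wt 1 (w - v) = (‖Q v‖ₑ ^ (p / 2) * wt (1 / p) (w - v)) *
        (‖Q v‖ₑ ^ (1 - p / 2) * wt (1 - 1 / p) (w - v)) := by
      intro v
      have e1 : ‖Q v‖ₑ = ‖Q v‖ₑ ^ (p / 2) * ‖Q v‖ₑ ^ (1 - p / 2) := by
        rw [← ENNReal.rpow_add_of_nonneg _ _ (by linarith) (by linarith)]
        simp
      have e2 : wt 1 (w - v) = wt (1 / p) (w - v) * wt (1 - 1 / p) (w - v) := by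
        rw [wt_mul_wt]; congr 1; ring
      rw [e2]
      nth_rewrite 1 [e1]
      ring
    calc ‖dInv Q w‖ₑ ^ (2 : ℝ) ≤ (∫⁻ v in D, (‖Q v‖ₑ ^ (p / 2) * wt (1 / p) (w - v)) *
          (‖Q v‖ₑ ^ (1 - p / 2) * wt (1 - 1 / p) (w - v))) ^ (2 : ℝ) := by
          simp_rw [← hsplit]
          gcongr
          exact hbase w
      _ ≤ (∫⁻ v in D, (‖Q v‖ₑ ^ (p / 2) * wt (1 / p) (w - v)) ^ (2 : ℝ)) *
          ∫⁻ v in D, (‖Q v‖ₑ ^ (1 - p / 2) * wt (1 - 1 / p) (w - v)) ^ (2 : ℝ) :=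
          lintegral_mul_rpow_two_le
            ((hxm.pow_const _).mul (mwt _ w).aemeasurable).restrict
            ((hxm.pow_const _).mul (mwt _ w).aemeasurable).restrict
      _ ≤ _ := by
          refine mul_le_mul' (le_of_eq ?_) ?_
          · refine lintegral_congr fun v => ?_
            rw [ENNReal.mul_rpow_of_nonneg _ _ (by norm_num), ← ENNReal.rpow_mul, wt_rpow]
            congr 2 <;> ring
          · calc ∫⁻ v in D, (‖Q v‖ₑ ^ (1 - p / 2) * wt (1 - 1 / p) (w - v)) ^ (2 : ℝ)
                ≤ ∫⁻ v in D, (‖Q v‖ₑ ^ p + wt 1 (w - v)) := by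
                  refine lintegral_mono fun v => ?_
                  simp only
                  rw [ENNReal.mul_rpow_of_nonneg _ _ (by norm_num)]
                  refine (ennreal_mul_le_rpow_add_rpow hconj _ _).trans (le_of_eq ?_)
                  rw [← ENNReal.rpow_mul, ← ENNReal.rpow_mul, wt_rpow, wt_rpow]
                  congr 2
                  · field_simp
                  · field_simp
              _ = (∫⁻ v in D, ‖Q v‖ₑ ^ p) + ∫⁻ v in D, wt 1 (w - v) :=
                  lintegral_add_right _ (mwt _ w)
              _ ≤ I + C₁ := by
                  gcongr
                  · exact setLIntegral_le_lintegral _ _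
                  · simp_rw [wt_sub_comm _ w]; exact h₁ w
  have hfin : ∫⁻ w in D', ‖dInv Q w‖ₑ ^ (2 : ℝ) ≤ I * C₂ * (I + C₁) := by
    calc ∫⁻ w in D', ‖dInv Q w‖ₑ ^ (2 : ℝ)
        ≤ ∫⁻ w in D', (∫⁻ v in D, ‖Q v‖ₑ ^ p * wt (2 / p) (w - v)) * (I + C₁) :=
          lintegral_mono fun w => hsq w
      _ = (∫⁻ w in D', ∫⁻ v in D, ‖Q v‖ₑ ^ p * wt (2 / p) (w - v)) * (I + C₁) :=
          lintegral_mul_const' _ _ (by finiteness)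
      _ ≤ _ := by
          gcongr
          rw [lintegral_lintegral_swap]
          · calc ∫⁻ v in D, ∫⁻ w in D', ‖Q v‖ₑ ^ p * wt (2 / p) (w - v)
                ≤ ∫⁻ v in D, ‖Q v‖ₑ ^ p * C₂ := by
                  refine lintegral_mono fun v => ?_
                  rw [lintegral_const_mul' _ _ (ENNReal.rpow_ne_top_of_nonneg (by linarith)
                    (by simp))]
                  gcongr
                  exact h₂ v
              _ = (∫⁻ v in D, ‖Q v‖ₑ ^ p) * C₂ := lintegral_mul_const' _ _ hC₂
              _ ≤ _ := by gcongr; exact setLIntegral_le_lintegral _ _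
          · refine AEMeasurable.mul ?_ ((measurable_wt _).comp (by fun_prop)).aemeasurable
            exact (hxm.restrict.comp_snd).pow_const p
  have h3 : eLpNorm (dInv Q) 2 (volume.restrict D') ^ (2 : ℝ) < ⊤ := by
    rw [eLpNorm_two_rpow]
    exact hfin.trans_lt (by finiteness)
  by_contra h
  rw [not_lt, top_le_iff] at h
  rw [h] at h3
  simp at h3

theorem memLp_two_φ₁Density {p R : ℝ} (hp₂ : p < 2) {χ Q : ℂ → ℂ} (hQ : Potential p R Q)
    (hχ : Continuous χ) (hχR : tsupport χ ⊆ Metric.closedBall 0 R) (τ : ℝ) (z₀ b : ℂ) :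
    MemLp (φ₁Density χ Q τ z₀ b) 2 := by
  set D := Metric.closedBall (0 : ℂ) R with hD
  have : IsFiniteMeasure (volume.restrict D) :=
    ⟨by rw [Measure.restrict_apply_univ]; exact measure_closedBall_lt_top⟩
  have h1 : MemLp (fun w => b - dInv Q w) 2 (volume.restrict D) :=
    (memLp_const b).sub (memLp_two_dInv hp₂ hQ R)
  obtain ⟨L, hL⟩ := (isCompact_closedBall (0 : ℂ) R).exists_bound_of_continuousOn hχ.continuousOn
  have h2 : MemLp (φ₁Density χ Q τ z₀ b) 2 (volume.restrict D) := by
    refine h1.of_le_mul (c := L) ?_ ?_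
    · exact (((continuous_osc _ z₀).aestronglyMeasurable.mul hχ.aestronglyMeasurable).mul
        (aestronglyMeasurable_const.sub (aestronglyMeasurable_dInv hQ.memLp.1))).restrict
    · filter_upwards [ae_restrict_mem measurableSet_closedBall] with w hw
      rw [φ₁Density, norm_mul, norm_mul, norm_osc, one_mul]
      exact mul_le_mul_of_nonneg_right (hL w hw) (norm_nonneg _)
  have h3 : D.indicator (φ₁Density χ Q τ z₀ b) = φ₁Density χ Q τ z₀ b := by
    refine Set.indicator_eq_self.mpr fun w hw => hχR (subset_tsupport _ fun h => hw ?_)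
    simp [φ₁Density, h]
  rwa [← memLp_indicator_iff_restrict measurableSet_closedBall, h3] at h2

/-- The Cauchy transform is bounded from `L²` of a ball to `L²` of another ball. -/
theorem exists_eLpNorm_dbarInv_le (R R' : ℝ) :
    ∃ C : ℝ≥0∞, C ≠ ⊤ ∧ ∀ φ : ℂ → ℂ, AEStronglyMeasurable φ →
      (∀ z ∉ Metric.closedBall (0 : ℂ) R, φ z = 0) →
      eLpNorm (dbarInv φ) 2 (volume.restrict (Metric.closedBall 0 R')) ≤ C * eLpNorm φ 2 := by
  obtain ⟨C₁, hC₁, h₁⟩ := exists_lintegral_wt_le (e := 1) (by norm_num) R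
  obtain ⟨C₂, hC₂, h₂⟩ := exists_lintegral_wt_le (e := 1) (by norm_num) R'
  refine ⟨(C₁ * C₂) ^ (1 / 2 : ℝ), ENNReal.rpow_ne_top_of_nonneg (by norm_num) (by finiteness),
    fun φ hφ hsupp => ?_⟩
  set D := Metric.closedBall (0 : ℂ) R
  set D' := Metric.closedBall (0 : ℂ) R'
  have mwt : ∀ (e : ℝ) (w : ℂ), Measurable fun v : ℂ => wt e (w - v) := fun e w =>
    (measurable_wt e).comp (by fun_prop)
  have hxm : AEMeasurable (fun v => ‖φ v‖ₑ) := hφ.enorm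
  have hpt : ∀ z, ‖dbarInv φ z‖ₑ ^ (2 : ℝ) ≤ C₁ * ∫⁻ w, ‖φ w‖ₑ ^ (2 : ℝ) * wt 1 (z - w) := by
    intro z
    have hbase : ‖dbarInv φ z‖ₑ ≤
        ∫⁻ w in D, wt (1 / 2) (z - w) * (‖φ w‖ₑ * wt (1 / 2) (z - w)) := by
      rw [dbarInv, enorm_mul, ← lintegral_indicator measurableSet_closedBall]
      refine (mul_le_of_le_one_left (by simp) enorm_one_div_pi_le).trans ?_
      refine (enorm_integral_le_lintegral_enorm _).trans (lintegral_mono fun w => ?_)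
      by_cases hw : w ∈ D
      · rw [Set.indicator_of_mem hw, div_eq_mul_inv, enorm_mul, mul_left_comm, wt_mul_wt]
        gcongr
        refine (enorm_inv_le_wt _).trans (le_of_eq ?_)
        norm_num
      · simp [hsupp w hw]
    calc ‖dbarInv φ z‖ₑ ^ (2 : ℝ)
        ≤ (∫⁻ w in D, wt (1 / 2) (z - w) * (‖φ w‖ₑ * wt (1 / 2) (z - w))) ^ (2 : ℝ) := by
          gcongr
      _ ≤ (∫⁻ w in D, wt (1 / 2) (z - w) ^ (2 : ℝ)) *
          ∫⁻ w in D, (‖φ w‖ₑ * wt (1 / 2) (z - w)) ^ (2 : ℝ) :=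
          lintegral_mul_rpow_two_le (mwt _ z).aemeasurable
            (hxm.mul (mwt _ z).aemeasurable).restrict
      _ ≤ _ := by
          refine mul_le_mul' ?_ ?_
          · simp_rw [wt_rpow, wt_sub_comm _ z]
            norm_num
            exact h₁ z
          · refine (lintegral_mono' Measure.restrict_le_self le_rfl).trans (le_of_eq ?_)
            refine lintegral_congr fun w => ?_
            rw [ENNReal.mul_rpow_of_nonneg _ _ (by norm_num), wt_rpow]
            norm_num
  have hmain : eLpNorm (dbarInv φ) 2 (volume.restrict D') ^ (2 : ℝ) ≤
      C₁ * C₂ * eLpNorm φ 2 ^ (2 : ℝ) := by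
    rw [eLpNorm_two_rpow, eLpNorm_two_rpow]
    calc ∫⁻ z in D', ‖dbarInv φ z‖ₑ ^ (2 : ℝ)
        ≤ ∫⁻ z in D', C₁ * ∫⁻ w, ‖φ w‖ₑ ^ (2 : ℝ) * wt 1 (z - w) :=
          lintegral_mono fun z => hpt z
      _ = C₁ * ∫⁻ w, ∫⁻ z in D', ‖φ w‖ₑ ^ (2 : ℝ) * wt 1 (z - w) := by
          rw [lintegral_const_mul' _ _ hC₁, lintegral_lintegral_swap]
          refine AEMeasurable.mul ?_ ((measurable_wt _).comp (by fun_prop)).aemeasurable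
          exact (hxm.comp_snd).pow_const _
      _ ≤ C₁ * ∫⁻ w, ‖φ w‖ₑ ^ (2 : ℝ) * C₂ := by
          gcongr with w
          rw [lintegral_const_mul' _ _ (ENNReal.rpow_ne_top_of_nonneg (by norm_num) (by simp))]
          gcongr
          exact h₂ w
      _ = _ := by rw [lintegral_mul_const' _ _ hC₂]; ring
  calc eLpNorm (dbarInv φ) 2 (volume.restrict D')
      = (eLpNorm (dbarInv φ) 2 (volume.restrict D') ^ (2 : ℝ)) ^ (1 / 2 : ℝ) := by
        rw [← ENNReal.rpow_mul]; norm_num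
    _ ≤ (C₁ * C₂ * eLpNorm φ 2 ^ (2 : ℝ)) ^ (1 / 2 : ℝ) := by gcongr
    _ = _ := by
        rw [ENNReal.mul_rpow_of_nonneg _ _ (by norm_num), ← ENNReal.rpow_mul _ 2]
        norm_num

/-! ### The energy identity -/

theorem integral_mul_fderiv_eq_neg {f g : ℂ → ℂ} (hf : ContDiff ℝ 1 f) (hg : ContDiff ℝ 1 g)
    (hc : HasCompactSupport g) (v : ℂ) :
    ∫ z, f z * fderiv ℝ g z v = -∫ z, fderiv ℝ f z v * g z := by
  have hfd : Continuous fun z => fderiv ℝ f z v :=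
    (hf.continuous_fderiv (by simp)).clm_apply continuous_const
  have hgd : Continuous fun z => fderiv ℝ g z v :=
    (hg.continuous_fderiv (by simp)).clm_apply continuous_const
  have hgc : HasCompactSupport fun z => fderiv ℝ g z v := hc.fderiv_apply (𝕜 := ℝ) v
  refine integral_mul_fderiv_eq_neg_fderiv_mul_of_integrable ?_ ?_ ?_
    (fun z _ => hf.differentiable (by simp) z) (fun z _ => hg.differentiable (by simp) z)
  · exact (hfd.mul hg.continuous).integrable_of_hasCompactSupport hc.mul_left
  · exact (hf.continuous.mul hgd).integrable_of_hasCompactSupport hgc.mul_left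
  · exact (hf.continuous.mul hg.continuous).integrable_of_hasCompactSupport hc.mul_left

theorem contDiff_fderiv_apply_const {f : ℂ → ℂ} (hf : ContDiff ℝ ∞ f) (v : ℂ) :
    ContDiff ℝ ∞ fun z => fderiv ℝ f z v :=
  (hf.fderiv_right (m := ∞) (by simp)).clm_apply contDiff_const

theorem fderiv_fderiv_comm {f : ℂ → ℂ} (hf : ContDiff ℝ ∞ f) (z u v : ℂ) :
    fderiv ℝ (fun w => fderiv ℝ f w u) z v = fderiv ℝ (fun w => fderiv ℝ f w v) z u := by
  have hd : DifferentiableAt ℝ (fderiv ℝ f) z :=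
    (hf.fderiv_right (m := ∞) (by simp)).differentiable (by simp) z
  have h : ∀ u v : ℂ, fderiv ℝ (fun w => fderiv ℝ f w u) z v = fderiv ℝ (fderiv ℝ f) z v u := by
    intro u v
    rw [fderiv_clm_apply hd (differentiableAt_const _)]
    simp
  rw [h, h]
  have h2 : minSmoothness ℝ 2 ≤ (∞ : WithTop ℕ∞) := by
    simp only [minSmoothness_of_isRCLikeNormedField]
    exact WithTop.coe_le_coe.mpr (le_top (a := (2 : ℕ∞)))
  exact (hf.contDiffAt.isSymmSndFDerivAt h2) v u

/-- For test functions the full gradient is controlled in `L²` by `∂̄`. -/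
theorem integral_norm_fderiv_sq_add {W : ℂ → ℂ} (hW : ContDiff ℝ ∞ W) (hc : HasCompactSupport W) :
    (∫ z, ‖fderiv ℝ W z 1‖ ^ 2) + ∫ z, ‖fderiv ℝ W z Complex.I‖ ^ 2 =
      4 * ∫ z, ‖dbar W z‖ ^ 2 := by
  set a : ℂ → ℂ := fun z => fderiv ℝ W z 1 with ha
  set b : ℂ → ℂ := fun z => fderiv ℝ W z Complex.I with hb
  have hac : ContDiff ℝ ∞ a := contDiff_fderiv_apply_const hW 1
  have hbc : ContDiff ℝ ∞ b := contDiff_fderiv_apply_const hW Complex.I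
  have has : HasCompactSupport a := hc.fderiv_apply (𝕜 := ℝ) 1
  have hbs : HasCompactSupport b := hc.fderiv_apply (𝕜 := ℝ) Complex.I
  set V : ℂ → ℂ := fun z => conj (W z) with hV
  have hVc : ContDiff ℝ ∞ V := Complex.conjCLE.contDiff.comp hW
  have hVs : HasCompactSupport V := hc.comp_left (map_zero _)
  have hVa : ∀ z, fderiv ℝ V z 1 = conj (a z) := fun z => fderiv_conj W z 1
  have hVb : ∀ z, fderiv ℝ V z Complex.I = conj (b z) := fun z => fderiv_conj W z Complex.I
  have hcross : ∫ z, a z * conj (b z) = ∫ z, b z * conj (a z) := by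
    simp_rw [← hVa, ← hVb]
    rw [integral_mul_fderiv_eq_neg (hac.of_le (by simp)) (hVc.of_le (by simp)) hVs,
      integral_mul_fderiv_eq_neg (hbc.of_le (by simp)) (hVc.of_le (by simp)) hVs]
    congr 2
    ext z
    simp only [ha, hb]
    rw [fderiv_fderiv_comm hW z 1 Complex.I]
  have hi1 : Integrable fun z => a z * conj (b z) :=
    (hac.continuous.mul (Complex.continuous_conj.comp hbc.continuous)).integrable_of_hasCompactSupport has.mul_right
  have hi2 : Integrable fun z => b z * conj (a z) :=
    (hbc.continuous.mul (Complex.continuous_conj.comp hac.continuous)).integrable_of_hasCompactSupport hbs.mul_right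
  have hsq : ∀ {f : ℂ → ℂ}, ContDiff ℝ ∞ f → HasCompactSupport f →
      Integrable fun z => ‖f z‖ ^ 2 := fun {f} hf hs => by
    have h1 : HasCompactSupport fun z => ‖f z‖ ^ 2 := hs.norm.comp_left (g := fun x : ℝ => x ^ 2)
      (by simp)
    exact (hf.continuous.norm.pow 2).integrable_of_hasCompactSupport h1
  have hpt : ∀ z, 4 * ‖dbar W z‖ ^ 2 = ‖a z‖ ^ 2 + ‖b z‖ ^ 2 +
      (-Complex.I * (a z * conj (b z) - b z * conj (a z))).re := by
    intro z
    have h1 : dbar W z = (a z + Complex.I * b z) / 2 := rfl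
    rw [h1, norm_div, div_pow, Complex.norm_two]
    simp only [← Complex.normSq_eq_norm_sq, Complex.normSq_apply, Complex.add_re, Complex.add_im,
      Complex.mul_re, Complex.mul_im, Complex.I_re, Complex.I_im, Complex.sub_re, Complex.sub_im,
      Complex.conj_re, Complex.conj_im, Complex.neg_re, Complex.neg_im]
    ring
  have hzero : ∫ z, (-Complex.I * (a z * conj (b z) - b z * conj (a z))).re = 0 := by
    have h1 : Integrable fun z => -Complex.I * (a z * conj (b z) - b z * conj (a z)) :=
      (hi1.sub hi2).const_mul _
    have h2 : ∫ z, (-Complex.I * (a z * conj (b z) - b z * conj (a z))).re =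
        (∫ z, -Complex.I * (a z * conj (b z) - b z * conj (a z))).re := by
      simpa using integral_re h1
    rw [h2, integral_const_mul, integral_sub hi1 hi2, hcross, sub_self, mul_zero, Complex.zero_re]
  have hi3 : Integrable fun z => (-Complex.I * (a z * conj (b z) - b z * conj (a z))).re := by
    simpa using ((hi1.sub hi2).const_mul (-Complex.I)).re
  have hab : Integrable fun z => ‖a z‖ ^ 2 + ‖b z‖ ^ 2 := (hsq hac has).add (hsq hbc hbs)
  rw [← integral_const_mul]
  simp_rw [hpt]
  rw [integral_add hab hi3, hzero, add_zero,
    integral_add (hsq hac has) (hsq hbc hbs)]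

/-! ### Cauchy transforms of test functions -/

theorem locallyIntegrable_inv : LocallyIntegrable (fun u : ℂ => u⁻¹) := by
  refine locallyIntegrable_of_norm_le_rpow (C := 1) (α := 1) (by simp) (by simp)
    (Eventually.of_forall fun u => ?_) measurable_inv.aestronglyMeasurable
  rw [Real.rpow_neg_one, one_mul, norm_inv]

theorem dbarInvConverges_of_continuous {φ : ℂ → ℂ} (hφ : Continuous φ) (hc : HasCompactSupport φ)
    (z : ℂ) : DbarInvConverges φ z := by
  have h : Integrable fun t : ℂ => t⁻¹ * φ (z - t) :=
    hc.convolutionExists_right (ContinuousLinearMap.mul ℝ ℂ) locallyIntegrable_inv hφ z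
  refine (h.comp_sub_left z).congr (Eventually.of_forall fun w => ?_)
  simp only [sub_sub_cancel]
  rw [mul_comm, div_eq_mul_inv]

theorem dbarInv_eq_convolution (φ : ℂ → ℂ) :
    dbarInv φ = fun z => (1 / (Real.pi : ℂ)) *
      ((fun u : ℂ => u⁻¹) ⋆[ContinuousLinearMap.mul ℝ ℂ, volume] φ) z := by
  ext z
  rw [dbarInv, convolution_def, ← integral_sub_left_eq_self _ _ z]
  congr 2
  ext w
  simp [div_eq_mul_inv, mul_comm]

theorem contDiff_dbarInv {φ : ℂ → ℂ} (hφ : ContDiff ℝ ∞ φ) (hc : HasCompactSupport φ) :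
    ContDiff ℝ ∞ (dbarInv φ) := by
  rw [dbarInv_eq_convolution]
  exact contDiff_const.mul (hc.contDiff_convolution_right _ locallyIntegrable_inv hφ)

theorem fderiv_dbarInv {φ : ℂ → ℂ} (hφ : ContDiff ℝ ∞ φ) (hc : HasCompactSupport φ) (z v : ℂ) :
    fderiv ℝ (dbarInv φ) z v = dbarInv (fun w => fderiv ℝ φ w v) z := by
  have h := hc.hasFDerivAt_convolution_right (ContinuousLinearMap.mul ℝ ℂ) locallyIntegrable_inv
    (hφ.of_le (by simp)) z
  have h2 := (h.const_mul (1 / (Real.pi : ℂ))).fderiv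
  rw [dbarInv_eq_convolution, h2, dbarInv_eq_convolution, smul_apply, smul_eq_mul,
    convolution_precompR_apply _ locallyIntegrable_inv (hc.fderiv ℝ)
      (hφ.continuous_fderiv (by simp))]

theorem dbar_dbarInv {φ : ℂ → ℂ} (hφ : ContDiff ℝ ∞ φ) (hc : HasCompactSupport φ) (z : ℂ) :
    dbar (dbarInv φ) z = φ z := by
  have h1 := dbarInvConverges_of_continuous (contDiff_fderiv_apply_const hφ 1).continuous
    (hc.fderiv_apply (𝕜 := ℝ) 1) z
  have h2 := dbarInvConverges_of_continuous (contDiff_fderiv_apply_const hφ Complex.I).continuous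
    (hc.fderiv_apply (𝕜 := ℝ) Complex.I) z
  unfold DbarInvConverges at h1 h2
  rw [← dbarInv_dbar (hφ.of_le (by simp)) hc z, dbar, fderiv_dbarInv hφ hc, fderiv_dbarInv hφ hc]
  simp only [dbarInv, dbar]
  have : ∀ w, (fderiv ℝ φ w 1 + Complex.I * fderiv ℝ φ w Complex.I) / 2 / (z - w) =
      (fderiv ℝ φ w 1 / (z - w) + Complex.I * (fderiv ℝ φ w Complex.I / (z - w))) / 2 :=
    fun w => by ring
  simp_rw [this]
  rw [integral_div, integral_add h1 (h2.const_mul _), integral_const_mul]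
  ring

theorem dbar_mul {f g : ℂ → ℂ} (hf : Differentiable ℝ f) (hg : Differentiable ℝ g) (z : ℂ) :
    dbar (fun w => f w * g w) z = f z * dbar g z + dbar f z * g z := by
  simp only [dbar]
  rw [fderiv_fun_mul (hf z) (hg z)]
  simp only [add_apply, smul_apply, smul_eq_mul]
  ring

theorem del_mul {f g : ℂ → ℂ} (hf : Differentiable ℝ f) (hg : Differentiable ℝ g) (z : ℂ) :
    del (fun w => f w * g w) z = f z * del g z + del f z * g z := by
  simp only [del]
  rw [fderiv_fun_mul (hf z) (hg z)]
  simp only [add_apply, smul_apply, smul_eq_mul]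
  ring

theorem continuous_dbar {f : ℂ → ℂ} (hf : ContDiff ℝ ∞ f) : Continuous (dbar f) :=
  ((contDiff_fderiv_apply_const hf 1).continuous.add
    (continuous_const.mul (contDiff_fderiv_apply_const hf Complex.I).continuous)).div_const 2

theorem eLpNorm_two_eq_ofReal {f : ℂ → ℂ} (hf : Continuous f) (hc : HasCompactSupport f) :
    eLpNorm f 2 ^ (2 : ℝ) = ENNReal.ofReal (∫ z, ‖f z‖ ^ 2) := by
  have h1 : HasCompactSupport fun z => ‖f z‖ ^ 2 := hc.norm.comp_left (g := fun x : ℝ => x ^ 2)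
    (by simp)
  have hi : Integrable fun z => ‖f z‖ ^ 2 := (hf.norm.pow 2).integrable_of_hasCompactSupport h1
  rw [eLpNorm_two_rpow, ofReal_integral_eq_lintegral_ofReal hi
    (Eventually.of_forall fun z => by positivity)]
  refine lintegral_congr fun z => ?_
  rw [ENNReal.ofReal_pow (norm_nonneg _), ofReal_norm, ENNReal.rpow_ofNat]

theorem eLpNorm_fderiv_le {W : ℂ → ℂ} (hW : ContDiff ℝ ∞ W) (hc : HasCompactSupport W) {v : ℂ}
    (hv : v = 1 ∨ v = Complex.I) :
    eLpNorm (fun z => fderiv ℝ W z v) 2 ≤ 2 * eLpNorm (dbar W) 2 := by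
  have hE := integral_norm_fderiv_sq_add hW hc
  have h0 : ∀ u, 0 ≤ ∫ z, ‖fderiv ℝ W z u‖ ^ 2 := fun u => integral_nonneg fun z => by positivity
  have hle : ∫ z, ‖fderiv ℝ W z v‖ ^ 2 ≤ 4 * ∫ z, ‖dbar W z‖ ^ 2 := by
    rcases hv with rfl | rfl
    · linarith [h0 Complex.I]
    · linarith [h0 1]
  have hsq : eLpNorm (fun z => fderiv ℝ W z v) 2 ^ (2 : ℝ) ≤ (2 * eLpNorm (dbar W) 2) ^ (2 : ℝ) := by
    rw [ENNReal.mul_rpow_of_nonneg _ _ (by norm_num),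
      eLpNorm_two_eq_ofReal (contDiff_fderiv_apply_const hW v).continuous
        (hc.fderiv_apply (𝕜 := ℝ) v),
      eLpNorm_two_eq_ofReal (continuous_dbar hW) (hasCompactSupport_dbar hc)]
    refine (ENNReal.ofReal_le_ofReal hle).trans (le_of_eq ?_)
    rw [ENNReal.ofReal_mul (by norm_num)]
    norm_num
  exact (ENNReal.rpow_le_rpow_iff (by norm_num)).mp hsq

/-- Local `L²` boundedness of the gradient of the Cauchy transform. -/
theorem exists_eLpNorm_fderiv_dbarInv_le {R : ℝ} (hR : 0 ≤ R) :
    ∃ C : ℝ≥0∞, C ≠ ⊤ ∧ ∀ φ : ℂ → ℂ, ContDiff ℝ ∞ φ → HasCompactSupport φ →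
      (∀ z ∉ Metric.closedBall (0 : ℂ) R, φ z = 0) → ∀ v : ℂ, v = 1 ∨ v = Complex.I →
      eLpNorm (fun z => fderiv ℝ (dbarInv φ) z v) 2 (volume.restrict (Metric.closedBall 0 R)) ≤
        C * eLpNorm φ 2 := by
  let B : ContDiffBump (0 : ℂ) := ⟨R + 1, R + 2, by linarith, by linarith⟩
  set η : ℂ → ℂ := fun z => ((B z : ℝ) : ℂ) with hη
  have hηc : ContDiff ℝ ∞ η := Complex.ofRealCLM.contDiff.comp B.contDiff
  have hηs : HasCompactSupport η := B.hasCompactSupport.comp_left (g := fun x : ℝ => (x : ℂ)) (by simp)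
  have hη1 : ∀ z ∈ Metric.closedBall (0 : ℂ) (R + 1), η z = 1 := fun z hz => by
    simp only [hη, B.one_of_mem_closedBall hz, Complex.ofReal_one]
  have hηle : ∀ z, ‖η z‖ ≤ 1 := fun z => by
    rw [hη, Complex.norm_real, Real.norm_of_nonneg B.nonneg]
    exact B.le_one
  have hη0 : ∀ z ∉ Metric.closedBall (0 : ℂ) (R + 2), z ∉ tsupport η := fun z hz hmem => by
    refine hz ?_
    have h1 : tsupport η ⊆ tsupport B := by
      refine closure_mono fun w hw => ?_
      rw [Function.mem_support] at hw ⊢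
      intro h
      exact hw (by simp [hη, h])
    have h2 := h1 hmem
    rwa [B.tsupport_eq] at h2
  obtain ⟨K, hK⟩ := (hasCompactSupport_dbar hηs).exists_bound_of_continuous (continuous_dbar hηc)
  obtain ⟨C, hC, hCb⟩ := exists_eLpNorm_dbarInv_le R (R + 2)
  refine ⟨2 * (1 + ENNReal.ofReal K * C), by finiteness, fun φ hφ hc hsupp v hv => ?_⟩
  set u := dbarInv φ with hu
  have huc : ContDiff ℝ ∞ u := contDiff_dbarInv hφ hc
  set D := Metric.closedBall (0 : ℂ) R
  set D₂ := Metric.closedBall (0 : ℂ) (R + 2) with hD₂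
  set W : ℂ → ℂ := fun z => η z * u z with hW
  have hWc : ContDiff ℝ ∞ W := hηc.mul huc
  have hWs : HasCompactSupport W := hηs.mul_right
  have hloc : ∀ z ∈ D, fderiv ℝ u z v = fderiv ℝ W z v := by
    intro z hz
    have : W =ᶠ[nhds z] u := by
      have hmem : Metric.ball (0 : ℂ) (R + 1) ∈ nhds z := by
        refine Metric.isOpen_ball.mem_nhds ?_
        have : ‖z‖ ≤ R := by simpa [D] using hz
        rw [mem_ball_zero_iff]; linarith
      filter_upwards [hmem] with w hw
      simp only [hW, hη1 w (Metric.ball_subset_closedBall hw), one_mul]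
    rw [this.fderiv_eq]
  have hdbarW : dbar W = (fun z => η z * φ z) + D₂.indicator fun z => dbar η z * u z := by
    ext z
    rw [hW, dbar_mul (hηc.differentiable (by simp)) (huc.differentiable (by simp)), hu,
      dbar_dbarInv hφ hc, Pi.add_apply]
    by_cases hz : z ∈ D₂
    · rw [Set.indicator_of_mem hz]
    · have hz' : dbar η z = 0 := by
        have : fderiv ℝ η z = 0 := by
          by_contra h
          exact hη0 z hz (support_fderiv_subset ℝ h)
        simp [dbar, this]
      rw [Set.indicator_of_notMem hz, hz', zero_mul]
  have h1 : eLpNorm (fun z => η z * φ z) 2 ≤ eLpNorm φ 2 := by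
    refine eLpNorm_mono fun z => ?_
    rw [norm_mul]
    exact mul_le_of_le_one_left (norm_nonneg _) (hηle z)
  have h2 : eLpNorm (D₂.indicator fun z => dbar η z * u z) 2 ≤
      ENNReal.ofReal K * (C * eLpNorm φ 2) := by
    rw [eLpNorm_indicator_eq_eLpNorm_restrict measurableSet_closedBall]
    refine (eLpNorm_le_mul_eLpNorm_of_ae_le_mul (g := u) (c := K)
      (Eventually.of_forall fun z => ?_) 2).trans ?_
    · rw [norm_mul]
      exact mul_le_mul_of_nonneg_right (hK z) (norm_nonneg _)
    · gcongr
      exact hCb φ hφ.continuous.aestronglyMeasurable hsupp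
  have h3 : eLpNorm (dbar W) 2 ≤ eLpNorm φ 2 + ENNReal.ofReal K * (C * eLpNorm φ 2) := by
    have m1 : AEStronglyMeasurable fun z => η z * φ z :=
      (hηc.continuous.mul hφ.continuous).aestronglyMeasurable
    have m2 : AEStronglyMeasurable fun z => dbar η z * u z :=
      ((continuous_dbar hηc).mul huc.continuous).aestronglyMeasurable
    rw [hdbarW]
    exact (eLpNorm_add_le m1 (m2.indicator measurableSet_closedBall) (by norm_num)).trans
      (add_le_add h1 h2)
  have h4 : eLpNorm (fun z => fderiv ℝ u z v) 2 (volume.restrict D) =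
      eLpNorm (fun z => fderiv ℝ W z v) 2 (volume.restrict D) :=
    eLpNorm_congr_ae ((ae_restrict_mem measurableSet_closedBall).mono fun z hz => hloc z hz)
  have h5 : eLpNorm (fun z => fderiv ℝ W z v) 2 (volume.restrict D) ≤
      eLpNorm (fun z => fderiv ℝ W z v) 2 := eLpNorm_mono_measure _ Measure.restrict_le_self
  rw [h4]
  refine (h5.trans (eLpNorm_fderiv_le hWc hWs hv)).trans ?_
  refine (mul_le_mul_right h3 2).trans (le_of_eq ?_)
  ring

/-! ### Weak derivatives -/

theorem IsTestFunction.memLp {U : Set ℂ} {φ : ℂ → ℂ} (h : IsTestFunction U φ) (μ : Measure ℂ)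
    [IsFiniteMeasureOnCompacts μ] : MemLp φ 2 μ :=
  h.1.continuous.memLp_of_hasCompactSupport h.2.1

theorem IsTestFunction.eq_zero {U : Set ℂ} {φ : ℂ → ℂ} (h : IsTestFunction U φ) {z : ℂ}
    (hz : z ∉ U) : φ z = 0 :=
  image_eq_zero_of_notMem_tsupport fun hmem => hz (h.2.2 hmem)

theorem IsTestFunction.fderiv_apply {U : Set ℂ} {φ : ℂ → ℂ} (h : IsTestFunction U φ) (v : ℂ) :
    IsTestFunction U fun z => fderiv ℝ φ z v :=
  ⟨contDiff_fderiv_apply_const h.1 v, h.2.1.fderiv_apply (𝕜 := ℝ) v,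
    (tsupport_fderiv_apply_subset ℝ v).trans h.2.2⟩

theorem setIntegral_eq_of_isTestFunction {U : Set ℂ} {φ : ℂ → ℂ} (h : IsTestFunction U φ)
    (f : ℂ → ℂ) : ∫ z in U, f z * φ z = ∫ z, f z * φ z :=
  setIntegral_eq_integral_of_forall_compl_eq_zero fun z hz => by rw [h.eq_zero hz, mul_zero]

/-- The space of test functions on `U`. -/
def testSpace (U : Set ℂ) : Submodule ℂ (ℂ → ℂ) where
  carrier := {φ | IsTestFunction U φ}
  zero_mem' := ⟨contDiff_const, HasCompactSupport.zero, by simp [tsupport]⟩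
  add_mem' := fun {f g} hf hg => ⟨hf.1.add hg.1, hf.2.1.add hg.2.1,
    (tsupport_add f g).trans (Set.union_subset hf.2.2 hg.2.2)⟩
  smul_mem' := fun c f hf => ⟨contDiff_const.smul hf.1, hf.2.1.smul_left,
    (tsupport_smul_subset_right (fun _ => c) f).trans hf.2.2⟩

/-- A functional on test functions that is bounded in the `L²(U)` norm is represented by a
function in `L²(U)`, by the Hahn–Banach and Riesz theorems. -/
theorem exists_memLp_integral_eq {U : Set ℂ} (ℓ : testSpace U →ₗ[ℂ] ℂ) {C : ℝ}
    (hℓ : ∀ φ : testSpace U, ‖ℓ φ‖ ≤ C * (eLpNorm (φ : ℂ → ℂ) 2 (volume.restrict U)).toReal) :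
    ∃ g : ℂ → ℂ, MemLp g 2 (volume.restrict U) ∧
      ∀ φ : testSpace U, ℓ φ = ∫ z in U, g z * (φ : ℂ → ℂ) z := by
  set μ := volume.restrict U with hμ
  have hmem : ∀ φ : testSpace U, MemLp (φ : ℂ → ℂ) 2 μ := fun φ => IsTestFunction.memLp φ.2 μ
  let J : testSpace U →ₗ[ℂ] Lp ℂ 2 μ :=
    { toFun := fun φ => (hmem φ).toLp _
      map_add' := fun φ ψ => MemLp.toLp_add (hmem φ) (hmem ψ)
      map_smul' := fun c φ => MemLp.toLp_const_smul c (hmem φ) }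
  have hJ : ∀ φ, ‖J φ‖ = (eLpNorm (φ : ℂ → ℂ) 2 μ).toReal := fun φ => Lp.norm_toLp _ (hmem φ)
  have hker : LinearMap.ker J ≤ LinearMap.ker ℓ := by
    intro φ hφ
    rw [LinearMap.mem_ker] at hφ ⊢
    have h := hℓ φ
    rw [← hJ, hφ, norm_zero, mul_zero] at h
    exact norm_le_zero_iff.mp h
  let ℓ' : LinearMap.range J →ₗ[ℂ] ℂ :=
    ((LinearMap.ker J).liftQ ℓ hker).comp (J.quotKerEquivRange.symm : _ →ₗ[ℂ] _)
  have hℓ' : ∀ φ, ℓ' ⟨J φ, LinearMap.mem_range_self J φ⟩ = ℓ φ := by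
    intro φ
    simp only [ℓ', LinearMap.comp_apply, LinearEquiv.coe_coe]
    have : J.quotKerEquivRange.symm ⟨J φ, LinearMap.mem_range_self J φ⟩ =
        (LinearMap.ker J).mkQ φ := by
      rw [LinearEquiv.symm_apply_eq]
      rfl
    rw [this]
    simp
  let Λ : StrongDual ℂ (LinearMap.range J) := ℓ'.mkContinuous C (by
    rintro ⟨_, φ, rfl⟩
    rw [hℓ']
    exact (hℓ φ).trans (by rw [← hJ]; rfl))
  obtain ⟨Λ', hΛ', -⟩ := exists_extension_norm_eq (LinearMap.range J) Λ
  set G : Lp ℂ 2 μ := (InnerProductSpace.toDual ℂ (Lp ℂ 2 μ)).symm Λ' with hG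
  refine ⟨fun z => conj (G z), ?_, fun φ => ?_⟩
  · exact (Lp.memLp G).star
  · have h1 : inner ℂ G (J φ) = ℓ φ := by
      rw [hG, InnerProductSpace.toDual_symm_apply]
      rw [show J φ = ((⟨J φ, LinearMap.mem_range_self J φ⟩ : LinearMap.range J) : Lp ℂ 2 μ) from rfl,
        hΛ']
      exact hℓ' φ
    rw [← h1, L2.inner_def]
    refine integral_congr_ae ?_
    filter_upwards [(hmem φ).coeFn_toLp] with z hz
    have : (J φ : ℂ → ℂ) z = (φ : ℂ → ℂ) z := hz
    rw [this]
    simp [mul_comm]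

theorem integrable_of_memLp_of_eq_zero {r : ℝ≥0∞} (hr : 1 ≤ r) {R : ℝ} {f : ℂ → ℂ}
    (hf : MemLp f r) (hs : ∀ z ∉ Metric.closedBall (0 : ℂ) R, f z = 0) : Integrable f := by
  have : IsFiniteMeasure (volume.restrict (Metric.closedBall (0 : ℂ) R)) :=
    ⟨by rw [Measure.restrict_apply_univ]; exact measure_closedBall_lt_top⟩
  have h : IntegrableOn f (Metric.closedBall (0 : ℂ) R) := hf.restrict _ |>.integrable hr
  exact (integrableOn_iff_integrable_of_support_subset fun z hz => by_contra fun h => hz (hs z h)).mp h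

theorem eLpNorm_restrict_of_eq_zero {U : Set ℂ} (hU : MeasurableSet U) {f : ℂ → ℂ}
    (hf : ∀ z ∉ U, f z = 0) : eLpNorm f 2 (volume.restrict U) = eLpNorm f 2 := by
  rw [← eLpNorm_indicator_eq_eLpNorm_restrict hU, Set.indicator_eq_self.mpr]
  exact fun z hz => by_contra fun h => hz (hf z h)

/-- The Cauchy transform of an `L²` density has weak derivatives in `L²`. By duality this is the
`L²` bound for the gradient of the Cauchy transform of test functions. -/
theorem exists_isWeakDeriv_dbarInv {R : ℝ} (hR : 0 ≤ R) {U : Set ℂ} (hU : MeasurableSet U)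
    (hUR : U ⊆ Metric.closedBall 0 R) {Ψ : ℂ → ℂ} (hΨ : MemLp Ψ 2)
    (hs : ∀ z ∉ Metric.closedBall (0 : ℂ) R, Ψ z = 0) {v : ℂ} (hv : v = 1 ∨ v = Complex.I) :
    ∃ g : ℂ → ℂ, MemLp g 2 (volume.restrict U) ∧ IsWeakDeriv U v (dbarInv Ψ) g := by
  obtain ⟨C, hC, hCb⟩ := exists_eLpNorm_fderiv_dbarInv_le hR
  obtain ⟨C', hC', hCb'⟩ := exists_eLpNorm_dbarInv_le R R
  set D := Metric.closedBall (0 : ℂ) R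
  have hΨi := integrable_of_memLp_of_eq_zero (by norm_num) hΨ hs
  have hu : MemLp (dbarInv Ψ) 2 (volume.restrict U) := by
    refine MemLp.mono_measure (Measure.restrict_mono hUR le_rfl)
      ⟨(aestronglyMeasurable_dbarInv hΨ.1).restrict, ?_⟩
    exact (hCb' Ψ hΨ.1 hs).trans_lt (ENNReal.mul_lt_top hC'.lt_top hΨ.2)
  have hint : ∀ {φ : ℂ → ℂ}, IsTestFunction U φ →
      Integrable (fun z => dbarInv Ψ z * φ z) (volume.restrict U) := fun hφ =>
    hu.integrable_mul (hφ.memLp _)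
  let ℓ : testSpace U →ₗ[ℂ] ℂ :=
    { toFun := fun φ => -∫ z in U, dbarInv Ψ z * fderiv ℝ (φ : ℂ → ℂ) z v
      map_add' := fun φ ψ => by
        rw [← neg_add, ← integral_add (hint (IsTestFunction.fderiv_apply φ.2 v))
          (hint (IsTestFunction.fderiv_apply ψ.2 v))]
        congr 2
        ext z
        have h1 : DifferentiableAt ℝ (φ : ℂ → ℂ) z := φ.2.1.differentiable (by simp) z
        have h2 : DifferentiableAt ℝ (ψ : ℂ → ℂ) z := ψ.2.1.differentiable (by simp) z
        rw [Submodule.coe_add, fderiv_add h1 h2, add_apply, mul_add]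
      map_smul' := fun c φ => by
        rw [RingHom.id_apply, smul_eq_mul, mul_neg, ← integral_const_mul]
        congr 2
        ext z
        have h1 : DifferentiableAt ℝ (φ : ℂ → ℂ) z := φ.2.1.differentiable (by simp) z
        rw [Submodule.coe_smul, fderiv_const_smul h1, smul_apply, smul_eq_mul]
        ring }
  have hbound : ∀ φ : testSpace U, ‖ℓ φ‖ₑ ≤
      eLpNorm Ψ 2 * C * eLpNorm (φ : ℂ → ℂ) 2 (volume.restrict U) := by
    rintro ⟨φ, hφ⟩
    have hφ' : IsTestFunction U φ := hφ
    have hφs : ∀ z ∉ D, φ z = 0 := fun z hz => hφ'.eq_zero fun h => hz (hUR h)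
    set V : ℂ → ℂ := fun z => fderiv ℝ (dbarInv φ) z v with hV
    have hVm : AEMeasurable fun z => ‖V z‖ₑ :=
      (contDiff_fderiv_apply_const (contDiff_dbarInv hφ'.1 hφ'.2.1)
        v).continuous.aestronglyMeasurable.enorm
    have e1 : ℓ ⟨φ, hφ⟩ = ∫ w, Ψ w * V w := by
      change -∫ z in U, dbarInv Ψ z * fderiv ℝ φ z v = _
      rw [setIntegral_eq_of_isTestFunction (hφ'.fderiv_apply v),
        integral_dbarInv_mul hΨi (hφ'.fderiv_apply v).1.continuous (hφ'.fderiv_apply v).2.1, neg_neg]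
      simp_rw [hV, fderiv_dbarInv hφ'.1 hφ'.2.1]
    have e2 : (∫⁻ w in D, ‖Ψ w‖ₑ * ‖V w‖ₑ) ≤
        eLpNorm Ψ 2 (volume.restrict D) * eLpNorm V 2 (volume.restrict D) := by
      have h := lintegral_mul_rpow_two_le (μ := volume.restrict D) hΨ.1.enorm.restrict hVm.restrict
      rw [← eLpNorm_two_rpow, ← eLpNorm_two_rpow,
        ← ENNReal.mul_rpow_of_nonneg _ _ (by norm_num)] at h
      exact (ENNReal.rpow_le_rpow_iff (by norm_num)).mp h
    have e3 : (∫⁻ w, ‖Ψ w * V w‖ₑ) ≤ ∫⁻ w in D, ‖Ψ w‖ₑ * ‖V w‖ₑ := by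
      rw [← lintegral_indicator measurableSet_closedBall]
      refine lintegral_mono fun w => ?_
      by_cases hw : w ∈ D
      · rw [Set.indicator_of_mem hw, enorm_mul]
      · simp [hs w hw]
    rw [e1]
    refine (enorm_integral_le_lintegral_enorm _).trans (e3.trans (e2.trans ?_))
    rw [mul_assoc, eLpNorm_restrict_of_eq_zero hU fun z hz => hφ'.eq_zero hz]
    exact mul_le_mul' (eLpNorm_mono_measure _ Measure.restrict_le_self)
      (hCb φ hφ'.1 hφ'.2.1 hφs v hv)
  obtain ⟨g, hg, hgφ⟩ := exists_memLp_integral_eq ℓ (C := (eLpNorm Ψ 2 * C).toReal) fun φ => by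
    have hfin : eLpNorm Ψ 2 * C * eLpNorm (φ : ℂ → ℂ) 2 (volume.restrict U) ≠ ⊤ :=
      ENNReal.mul_ne_top (ENNReal.mul_ne_top hΨ.2.ne hC) (IsTestFunction.memLp φ.2 _).2.ne
    have h := ENNReal.toReal_mono hfin (hbound φ)
    rwa [ENNReal.toReal_mul, toReal_enorm] at h
  refine ⟨g, hg, fun φ hφ => ?_⟩
  have h : -∫ z in U, dbarInv Ψ z * fderiv ℝ φ z v = ∫ z in U, g z * φ z := hgφ ⟨φ, hφ⟩
  rw [← h, neg_neg]

theorem IsWeakDeriv.add {U : Set ℂ} {v : ℂ} {f₁ f₂ g₁ g₂ : ℂ → ℂ}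
    (h₁ : IsWeakDeriv U v f₁ g₁) (h₂ : IsWeakDeriv U v f₂ g₂)
    (hf₁ : MemLp f₁ 2 (volume.restrict U)) (hf₂ : MemLp f₂ 2 (volume.restrict U))
    (hg₁ : MemLp g₁ 2 (volume.restrict U)) (hg₂ : MemLp g₂ 2 (volume.restrict U)) :
    IsWeakDeriv U v (fun z => f₁ z + f₂ z) (fun z => g₁ z + g₂ z) := by
  intro φ hφ
  have hφ' := hφ.fderiv_apply v
  have hint : ∀ {f ψ : ℂ → ℂ}, MemLp f 2 (volume.restrict U) → IsTestFunction U ψ →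
      Integrable (fun z => f z * ψ z) (volume.restrict U) := fun hf hψ =>
    hf.integrable_mul (hψ.memLp _)
  simp_rw [add_mul]
  rw [integral_add (hint hf₁ hφ') (hint hf₂ hφ'), integral_add (hint hg₁ hφ) (hint hg₂ hφ),
    h₁ φ hφ, h₂ φ hφ, neg_add]

theorem isWeakDeriv_of_contDiff {U : Set ℂ} {f : ℂ → ℂ} (hf : ContDiff ℝ ∞ f) (v : ℂ) :
    IsWeakDeriv U v f fun z => fderiv ℝ f z v := by
  intro φ hφ
  rw [setIntegral_eq_of_isTestFunction (hφ.fderiv_apply v), setIntegral_eq_of_isTestFunction hφ]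
  exact integral_mul_fderiv_eq_neg (hf.of_le (by simp)) (hφ.1.of_le (by simp)) hφ.2.1 v

theorem memLp_two_of_continuous {U : Set ℂ} (hU : Bornology.IsBounded U) {f : ℂ → ℂ}
    (hf : Continuous f) : MemLp f 2 (volume.restrict U) := by
  obtain ⟨R, hR⟩ := hU.subset_closedBall (0 : ℂ)
  obtain ⟨M, hM⟩ := (isCompact_closedBall (0 : ℂ) R).exists_bound_of_continuousOn hf.continuousOn
  have : IsFiniteMeasure (volume.restrict (Metric.closedBall (0 : ℂ) R)) :=
    ⟨by rw [Measure.restrict_apply_univ]; exact measure_closedBall_lt_top⟩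
  refine MemLp.mono_measure (Measure.restrict_mono hR le_rfl) ?_
  refine MemLp.of_bound hf.aestronglyMeasurable M ?_
  filter_upwards [ae_restrict_mem measurableSet_closedBall] with z hz using hM z hz

theorem contDiff_osc (s : ℝ) (z₀ : ℂ) : ContDiff ℝ ∞ (osc s z₀) := by
  have h : ContDiff ℝ ∞ (fun z : ℂ => Phi z₀ z) := by unfold Phi; fun_prop
  have h2 : ContDiff ℝ ∞ (fun z : ℂ => conj (Phi z₀ z)) := Complex.conjCLE.contDiff.comp h
  exact (contDiff_const.mul (h.add h2)).cexp

theorem φ₁_eq_dbarInv (χ Q : ℂ → ℂ) (τ : ℝ) (z₀ b : ℂ) :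
    φ₁ χ Q τ z₀ b = dbarInv (fun w => (1 / 4) * φ₁Density χ Q τ z₀ b w) := by
  ext z
  simp only [φ₁, dbarInv]
  simp_rw [mul_div_assoc]
  rw [integral_const_mul]
  ring

theorem φ₁Density_eq_zero {χ : ℂ → ℂ} {R : ℝ} (hχR : tsupport χ ⊆ Metric.closedBall 0 R)
    (Q : ℂ → ℂ) (τ : ℝ) (z₀ b : ℂ) {z : ℂ} (hz : z ∉ Metric.closedBall (0 : ℂ) R) :
    φ₁Density χ Q τ z₀ b z = 0 := by
  have : χ z = 0 := image_eq_zero_of_notMem_tsupport fun h => hz (hχR h)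
  simp [φ₁Density, this]

theorem memW12_of_eq {U : Set ℂ} (hUo : IsOpen U) (hUb : Bornology.IsBounded U) {R : ℝ}
    {χ Q f : ℂ → ℂ} (hχR : tsupport χ ⊆ Metric.closedBall 0 R) {τ : ℝ} {z₀ b : ℂ}
    (hΨ : MemLp (φ₁Density χ Q τ z₀ b) 2)
    (hf : ∀ z, f z = osc (-τ) z₀ z + φ₁ χ Q τ z₀ b z) : MemW12 U f := by
  obtain ⟨R', hR'⟩ := hUb.subset_closedBall (0 : ℂ)
  set R₂ := max (max R R') 0 with hR₂
  have hR₂0 : 0 ≤ R₂ := le_max_right _ _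
  have hUR : U ⊆ Metric.closedBall 0 R₂ := hR'.trans
    (Metric.closedBall_subset_closedBall ((le_max_right _ _).trans (le_max_left _ _)))
  have hχR₂ : tsupport χ ⊆ Metric.closedBall 0 R₂ := hχR.trans
    (Metric.closedBall_subset_closedBall ((le_max_left _ _).trans (le_max_left _ _)))
  set Ψ : ℂ → ℂ := fun w => (1 / 4) * φ₁Density χ Q τ z₀ b w with hΨdef
  have hΨ2 : MemLp Ψ 2 := hΨ.const_mul _
  have hΨs : ∀ z ∉ Metric.closedBall (0 : ℂ) R₂, Ψ z = 0 := fun z hz => by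
    rw [hΨdef]; simp only [φ₁Density_eq_zero hχR₂ Q τ z₀ b hz, mul_zero]
  have hfe : f = fun z => osc (-τ) z₀ z + dbarInv Ψ z := by
    ext z; rw [hf, φ₁_eq_dbarInv]
  have hm : MeasurableSet U := hUo.measurableSet
  have hosc : MemLp (osc (-τ) z₀) 2 (volume.restrict U) :=
    memLp_two_of_continuous hUb (continuous_osc _ _)
  have hoscd : ∀ v, MemLp (fun z => fderiv ℝ (osc (-τ) z₀) z v) 2 (volume.restrict U) := fun v =>
    memLp_two_of_continuous hUb (contDiff_fderiv_apply_const (contDiff_osc _ _) v).continuous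
  have hu : MemLp (dbarInv Ψ) 2 (volume.restrict U) := by
    obtain ⟨C', hC', hCb'⟩ := exists_eLpNorm_dbarInv_le R₂ R₂
    refine MemLp.mono_measure (Measure.restrict_mono hUR le_rfl)
      ⟨(aestronglyMeasurable_dbarInv hΨ2.1).restrict, ?_⟩
    exact (hCb' Ψ hΨ2.1 hΨs).trans_lt (ENNReal.mul_lt_top hC'.lt_top hΨ2.2)
  obtain ⟨g₁, hg₁, hw₁⟩ := exists_isWeakDeriv_dbarInv hR₂0 hm hUR hΨ2 hΨs (Or.inl rfl)
  obtain ⟨g₂, hg₂, hw₂⟩ := exists_isWeakDeriv_dbarInv hR₂0 hm hUR hΨ2 hΨs (Or.inr rfl)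
  rw [hfe]
  refine ⟨hosc.add hu, _, _, (hoscd 1).add hg₁, (hoscd Complex.I).add hg₂, ?_, ?_⟩
  · exact (isWeakDeriv_of_contDiff (contDiff_osc _ _) 1).add hw₁ hosc hu (hoscd 1) hg₁
  · exact (isWeakDeriv_of_contDiff (contDiff_osc _ _) Complex.I).add hw₂ hosc hu
      (hoscd Complex.I) hg₂

/-! ### The Schrödinger equation -/

theorem laplacian_eq_fderiv {φ : ℂ → ℂ} (hφ : ContDiff ℝ ∞ φ) (z : ℂ) :
    Laplacian.laplacian φ z = fderiv ℝ (fun w => fderiv ℝ φ w 1) z 1 +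
      fderiv ℝ (fun w => fderiv ℝ φ w Complex.I) z Complex.I := by
  have hd : DifferentiableAt ℝ (fderiv ℝ φ) z :=
    (hφ.fderiv_right (m := ∞) (by simp)).differentiable (by simp) z
  have h : ∀ u v : ℂ, fderiv ℝ (fun w => fderiv ℝ φ w u) z v = fderiv ℝ (fderiv ℝ φ) z v u := by
    intro u v
    rw [fderiv_clm_apply hd (differentiableAt_const _)]
    simp
  rw [InnerProductSpace.laplacian_eq_iteratedFDeriv_complexPlane, h, h]
  simp [iteratedFDeriv_two_apply]

theorem contDiff_del {f : ℂ → ℂ} (hf : ContDiff ℝ ∞ f) : ContDiff ℝ ∞ (del f) :=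
  ((contDiff_fderiv_apply_const hf 1).sub
    (contDiff_const.mul (contDiff_fderiv_apply_const hf Complex.I))).div_const 2

theorem contDiff_dbar {f : ℂ → ℂ} (hf : ContDiff ℝ ∞ f) : ContDiff ℝ ∞ (dbar f) :=
  ((contDiff_fderiv_apply_const hf 1).add
    (contDiff_const.mul (contDiff_fderiv_apply_const hf Complex.I))).div_const 2

theorem fderiv_del {φ : ℂ → ℂ} (hφ : ContDiff ℝ ∞ φ) (z v : ℂ) :
    fderiv ℝ (del φ) z v = (fderiv ℝ (fun w => fderiv ℝ φ w 1) z v -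
      Complex.I * fderiv ℝ (fun w => fderiv ℝ φ w Complex.I) z v) / 2 := by
  have h1 := ((contDiff_fderiv_apply_const hφ 1).differentiable (by simp) z).hasFDerivAt
  have h2 := ((contDiff_fderiv_apply_const hφ Complex.I).differentiable (by simp) z).hasFDerivAt
  have h := ((h1.sub (h2.const_mul Complex.I)).mul_const (2⁻¹ : ℂ)).fderiv
  have he : del φ = fun w => (fderiv ℝ φ w 1 - Complex.I * fderiv ℝ φ w Complex.I) * 2⁻¹ := by
    ext w; rw [del, div_eq_mul_inv]
  rw [he]
  erw [h]
  simp
  ring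

theorem fderiv_dbar {φ : ℂ → ℂ} (hφ : ContDiff ℝ ∞ φ) (z v : ℂ) :
    fderiv ℝ (dbar φ) z v = (fderiv ℝ (fun w => fderiv ℝ φ w 1) z v +
      Complex.I * fderiv ℝ (fun w => fderiv ℝ φ w Complex.I) z v) / 2 := by
  have h1 := ((contDiff_fderiv_apply_const hφ 1).differentiable (by simp) z).hasFDerivAt
  have h2 := ((contDiff_fderiv_apply_const hφ Complex.I).differentiable (by simp) z).hasFDerivAt
  have h := ((h1.add (h2.const_mul Complex.I)).mul_const (2⁻¹ : ℂ)).fderiv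
  have he : dbar φ = fun w => (fderiv ℝ φ w 1 + Complex.I * fderiv ℝ φ w Complex.I) * 2⁻¹ := by
    ext w; rw [dbar, div_eq_mul_inv]
  rw [he]
  erw [h]
  simp
  ring

theorem laplacian_eq_dbar_del {φ : ℂ → ℂ} (hφ : ContDiff ℝ ∞ φ) (z : ℂ) :
    Laplacian.laplacian φ z = 4 * dbar (del φ) z := by
  rw [laplacian_eq_fderiv hφ, dbar, fderiv_del hφ, fderiv_del hφ,
    fderiv_fderiv_comm hφ z Complex.I 1]
  linear_combination (fderiv ℝ (fun w => fderiv ℝ φ w Complex.I) z Complex.I) * Complex.I_sq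

theorem laplacian_eq_del_dbar {φ : ℂ → ℂ} (hφ : ContDiff ℝ ∞ φ) (z : ℂ) :
    Laplacian.laplacian φ z = 4 * del (dbar φ) z := by
  rw [laplacian_eq_fderiv hφ, del, fderiv_dbar hφ, fderiv_dbar hφ,
    fderiv_fderiv_comm hφ z Complex.I 1]
  linear_combination (fderiv ℝ (fun w => fderiv ℝ φ w Complex.I) z Complex.I) * Complex.I_sq

theorem integral_mul_del {f g : ℂ → ℂ} (hf : ContDiff ℝ ∞ f) (hg : ContDiff ℝ ∞ g)
    (hc : HasCompactSupport g) : ∫ z, f z * del g z = -∫ z, del f z * g z := by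
  have hi : ∀ v, Integrable fun z => f z * fderiv ℝ g z v := fun v =>
    (hf.continuous.mul (contDiff_fderiv_apply_const hg v).continuous).integrable_of_hasCompactSupport
      (hc.fderiv_apply (𝕜 := ℝ) v).mul_left
  have hi' : ∀ v, Integrable fun z => fderiv ℝ f z v * g z := fun v =>
    ((contDiff_fderiv_apply_const hf v).continuous.mul hg.continuous).integrable_of_hasCompactSupport
      hc.mul_left
  have e1 : ∀ z, f z * del g z = (f z * fderiv ℝ g z 1 -
      Complex.I * (f z * fderiv ℝ g z Complex.I)) / 2 := fun z => by rw [del]; ring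
  have e2 : ∀ z, del f z * g z = (fderiv ℝ f z 1 * g z -
      Complex.I * (fderiv ℝ f z Complex.I * g z)) / 2 := fun z => by rw [del]; ring
  have h := fun v => integral_mul_fderiv_eq_neg (hf.of_le (by simp)) (hg.of_le (by simp)) hc v
  simp_rw [e1, e2]
  rw [integral_div, integral_div, integral_sub (hi 1) ((hi Complex.I).const_mul _),
    integral_sub (hi' 1) ((hi' Complex.I).const_mul _), integral_const_mul, integral_const_mul,
    h 1, h Complex.I]
  ring

/-- The holomorphic exponential `e^{iτΦ}`. -/
noncomputable def expPhi (τ : ℝ) (z₀ z : ℂ) : ℂ := Complex.exp (Complex.I * τ * Phi z₀ z)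

/-- The antiholomorphic exponential `e^{-iτΦ̄}`. -/
noncomputable def expConjPhi (τ : ℝ) (z₀ z : ℂ) : ℂ :=
  Complex.exp (-(Complex.I * τ * conj (Phi z₀ z)))

theorem contDiff_expPhi (τ : ℝ) (z₀ : ℂ) : ContDiff ℝ ∞ (expPhi τ z₀) := by
  have h : ContDiff ℝ ∞ (fun z : ℂ => Phi z₀ z) := by unfold Phi; fun_prop
  exact (contDiff_const.mul h).cexp

theorem contDiff_expConjPhi (τ : ℝ) (z₀ : ℂ) : ContDiff ℝ ∞ (expConjPhi τ z₀) := by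
  have h : ContDiff ℝ ∞ (fun z : ℂ => Phi z₀ z) := by unfold Phi; fun_prop
  have h2 : ContDiff ℝ ∞ (fun z : ℂ => conj (Phi z₀ z)) := Complex.conjCLE.contDiff.comp h
  exact (contDiff_const.mul h2).neg.cexp

theorem dbar_eq_zero_of_differentiableAt {f : ℂ → ℂ} {z : ℂ} (hf : DifferentiableAt ℂ f z) :
    dbar f z = 0 := by
  rw [dbar, hf.fderiv_restrictScalars ℝ]
  have h : fderiv ℂ f z Complex.I = Complex.I * fderiv ℂ f z 1 := by
    rw [← smul_eq_mul, ← map_smul]; simp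
  simp only [ContinuousLinearMap.coe_restrictScalars', h]
  linear_combination (fderiv ℂ f z 1 / 2) * Complex.I_sq

theorem dbar_expPhi (τ : ℝ) (z₀ z : ℂ) : dbar (expPhi τ z₀) z = 0 := by
  refine dbar_eq_zero_of_differentiableAt ?_
  unfold expPhi Phi
  fun_prop

theorem del_expConjPhi (τ : ℝ) (z₀ z : ℂ) : del (expConjPhi τ z₀) z = 0 := by
  have h : (fun w => conj (expConjPhi τ z₀ w)) = expPhi τ z₀ := by
    ext w
    simp [expConjPhi, expPhi, ← Complex.exp_conj]
  have h2 := conj_del (expConjPhi τ z₀) z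
  rw [h, dbar_expPhi] at h2
  exact (map_eq_zero _).mp h2

theorem expPhi_mul_osc_neg (τ : ℝ) (z₀ z : ℂ) :
    expPhi τ z₀ z * osc (-τ) z₀ z = expConjPhi τ z₀ z := by
  rw [expPhi, osc, expConjPhi, ← Complex.exp_add]
  congr 1
  push_cast
  ring

theorem osc_mul_expConjPhi (τ : ℝ) (z₀ z : ℂ) :
    osc τ z₀ z * expConjPhi τ z₀ z = expPhi τ z₀ z := by
  rw [← expPhi_mul_osc_neg, mul_left_comm, osc_mul_osc_neg, mul_one]

/-- A bounded solution of the integral equation gives a distributional solution: with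
`u = e^{-iτΦ̄} + ¼ e^{iτΦ} ∂̄⁻¹Ψ` one has `∂̄ u = ¼ e^{-iτΦ̄} (b - ∂⁻¹Q)` in `Ω`, and hence
`4 ∂∂̄ u = -e^{-iτΦ̄} Q = -q u`. -/
theorem isDistribSolution_of_eq {Ω : Set ℂ} {χ q f : ℂ → ℂ}
    (hχ1 : ∀ z ∈ Ω, χ z = 1) {τ : ℝ} {z₀ b : ℂ} {M : ℝ} (hfm : AEStronglyMeasurable f)
    (hfM : ∀ z, ‖f z‖ ≤ M) (hq : Integrable q)
    (hΨ : Integrable (φ₁Density χ (fun v => osc τ z₀ v * q v * f v) τ z₀ b))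
    (hf : ∀ z, f z = osc (-τ) z₀ z + φ₁ χ (fun v => osc τ z₀ v * q v * f v) τ z₀ b z) :
    IsDistribSolution Ω q (fun z => Complex.exp (Complex.I * τ * Phi z₀ z) * f z) := by
  set Q : ℂ → ℂ := fun v => osc τ z₀ v * q v * f v with hQ
  set Ψ := φ₁Density χ Q τ z₀ b with hΨdef
  set E := expPhi τ z₀ with hE
  set E' := expConjPhi τ z₀ with hE'
  have hEc : ContDiff ℝ ∞ E := contDiff_expPhi τ z₀
  have hE'c : ContDiff ℝ ∞ E' := contDiff_expConjPhi τ z₀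
  have hqf : Integrable fun z => q z * f z :=
    hq.mul_bdd (c := M) hfm (Eventually.of_forall hfM)
  have hQi : Integrable Q := by
    have := hqf.bdd_mul (c := 1) (continuous_osc τ z₀).aestronglyMeasurable
      (Eventually.of_forall fun x => (norm_osc _ _ _).le)
    refine this.congr (Eventually.of_forall fun z => ?_)
    simp only [hQ]; ring
  have hfcs : ∀ {g : ℂ → ℂ}, Continuous g → HasCompactSupport g → Integrable fun z => f z * g z :=
    fun hg hc => (hg.integrable_of_hasCompactSupport hc).bdd_mul (c := M) hfm
      (Eventually.of_forall hfM)
  have hfloc : LocallyIntegrable f :=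
    (memLp_top_of_bound hfm M (Eventually.of_forall hfM)).locallyIntegrable le_top
  refine ⟨?_, ?_, fun φ hφ => ?_⟩
  · exact (hfloc.continuous_mul hEc.continuous).locallyIntegrableOn _
  · have := (hqf.locallyIntegrable.continuous_mul hEc.continuous).locallyIntegrableOn Ω
    have he : (fun z => q z * (E z * f z)) = fun z => E z * (q z * f z) := by
      ext z; ring
    change LocallyIntegrableOn (fun z => q z * (E z * f z)) Ω
    rw [he]
    exact this
  set θ := del φ with hθ
  have hθc : ContDiff ℝ ∞ θ := contDiff_del hφ.1
  have hθs : HasCompactSupport θ := hasCompactSupport_del hφ.2.1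
  have hθ0 : ∀ z ∉ Ω, θ z = 0 := fun z hz => by
    have h : ∀ v, fderiv ℝ φ z v = 0 := fun v => (hφ.fderiv_apply v).eq_zero hz
    simp [hθ, del, h]
  have hlap0 : ∀ z ∉ Ω, Laplacian.laplacian φ z = 0 := fun z hz => by
    rw [laplacian_eq_fderiv hφ.1, ((hφ.fderiv_apply 1).fderiv_apply 1).eq_zero hz,
      ((hφ.fderiv_apply Complex.I).fderiv_apply Complex.I).eq_zero hz, add_zero]
  rw [setIntegral_eq_integral_of_forall_compl_eq_zero fun z hz => by rw [hlap0 z hz, mul_zero],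
    setIntegral_eq_of_isTestFunction hφ]
  have hEθc : ContDiff ℝ ∞ fun z => E z * θ z := hEc.mul hθc
  have hEθs : HasCompactSupport fun z => E z * θ z := hθs.mul_left
  -- the antiholomorphic part is harmonic
  have hI1 : ∫ z, E' z * Laplacian.laplacian φ z = 0 := by
    simp_rw [laplacian_eq_del_dbar hφ.1, mul_left_comm (E' _)]
    rw [integral_const_mul, integral_mul_del hE'c (contDiff_dbar hφ.1)
      (hasCompactSupport_dbar hφ.2.1)]
    simp [hE', del_expConjPhi]
  have hI0 : ∫ z, E' z * θ z = 0 := by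
    rw [hθ, integral_mul_del hE'c hφ.1 hφ.2.1]
    simp [hE', del_expConjPhi]
  have hdb : ∀ z, dbar (fun w => E w * θ w) z = E z * dbar θ z := fun z => by
    rw [dbar_mul (hEc.differentiable (by simp)) (hθc.differentiable (by simp)), hE, dbar_expPhi,
      zero_mul, add_zero]
  have hI2 : ∫ z, dbarInv Ψ z * (E z * dbar θ z) = -∫ z, Ψ z * (E z * θ z) := by
    simp_rw [← hdb]
    rw [integral_dbarInv_mul hΨ (continuous_dbar hEθc) (hasCompactSupport_dbar hEθs)]
    simp_rw [dbarInv_dbar (hEθc.of_le (by simp)) hEθs]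
  have hE'φc : ContDiff ℝ ∞ fun z => E' z * φ z := hE'c.mul hφ.1
  have hE'φs : HasCompactSupport fun z => E' z * φ z := hφ.2.1.mul_left
  have hdel : ∀ z, del (fun w => E' w * φ w) z = E' z * θ z := fun z => by
    rw [del_mul (hE'c.differentiable (by simp)) (hφ.1.differentiable (by simp)), hE',
      del_expConjPhi, zero_mul, add_zero]
  have hI3 : ∫ z, dInv Q z * (E' z * θ z) = -∫ z, Q z * (E' z * φ z) := by
    simp_rw [← hdel]
    rw [integral_dInv_mul hQi (contDiff_del hE'φc).continuous (hasCompactSupport_del hE'φs)]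
    simp_rw [dInv_del (hE'φc.of_le (by simp)) hE'φs]
  have hΨpt : ∀ z, Ψ z * (E z * θ z) = b * (E' z * θ z) - dInv Q z * (E' z * θ z) := by
    intro z
    by_cases hz : z ∈ Ω
    · rw [hΨdef, φ₁Density, hχ1 z hz, hE', ← expPhi_mul_osc_neg]; ring
    · rw [hθ0 z hz]; ring
  have hiΨ : Integrable fun z => Ψ z * (E z * θ z) := by
    obtain ⟨K, hK⟩ := hEθs.exists_bound_of_continuous hEθc.continuous
    exact hΨ.mul_bdd (c := K) hEθc.continuous.aestronglyMeasurable (Eventually.of_forall hK)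
  have hiE'θ : Integrable fun z => E' z * θ z :=
    (hE'c.continuous.mul hθc.continuous).integrable_of_hasCompactSupport hθs.mul_left
  have hidQ : Integrable fun z => dInv Q z * (E' z * θ z) := by
    refine ((hiE'θ.const_mul b).sub hiΨ).congr (Eventually.of_forall fun z => ?_)
    simp only [Pi.sub_apply, hΨpt]; ring
  have hI4 : ∫ z, Ψ z * (E z * θ z) = ∫ z, q z * (E z * f z) * φ z := by
    simp_rw [hΨpt]
    rw [integral_sub (hiE'θ.const_mul b) hidQ, integral_const_mul, hI0, hI3, mul_zero, zero_sub,
      neg_neg]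
    refine integral_congr_ae (Eventually.of_forall fun z => ?_)
    simp only [hQ, hE]
    rw [← osc_mul_expConjPhi]
    ring
  have hupt : ∀ z, E z * f z * Laplacian.laplacian φ z =
      E' z * Laplacian.laplacian φ z + dbarInv Ψ z * (E z * dbar θ z) := by
    intro z
    have h1 : f z = osc (-τ) z₀ z + 1 / 4 * dbarInv Ψ z := hf z
    rw [h1, hE', ← expPhi_mul_osc_neg, laplacian_eq_dbar_del hφ.1]
    ring
  have hlapc : Continuous (Laplacian.laplacian φ) := by
    have : Laplacian.laplacian φ = fun z => 4 * dbar θ z := by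
      ext z; exact laplacian_eq_dbar_del hφ.1 z
    rw [this]
    exact continuous_const.mul (continuous_dbar hθc)
  have hlaps : HasCompactSupport (Laplacian.laplacian φ) := by
    have : Laplacian.laplacian φ = fun z => 4 * dbar θ z := by
      ext z; exact laplacian_eq_dbar_del hφ.1 z
    rw [this]
    exact (hasCompactSupport_dbar hθs).mul_left
  have hi1 : Integrable fun z => E' z * Laplacian.laplacian φ z :=
    (hE'c.continuous.mul hlapc).integrable_of_hasCompactSupport hlaps.mul_left
  have hi2 : Integrable fun z => dbarInv Ψ z * (E z * dbar θ z) := by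
    have h1 := hfcs (hEc.continuous.mul hlapc) hlaps.mul_left
    refine (h1.sub hi1).congr (Eventually.of_forall fun z => ?_)
    have := hupt z
    simp only [Pi.sub_apply, Pi.mul_apply]
    linear_combination this
  have hfinal : ∫ z, E z * f z * Laplacian.laplacian φ z = -∫ z, q z * (E z * f z) * φ z := by
    simp_rw [hupt]
    rw [integral_add hi1 hi2, hI1, hI2, hI4, zero_add]
  change (∫ z, E z * f z * Laplacian.laplacian φ z) + ∫ z, q z * (E z * f z) * φ z = 0
  rw [hfinal]
  ring

/-! ### The first family of solutions -/

/-- The solutions `e^{iτΦ} f₁`, with the rate `α = holderExp p / 4`. -/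
theorem cgo_first_case {p : ℝ} (hp₁ : 1 < p) (hp₂ : p < 2) (χ q : ℂ → ℂ) (B : ℝ)
    (hq : MemLp q (ENNReal.ofReal p)) :
    ∃ C τ₀ : ℝ, 0 < C ∧ 1 ≤ τ₀ ∧
      ∀ Ω X : Set ℂ, UsualAssumptions Ω X χ → (∀ z ∉ Ω, q z = 0) →
      ∀ β : ℂ → ℂ, (∀ z₀, ‖β z₀‖ ≤ B) →
      ∀ (z₀ : ℂ) (τ : ℝ), 1 < τ →
        φ₁Converges χ q τ z₀ (β z₀) ∧
        (∀ m, 1 ≤ m → S₁Converges χ q τ z₀ (F₁ χ q τ z₀ (β z₀) m)) ∧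
        (∀ m, ∀ z ∈ X, ‖F₁ χ q τ z₀ (β z₀) m z‖ ≤ (C * τ ^ (-(holderExp p / 4))) ^ m) ∧
        (τ₀ < τ →
          TendstoUniformlyOn
            (fun N z => ∑ m ∈ Finset.range N, F₁ χ q τ z₀ (β z₀) m z)
            (f₁ χ q τ z₀ (β z₀)) atTop X ∧
          MemW12 X (f₁ χ q τ z₀ (β z₀)) ∧
          IsDistribSolution Ω q (fun z =>
            Complex.exp (Complex.I * τ * Phi z₀ z) * f₁ χ q τ z₀ (β z₀) z)) := by
  -- the constants depend on `χ` and `q` only, so admissible domains may be assumed to exist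
  by_cases hex : ∃ Ω X : Set ℂ, UsualAssumptions Ω X χ ∧ ∀ z ∉ Ω, q z = 0
  swap
  · exact ⟨1, 1, one_pos, le_rfl, fun Ω X hU hq0 => absurd ⟨Ω, X, hU, hq0⟩ hex⟩
  obtain ⟨Ω', X', hU', hq0'⟩ := hex
  obtain ⟨R, hR⟩ := hU'.compact_cutoff.isBounded.subset_closedBall (0 : ℂ)
  have hχ := hU'.smooth_cutoff
  have hχc := hχ.continuous
  have hpot : ∀ {Q : ℂ → ℂ} {M : ℝ}, AEStronglyMeasurable Q → (∀ v, ‖Q v‖ ≤ M * ‖q v‖) →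
      Potential p R Q := by
    intro Q M hQm hQ
    refine ⟨hp₁, hq.of_le_mul hQm (Eventually.of_forall hQ), fun z hz => ?_⟩
    have hqz : q z = 0 := hq0' z fun hzΩ => hz (hR (subset_tsupport χ (by
      simp [hU'.cutoff_eq_one z hzΩ])))
    have := hQ z
    rwa [hqz, norm_zero, mul_zero, norm_le_zero_iff] at this
  have hqp : Potential p R q := hpot (M := 1) hq.1 fun v => by simp
  have hα : 0 < holderExp p / 4 := by have := holderExp_pos hp₁; positivity
  set α := holderExp p / 4 with hαdef
  obtain ⟨C₀, hC₀, hdec⟩ := exists_isDecayConst hqp hχ hU'.compact_cutoff hR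
  set C := C₀ * (|B| + 1) + 1 with hC
  have hCpos : 0 < C := by positivity
  refine ⟨C, max 1 (C ^ (1 / α)), hCpos, le_max_left _ _, ?_⟩
  intro Ω X hU hq0 β hβ z₀ τ hτ
  have hC' : C₀ * (‖β z₀‖ + 1) ≤ C := by
    have h1 : ‖β z₀‖ ≤ |B| := (hβ z₀).trans (le_abs_self B)
    have h2 : C₀ * (‖β z₀‖ + 1) ≤ C₀ * (|B| + 1) := by gcongr
    linarith
  have hF := norm_F₁_le (z₀ := z₀) hdec hC₀ hχc hq.1 hτ hC'
  refine ⟨φ₁Converges_of_isDecayConst hdec hq.1 hτ,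
    fun m _ => S₁Converges_F₁ hdec hC₀ hχc hq.1 hτ m, fun m z _ => hF m z, fun hτ₀ => ?_⟩
  have hτ0 : 0 < τ := by linarith
  have hr₀ : 0 ≤ C * τ ^ (-α) := by positivity
  have hr₁ : C * τ ^ (-α) < 1 := by
    have h1 : C ^ (1 / α) < τ := (le_max_right _ _).trans_lt hτ₀
    have h2 : C < τ ^ α := by
      have := Real.rpow_lt_rpow (by positivity) h1 hα
      rwa [← Real.rpow_mul hCpos.le, one_div_mul_cancel hα.ne', Real.rpow_one] at this
    rw [Real.rpow_neg hτ0.le, ← div_eq_mul_inv, div_lt_one (by positivity)]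
    exact h2
  have hfm := aestronglyMeasurable_f₁ hr₀ hr₁ hF hχc hq.1
  have hfb := norm_f₁_le hr₀ hr₁ hF
  have heq := f₁_eq hdec hχc hq.1 hτ hr₀ hr₁ hF
  have hQ := hpot (aestronglyMeasurable_osc_mul_mul τ z₀ hq.1 hfm)
    (norm_osc_mul_mul_le τ z₀ q hfb)
  have hΨ := memLp_two_φ₁Density hp₂ hQ hχc hR τ z₀ (β z₀)
  refine ⟨tendstoUniformlyOn_tsum_nat (summable_geometric_of_lt_one hr₀ hr₁) fun m z _ => hF m z,
    memW12_of_eq hU.isOpen_outer hU.isBounded_outer hR hΨ heq, ?_⟩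
  refine isDistribSolution_of_eq hU.cutoff_eq_one hfm hfb ?_ ?_ heq
  · exact integrable_of_memLp_of_eq_zero (by simpa using hp₁.le) hq hqp.eq_zero
  · exact integrable_of_memLp_of_eq_zero (by norm_num) hΨ
      fun z hz => φ₁Density_eq_zero hR _ τ z₀ _ hz

/-! ### Reflection in the real axis -/

/-- The reflected function `z ↦ u (z̄)`. Reflection exchanges `∂⁻¹` with `∂̄⁻¹`, and with them the
two families of solutions. -/
def reflect (u : ℂ → ℂ) (z : ℂ) : ℂ := u (conj z)

theorem measurePreserving_conj : MeasurePreserving (fun z : ℂ => conj z) :=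
  Complex.conjLIE.measurePreserving

theorem measurableEmbedding_conj : MeasurableEmbedding (fun z : ℂ => conj z) :=
  Complex.conjLIE.toHomeomorph.measurableEmbedding

theorem integral_comp_conj (g : ℂ → ℂ) : ∫ w, g (conj w) = ∫ w, g w :=
  measurePreserving_conj.integral_comp measurableEmbedding_conj g

theorem integrable_comp_conj (g : ℂ → ℂ) : Integrable (fun w => g (conj w)) ↔ Integrable g :=
  measurePreserving_conj.integrable_comp_emb measurableEmbedding_conj

theorem dInv_eq_dbarInv_reflect (u : ℂ → ℂ) (z : ℂ) :
    dInv u z = dbarInv (reflect u) (conj z) := by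
  rw [dInv, dbarInv, ← integral_comp_conj]
  simp [reflect]

theorem dbarInv_eq_dInv_reflect (u : ℂ → ℂ) (z : ℂ) :
    dbarInv u z = dInv (reflect u) (conj z) := by
  rw [dInv, dbarInv, ← integral_comp_conj]
  simp [reflect]

theorem dInvConverges_iff_reflect (u : ℂ → ℂ) (z : ℂ) :
    DInvConverges u z ↔ DbarInvConverges (reflect u) (conj z) := by
  rw [DInvConverges, DbarInvConverges, ← integrable_comp_conj]
  simp [reflect]

theorem dbarInvConverges_iff_reflect (u : ℂ → ℂ) (z : ℂ) :
    DbarInvConverges u z ↔ DInvConverges (reflect u) (conj z) := by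
  rw [DInvConverges, DbarInvConverges, ← integrable_comp_conj]
  simp [reflect]

theorem Phi_conj (z₀ z : ℂ) : Phi (conj z₀) (conj z) = conj (Phi z₀ z) := by
  simp [Phi]

theorem osc_conj (s : ℝ) (z₀ z : ℂ) : osc s (conj z₀) (conj z) = osc s z₀ z := by
  rw [osc, osc, Phi_conj, Complex.conj_conj, add_comm]

theorem reflect_osc_mul_mul (q : ℂ → ℂ) (s : ℝ) (z₀ : ℂ) (f : ℂ → ℂ) :
    reflect (fun v => osc s z₀ v * q v * f v) =
      fun v => osc s (conj z₀) v * reflect q v * reflect f v := by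
  ext v
  simp only [reflect]
  rw [← osc_conj, Complex.conj_conj]

theorem reflect_S₂Density (χ q : ℂ → ℂ) (τ : ℝ) (z₀ : ℂ) (f : ℂ → ℂ) :
    reflect (S₂Density χ q τ z₀ f) =
      S₁Density (reflect χ) (reflect q) τ (conj z₀) (reflect f) := by
  ext w
  rw [S₁Density, ← reflect_osc_mul_mul, reflect, S₂Density, dbarInv_eq_dInv_reflect,
    Complex.conj_conj, ← osc_conj, Complex.conj_conj, reflect]

theorem reflect_φ₂Density (χ q : ℂ → ℂ) (τ : ℝ) (z₀ b : ℂ) :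
    reflect (φ₂Density χ q τ z₀ b) = φ₁Density (reflect χ) (reflect q) τ (conj z₀) b := by
  ext w
  rw [φ₁Density, reflect, φ₂Density, dbarInv_eq_dInv_reflect, Complex.conj_conj, ← osc_conj,
    Complex.conj_conj, reflect]

theorem reflect_S₂ (χ q : ℂ → ℂ) (τ : ℝ) (z₀ : ℂ) (f : ℂ → ℂ) :
    reflect (S₂ χ q τ z₀ f) = S₁ (reflect χ) (reflect q) τ (conj z₀) (reflect f) := by
  ext z
  rw [S₁, ← reflect_S₂Density, reflect, S₂, dInv_eq_dbarInv_reflect, Complex.conj_conj]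

theorem reflect_φ₂ (χ q : ℂ → ℂ) (τ : ℝ) (z₀ b : ℂ) :
    reflect (φ₂ χ q τ z₀ b) = φ₁ (reflect χ) (reflect q) τ (conj z₀) b := by
  ext z
  rw [φ₁, ← reflect_φ₂Density, reflect, φ₂, dInv_eq_dbarInv_reflect, Complex.conj_conj]

theorem reflect_F₂ (χ q : ℂ → ℂ) (τ : ℝ) (z₀ b : ℂ) (m : ℕ) :
    reflect (F₂ χ q τ z₀ b m) = F₁ (reflect χ) (reflect q) τ (conj z₀) b m := by
  cases m with
  | zero =>
    ext z
    rw [reflect, F₂, F₁, ← osc_conj, Complex.conj_conj]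
  | succ m =>
    rw [F₂, F₁]
    induction m with
    | zero => exact reflect_φ₂ χ q τ z₀ b
    | succ m ih => rw [Function.iterate_succ_apply', Function.iterate_succ_apply', reflect_S₂, ih]

theorem F₂_eq (χ q : ℂ → ℂ) (τ : ℝ) (z₀ b : ℂ) (m : ℕ) (z : ℂ) :
    F₂ χ q τ z₀ b m z = F₁ (reflect χ) (reflect q) τ (conj z₀) b m (conj z) := by
  rw [← reflect_F₂, reflect, Complex.conj_conj]

theorem f₂_eq (χ q : ℂ → ℂ) (τ : ℝ) (z₀ b z : ℂ) :
    f₂ χ q τ z₀ b z = f₁ (reflect χ) (reflect q) τ (conj z₀) b (conj z) := by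
  simp_rw [f₂, f₁, F₂_eq]

theorem ae_conj {P : ℂ → Prop} (h : ∀ᵐ w : ℂ, P w) : ∀ᵐ w : ℂ, P (conj w) :=
  measurePreserving_conj.quasiMeasurePreserving.ae h

theorem φ₂Converges_of_reflect {χ q : ℂ → ℂ} {τ : ℝ} {z₀ b : ℂ}
    (h : φ₁Converges (reflect χ) (reflect q) τ (conj z₀) b) : φ₂Converges χ q τ z₀ b := by
  refine ⟨?_, fun z => ?_⟩
  · filter_upwards [ae_conj h.1] with w hw using (dbarInvConverges_iff_reflect _ _).mpr hw
  · rw [dInvConverges_iff_reflect, reflect_φ₂Density]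
    exact h.2 _

theorem S₂Converges_of_reflect {χ q : ℂ → ℂ} {τ : ℝ} {z₀ : ℂ} {f : ℂ → ℂ}
    (h : S₁Converges (reflect χ) (reflect q) τ (conj z₀) (reflect f)) :
    S₂Converges χ q τ z₀ f := by
  refine ⟨?_, fun z => ?_⟩
  · filter_upwards [ae_conj h.1] with w hw
    rw [dbarInvConverges_iff_reflect, reflect_osc_mul_mul]
    exact hw
  · rw [dInvConverges_iff_reflect, reflect_S₂Density]
    exact h.2 _

theorem IsTestFunction.reflect {U : Set ℂ} {φ : ℂ → ℂ} (h : IsTestFunction U φ) :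
    IsTestFunction ((fun z => conj z) ⁻¹' U) (reflect φ) := by
  refine ⟨h.1.comp Complex.conjCLE.contDiff,
    h.2.1.comp_homeomorph Complex.conjLIE.toHomeomorph, ?_⟩
  rw [show tsupport (BukhgeimCGO.reflect φ) = (fun z => conj z) ⁻¹' tsupport φ from
    tsupport_comp_eq_preimage φ Complex.conjLIE.toHomeomorph]
  exact Set.preimage_mono h.2.2

theorem UsualAssumptions.reflect {Ω X : Set ℂ} {χ : ℂ → ℂ} (h : UsualAssumptions Ω X χ) :
    UsualAssumptions ((fun z => conj z) ⁻¹' Ω) ((fun z => conj z) ⁻¹' X) (reflect χ) := by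
  have hb : ∀ {s : Set ℂ}, Bornology.IsBounded s →
      Bornology.IsBounded ((fun z : ℂ => conj z) ⁻¹' s) := fun hs =>
    Complex.conjLIE.antilipschitz.isBounded_preimage hs
  have ht : IsTestFunction X χ := ⟨h.smooth_cutoff, h.compact_cutoff, h.tsupport_cutoff⟩
  exact
    { isOpen_inner := h.isOpen_inner.preimage Complex.continuous_conj
      isConnected_inner :=
        Complex.conjLIE.toHomeomorph.isConnected_preimage.mpr h.isConnected_inner
      isBounded_inner := hb h.isBounded_inner
      isOpen_outer := h.isOpen_outer.preimage Complex.continuous_conj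
      isConnected_outer :=
        Complex.conjLIE.toHomeomorph.isConnected_preimage.mpr h.isConnected_outer
      isBounded_outer := hb h.isBounded_outer
      closure_subset := (Complex.conjLIE.toHomeomorph.preimage_closure Ω).symm.subset.trans
        (Set.preimage_mono h.closure_subset)
      smooth_cutoff := ht.reflect.1
      compact_cutoff := ht.reflect.2.1
      tsupport_cutoff := ht.reflect.2.2
      cutoff_eq_one := fun z hz => h.cutoff_eq_one _ hz }

theorem fderiv_reflect {φ : ℂ → ℂ} {z : ℂ} (h : DifferentiableAt ℝ φ (conj z)) (v : ℂ) :
    fderiv ℝ (reflect φ) z v = fderiv ℝ φ (conj z) (conj v) := by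
  have h2 : HasFDerivAt (fun z : ℂ => conj z) (Complex.conjCLE : ℂ →L[ℝ] ℂ) z :=
    Complex.conjCLE.hasFDerivAt
  have := (h.hasFDerivAt.comp z h2).fderiv
  change fderiv ℝ (φ ∘ fun z => conj z) z v = _
  rw [this]
  rfl

theorem laplacian_reflect {φ : ℂ → ℂ} (h : ContDiff ℝ ∞ φ) (z : ℂ) :
    Laplacian.laplacian (reflect φ) z = Laplacian.laplacian φ (conj z) := by
  have hr : ContDiff ℝ ∞ (reflect φ) := h.comp Complex.conjCLE.contDiff
  have key : ∀ v, fderiv ℝ (fun w => fderiv ℝ (reflect φ) w v) z v =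
      fderiv ℝ (fun w => fderiv ℝ φ w (conj v)) (conj z) (conj v) := by
    intro v
    have e : (fun w => fderiv ℝ (reflect φ) w v) =
        reflect (fun w => fderiv ℝ φ w (conj v)) := by
      ext w
      rw [fderiv_reflect (h.differentiable (by simp) _)]
      rfl
    rw [e, fderiv_reflect]
    exact (contDiff_fderiv_apply_const h _).differentiable (by simp) _
  have hd : DifferentiableAt ℝ (fun w => fderiv ℝ φ w Complex.I) (conj z) :=
    (contDiff_fderiv_apply_const h _).differentiable (by simp) _
  rw [laplacian_eq_fderiv hr, laplacian_eq_fderiv h, key, key]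
  simp [fderiv_fun_neg]

theorem setIntegral_reflect (U : Set ℂ) (g : ℂ → ℂ) :
    ∫ z in (fun z => conj z) ⁻¹' U, g (conj z) = ∫ z in U, g z :=
  measurePreserving_conj.setIntegral_preimage_emb measurableEmbedding_conj g U

theorem preimage_conj_preimage_conj (U : Set ℂ) :
    (fun z : ℂ => conj z) ⁻¹' ((fun z => conj z) ⁻¹' U) = U := by
  ext z
  simp

theorem memLp_restrict_reflect {U : Set ℂ} {f : ℂ → ℂ} {r : ENNReal}
    (hf : MemLp f r (volume.restrict U)) :
    MemLp (reflect f) r (volume.restrict ((fun z => conj z) ⁻¹' U)) :=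
  hf.comp_measurePreserving
    (measurePreserving_conj.restrict_preimage_emb measurableEmbedding_conj U)

/-- Reflection turns a derivative in the direction `v` into one in the direction `v̄`; for `v = i` this
is a change of sign. -/
theorem IsWeakDeriv.reflect {U : Set ℂ} {v : ℂ} {f g : ℂ → ℂ} (h : IsWeakDeriv U v f g) :
    IsWeakDeriv ((fun z => conj z) ⁻¹' U) (conj v) (reflect f) (reflect g) := by
  intro φ hφ
  have hφ' := hφ.reflect
  rw [preimage_conj_preimage_conj] at hφ'
  have e := h _ hφ'
  rw [← setIntegral_reflect U, ← setIntegral_reflect U] at e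
  convert e using 3 with z
  · rw [fderiv_reflect (hφ.1.differentiable (by simp) _), Complex.conj_conj]
    rfl
  · ext z
    simp [BukhgeimCGO.reflect]

theorem MemW12.reflect {U : Set ℂ} {f : ℂ → ℂ} (h : MemW12 U f) :
    MemW12 ((fun z => conj z) ⁻¹' U) (reflect f) := by
  obtain ⟨hf, g₁, g₂, hg₁, hg₂, hw₁, hw₂⟩ := h
  refine ⟨memLp_restrict_reflect hf, BukhgeimCGO.reflect g₁, -BukhgeimCGO.reflect g₂,
    memLp_restrict_reflect hg₁, (memLp_restrict_reflect hg₂).neg, ?_, fun φ hφ => ?_⟩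
  · simpa using hw₁.reflect
  · have := hw₂.reflect φ hφ
    simp only [Complex.conj_I, map_neg, mul_neg, integral_neg, neg_inj] at this
    simp only [Pi.neg_apply, neg_mul, integral_neg, neg_neg]
    exact this

theorem LocallyIntegrableOn.reflect {U : Set ℂ} {f : ℂ → ℂ} (h : LocallyIntegrableOn f U) :
    LocallyIntegrableOn (reflect f) ((fun z => conj z) ⁻¹' U) := by
  intro z hz
  obtain ⟨s, hs, hfs⟩ := h (conj z) hz
  refine ⟨(fun z => conj z) ⁻¹' s, ?_, ?_⟩
  · exact (Complex.continuous_conj.continuousWithinAt.tendsto_nhdsWithin fun _ hx => hx) hs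
  · exact (measurePreserving_conj.integrableOn_comp_preimage measurableEmbedding_conj).mpr hfs

theorem IsDistribSolution.reflect {U : Set ℂ} {q u : ℂ → ℂ} (h : IsDistribSolution U q u) :
    IsDistribSolution ((fun z => conj z) ⁻¹' U) (reflect q) (reflect u) := by
  refine ⟨LocallyIntegrableOn.reflect h.1, LocallyIntegrableOn.reflect h.2.1, fun φ hφ => ?_⟩
  have hφ' := hφ.reflect
  rw [preimage_conj_preimage_conj] at hφ'
  have e := h.2.2 _ hφ'
  rw [← setIntegral_reflect U, ← setIntegral_reflect U] at e
  simp_rw [laplacian_reflect hφ.1] at e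
  simpa [BukhgeimCGO.reflect] using e

/-- The solutions `e^{iτΦ̄} f₂`, obtained from `cgo_first_case` for the reflected cut-off, potential
and domains, at the reflected base point. -/
theorem cgo_second_case {p : ℝ} (hp₁ : 1 < p) (hp₂ : p < 2) (χ q : ℂ → ℂ) (B : ℝ)
    (hq : MemLp q (ENNReal.ofReal p)) :
    ∃ C τ₀ : ℝ, 0 < C ∧ 1 ≤ τ₀ ∧
      ∀ Ω X : Set ℂ, UsualAssumptions Ω X χ → (∀ z ∉ Ω, q z = 0) →
      ∀ β : ℂ → ℂ, (∀ z₀, ‖β z₀‖ ≤ B) →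
      ∀ (z₀ : ℂ) (τ : ℝ), 1 < τ →
        φ₂Converges χ q τ z₀ (β z₀) ∧
        (∀ m, 1 ≤ m → S₂Converges χ q τ z₀ (F₂ χ q τ z₀ (β z₀) m)) ∧
        (∀ m, ∀ z ∈ X, ‖F₂ χ q τ z₀ (β z₀) m z‖ ≤ (C * τ ^ (-(holderExp p / 4))) ^ m) ∧
        (τ₀ < τ →
          TendstoUniformlyOn
            (fun N z => ∑ m ∈ Finset.range N, F₂ χ q τ z₀ (β z₀) m z)
            (f₂ χ q τ z₀ (β z₀)) atTop X ∧
          MemW12 X (f₂ χ q τ z₀ (β z₀)) ∧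
          IsDistribSolution Ω q (fun z =>
            Complex.exp (Complex.I * τ * conj (Phi z₀ z)) * f₂ χ q τ z₀ (β z₀) z)) := by
  obtain ⟨C, τ₀, hC, hτ₀, h⟩ := cgo_first_case hp₁ hp₂ (reflect χ) (reflect q) B
    (hq.comp_measurePreserving measurePreserving_conj)
  refine ⟨C, τ₀, hC, hτ₀, fun Ω X hU hq0 β hβ z₀ τ hτ => ?_⟩
  obtain ⟨h₁, h₂, h₃, h₄⟩ := h _ _ hU.reflect (fun z hz => hq0 _ hz) (fun z => β (conj z))
    (fun z => hβ _) (conj z₀) τ hτ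
  simp only [Complex.conj_conj] at h₁ h₂ h₃ h₄
  have hf : f₂ χ q τ z₀ (β z₀) = reflect (f₁ (reflect χ) (reflect q) τ (conj z₀) (β z₀)) :=
    funext fun z => f₂_eq _ _ _ _ _ z
  refine ⟨φ₂Converges_of_reflect h₁, fun m hm => S₂Converges_of_reflect ?_, fun m z hz => ?_,
    fun hτ' => ?_⟩
  · rw [reflect_F₂]
    exact h₂ m hm
  · rw [F₂_eq]
    exact h₃ m _ (by simpa using hz)
  · obtain ⟨hu, hw, hd⟩ := h₄ hτ'
    refine ⟨?_, ?_, ?_⟩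
    · have := hu.comp fun z : ℂ => conj z
      rw [preimage_conj_preimage_conj] at this
      simp_rw [F₂_eq, hf]
      exact this
    · have := hw.reflect
      rwa [preimage_conj_preimage_conj, ← hf] at this
    · have := hd.reflect
      rw [preimage_conj_preimage_conj] at this
      convert this using 1
      · ext z; simp [reflect]
      · ext z
        rw [hf, reflect, reflect, Phi_conj]

end BukhgeimCGO

open BukhgeimCGO in
theorem theorem2p2 (p : ℝ) (hp₁ : 1 < p) (hp₂ : p < 2) :
    ∃ α : ℝ, 0 < α ∧ α < 1 / p ∧
      -- the case `j = 1`
      (∀ (χ q₁ : ℂ → ℂ) (B : ℝ), MemLp q₁ (ENNReal.ofReal p) →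
        ∃ C τ₀ : ℝ, 0 < C ∧ 1 ≤ τ₀ ∧
          ∀ Ω X : Set ℂ, UsualAssumptions Ω X χ → (∀ z ∉ Ω, q₁ z = 0) →
          ∀ β₁ : ℂ → ℂ, (∀ z₀, ‖β₁ z₀‖ ≤ B) →
          ∀ (z₀ : ℂ) (τ : ℝ), 1 < τ →
            φ₁Converges χ q₁ τ z₀ (β₁ z₀) ∧
            (∀ m, 1 ≤ m → S₁Converges χ q₁ τ z₀ (F₁ χ q₁ τ z₀ (β₁ z₀) m)) ∧
            (∀ m, ∀ z ∈ X, ‖F₁ χ q₁ τ z₀ (β₁ z₀) m z‖ ≤ (C * τ ^ (-α)) ^ m) ∧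
            (τ₀ < τ →
              TendstoUniformlyOn
                (fun N z => ∑ m ∈ Finset.range N, F₁ χ q₁ τ z₀ (β₁ z₀) m z)
                (f₁ χ q₁ τ z₀ (β₁ z₀)) atTop X ∧
              MemW12 X (f₁ χ q₁ τ z₀ (β₁ z₀)) ∧
              IsDistribSolution Ω q₁ (fun z =>
                Complex.exp (Complex.I * τ * Phi z₀ z) * f₁ χ q₁ τ z₀ (β₁ z₀) z))) ∧
      -- the case `j = 2`
      (∀ (χ q₂ : ℂ → ℂ) (B : ℝ), MemLp q₂ (ENNReal.ofReal p) →
        ∃ C τ₀ : ℝ, 0 < C ∧ 1 ≤ τ₀ ∧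
          ∀ Ω X : Set ℂ, UsualAssumptions Ω X χ → (∀ z ∉ Ω, q₂ z = 0) →
          ∀ β₂ : ℂ → ℂ, (∀ z₀, ‖β₂ z₀‖ ≤ B) →
          ∀ (z₀ : ℂ) (τ : ℝ), 1 < τ →
            φ₂Converges χ q₂ τ z₀ (β₂ z₀) ∧
            (∀ m, 1 ≤ m → S₂Converges χ q₂ τ z₀ (F₂ χ q₂ τ z₀ (β₂ z₀) m)) ∧
            (∀ m, ∀ z ∈ X, ‖F₂ χ q₂ τ z₀ (β₂ z₀) m z‖ ≤ (C * τ ^ (-α)) ^ m) ∧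
            (τ₀ < τ →
              TendstoUniformlyOn
                (fun N z => ∑ m ∈ Finset.range N, F₂ χ q₂ τ z₀ (β₂ z₀) m z)
                (f₂ χ q₂ τ z₀ (β₂ z₀)) atTop X ∧
              MemW12 X (f₂ χ q₂ τ z₀ (β₂ z₀)) ∧
              IsDistribSolution Ω q₂ (fun z =>
                Complex.exp (Complex.I * τ * conj (Phi z₀ z)) *
                  f₂ χ q₂ τ z₀ (β₂ z₀) z))) := by
  have hα := holderExp_pos hp₁
  have hα' := holderExp_lt_one hp₁
  refine ⟨holderExp p / 4, by positivity, ?_, cgo_first_case hp₁ hp₂, cgo_second_case hp₁ hp₂⟩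
  have : 1 / 2 < 1 / p := one_div_lt_one_div_of_lt (by linarith) hp₂
  linarith
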